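/- Let $n\ge 2$, $g>0$, $\bar\rho_0>0$, and let $p\in C^2((0,\infty))$ satisfy $p(\bar\rho_0)=0$ and $p'(\rho)>0$, $2p'(\rho)+\rho p''(\rho)>0$ for all $\rho\ge\bar\rho_0$. Put $h(\rho)=\int_{\bar\rho_0}^{\rho}\frac{p'(s)}{s}\,ds$ and $y^{\mathrm{st}}=\frac{p'(\bar\rho_0)}{2g}$. For $0\le s<y^{\mathrm{st}}$ let $\rho_{\mathrm{cr}}(s)$ be the largest solution $\rho>0$ of $\frac{p'(\rho)}2+h(\rho)=gs$ (and $\rho_{\mathrm{cr}}(s)=0$ if there is none), and for $t\ge0$ let $H(t;s)$ be the unique $\rho>\rho_{\mathrm{cr}}(s)$ with $2\rho^2\,(gs-h(\rho))=2\bar\rho_0^2\,g\,t$, whenever it exists; write $H_0=H(0;0)=\bar\rho_0$. Let $$F(t;s)=\int_0^t\frac{d\tau}{H(\tau;s)},\qquad \lambda(s)=2s\,\partial_1F(s;s)-F(s;s).$$ (On $\{u=0\}$, where $\nabla u=0$ a.e., all integrands below are $0$.) Let $\Omega\subset\mathbb R^n$ be a bounded domain with $\Omega\cap\{x_n=0\}\ne\varnothing$.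 A function $u\in W^{1,2}_{\mathrm{loc}}(\Omega)$ is a subsonic variational solution in $\Omega$ if 1. $u\ge0$ in $\Omega$, $u=0$ in $\Omega\cap\{x_n\le0\}$, and $x_n<y^{\mathrm{st}}$ in $\Omega\cap\{u>0\}$; 2. $u\in C^0(\Omega)\cap C^2(\Omega\cap\{u>0\})$; 3. there is $\varepsilon_0>0$ such that, for a.e. $x\in\Omega\cap\{u>0\}$, $H(|\nabla u|^2;x_n)$ exists and $H(|\nabla u|^2;x_n)-\rho_{\mathrm{cr}}(x_n)\ge\varepsilon_0$; 4. for every $\phi\in C^1_0(\Omega;\mathbb R^n)$, $$\begin{aligned}0=&\int_\Omega\big(F(|\nabla u|^2;x_n)+\lambda(x_n)\chi_{\{u>0\}}\big)\operatorname{div}\phi\,dx-2\int_\Omega\partial_1F(|\nabla u|^2;x_n)\,\nabla u\,D\phi\,\nabla u\,dx\\&+\int_\Omega\big(\lambda'(x_n)\chi_{\{u>0\}}+\partial_2F(|\nabla u|^2;x_n)\big)\phi_n\,dx.\end{aligned}$$ Let $u$ be such a solution, assume that $|\nabla u|^2\le C x_n^+$ locally in $\Omega$ (i.e. for every compact $K\subset\Omega$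 there is a constant $C$ such that this holds a.e. in $K$), let $x^\circ\in\Omega\cap\partial\{u>0\}$ with $x^\circ_n=0$, and let, for small $r>0$, $$\Phi(x^\circ,u;r)=r^{-n-1}\int_{B_r(x^\circ)}\big(F(|\nabla u|^2;x_n)+\lambda(x_n)\chi_{\{u>0\}}\big)dx-\frac32\,r^{-n-2}\int_{\partial B_r(x^\circ)}\frac{u^2}{H_0}\,d\mathcal H^{n-1}.$$ Then: (1) The limit $\Phi(x^\circ,u;0^+)=\lim_{r\to0^+}\Phi(x^\circ,u;r)$ exists and is finite. (2) Let $r_m\to0^+$ be such that $u_m(x)=u(x^\circ+r_mx)/r_m^{3/2}$ converges weakly in $W^{1,2}_{\mathrm{loc}}(\mathbb R^n)$ to some $u_0\in W^{1,2}_{\mathrm{loc}}(\mathbb R^n)$. Then $u_0$ is (after modification on a null set) homogeneous of degree $3/2$: $u_0(cx)=c^{3/2}u_0(x)$ for all $c>0$ and all $x$. (3) In the situation of (2), $u_m\to u_0$ strongly in $W^{1,2}_{\mathrm{loc}}(\mathbb R^n)$. -/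

import Mathlib

open MeasureTheory Set Filter Topology Metric
open scoped ContDiff

noncomputable section

/-- Data of a compressible liquid under gravity: the constant density `rho0 > 0` on the free
surface, the gravitational constant `g > 0`, and the equation of state `p = p(ρ)`. -/
structure CompressibleLiquid where
  p : ℝ → ℝ
  rho0 : ℝ
  g : ℝ
  rho0_pos : 0 < rho0
  g_pos : 0 < g
  contDiffOn_p : ContDiffOn ℝ 2 p (Ioi 0)
  p_rho0 : p rho0 = 0
  deriv_p_pos : ∀ ρ, rho0 ≤ ρ → 0 < deriv p ρ
  stiffness : ∀ ρ, rho0 ≤ ρ → 0 < 2 * deriv p ρ + ρ * deriv (deriv p) ρ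

namespace CompressibleLiquid

variable (L : CompressibleLiquid)

/-- The enthalpy `h(ρ) = ∫_{ρ₀}^{ρ} p'(s) / s ds`. -/
def enthalpy (ρ : ℝ) : ℝ := ∫ s in L.rho0..ρ, deriv L.p s / s

/-- The stagnation height `p'(ρ₀) / (2g)`. In terms of the depth `s = stagnationHeight - y_n`
below it, Bernoulli's law reads `q ^ 2 / 2 + h(ρ) = g * s`. -/
def stagnationHeight : ℝ := deriv L.p L.rho0 / (2 * L.g)

/-- The critical density at depth `s` below the stagnation height: the (largest) positive
solution of `p'(ρ) / 2 + h(ρ) = g * s`, i.e. of `p'(ρ) / 2 + h(ρ) + g * y_n = p'(ρ₀) / 2` with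
`y_n = stagnationHeight - s`. It is `0` if there is no solution; for `0 ≤ s < stagnationHeight`
this means that all densities are subsonic. -/
def criticalDensity (s : ℝ) : ℝ :=
  sSup {ρ | 0 < ρ ∧ deriv L.p ρ / 2 + L.enthalpy ρ = L.g * s}

/-- `ρ` is a subsonic density at depth `s` for which Bernoulli's law
`|∇ψ|² / (2ρ²) + h(ρ) = g * s` holds with `|∇ψ|² = 2 ρ₀² g t`; here `ψ = ρ₀ (2g)^(1/2) u` and
`t = |∇u|²`. -/
def IsSubsonicDensity (t s ρ : ℝ) : Prop :=
  L.criticalDensity s < ρ ∧ 2 * ρ ^ 2 * (L.g * s - L.enthalpy ρ) = 2 * L.rho0 ^ 2 * L.g * t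

/-- The density `H(t; s)` as a function of `t = |∇u|²` and the depth `s = x_n`: the unique
subsonic solution of Bernoulli's law (and `0` if there is none). -/
def H (t s : ℝ) : ℝ := sSup {ρ | L.IsSubsonicDensity t s ρ}

/-- `F(t; s) = ∫₀ᵗ 1 / H(τ; s) dτ`. -/
def F (t s : ℝ) : ℝ := ∫ τ in (0 : ℝ)..t, 1 / L.H τ s

/-- `∂₁F(t; s) = 1 / H(t; s)`. -/
def dF1 (t s : ℝ) : ℝ := 1 / L.H t s

/-- `∂₂F(t; s)`. -/
def dF2 (t s : ℝ) : ℝ := deriv (fun σ => L.F t σ) s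

/-- `Λ(t; s) = 2 t ∂₁F(t; s) - F(t; s)`. -/
def Lam (t s : ℝ) : ℝ := 2 * t * L.dF1 t s - L.F t s

/-- `λ(s) = Λ(s; s)`. -/
def lam (s : ℝ) : ℝ := L.Lam s s

end CompressibleLiquid

/-- `ℝⁿ` with `n = d + 1`, so that `x (Fin.last d)` is the last coordinate `x_n`. -/
abbrev Euc (d : ℕ) : Type := EuclideanSpace ℝ (Fin (d + 1))

/-- The last coordinate `x_n`. -/
def lastCoord {d : ℕ} (x : Euc d) : ℝ := x (Fin.last d)

/-- The divergence of a vector field. -/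
def divergence {d : ℕ} (φ : Euc d → Euc d) (x : Euc d) : ℝ :=
  ∑ i, fderiv ℝ φ x (EuclideanSpace.single i 1) i

/-- `u ∈ W^{1,2}_loc(Ω)` with weak gradient `Du`. -/
structure MemW12Loc {d : ℕ} (Ω : Set (Euc d)) (u : Euc d → ℝ) (Du : Euc d → Euc d) : Prop where
  memLp_fun : ∀ K ⊆ Ω, IsCompact K → MemLp u 2 (volume.restrict K)
  memLp_grad : ∀ K ⊆ Ω, IsCompact K → MemLp Du 2 (volume.restrict K)
  integral_by_parts : ∀ η : Euc d → ℝ, ContDiff ℝ ∞ η → HasCompactSupport η → tsupport η ⊆ Ω →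
    ∀ i : Fin (d + 1), ∫ x in Ω, u x * fderiv ℝ η x (EuclideanSpace.single i 1) =
      - ∫ x in Ω, Du x i * η x

/-- Weak convergence `v m ⇀ v₀` in `W^{1,2}(B_R(0))` for every `R > 0`; `Dv m` and `Dv₀` are the
gradients. -/
def TendstoWeaklyW12Loc {d : ℕ} (v : ℕ → Euc d → ℝ) (Dv : ℕ → Euc d → Euc d)
    (v₀ : Euc d → ℝ) (Dv₀ : Euc d → Euc d) : Prop :=
  ∀ R : ℝ, 0 < R →
    (∀ f : Euc d → ℝ, MemLp f 2 (volume.restrict (ball 0 R)) →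
      Tendsto (fun m => ∫ x in ball 0 R, v m x * f x) atTop
        (𝓝 (∫ x in ball 0 R, v₀ x * f x))) ∧
    (∀ f : Euc d → Euc d, MemLp f 2 (volume.restrict (ball 0 R)) →
      Tendsto (fun m => ∫ x in ball 0 R, inner ℝ (Dv m x) (f x)) atTop
        (𝓝 (∫ x in ball 0 R, inner ℝ (Dv₀ x) (f x))))

/-- Strong convergence `v m → v₀` in `W^{1,2}(B_R(0))` for every `R > 0`. -/
def TendstoStronglyW12Loc {d : ℕ} (v : ℕ → Euc d → ℝ) (Dv : ℕ → Euc d → Euc d)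
    (v₀ : Euc d → ℝ) (Dv₀ : Euc d → Euc d) : Prop :=
  ∀ R : ℝ, 0 < R →
    Tendsto (fun m => eLpNorm (v m - v₀) 2 (volume.restrict (ball 0 R))) atTop (𝓝 0) ∧
    Tendsto (fun m => eLpNorm (Dv m - Dv₀) 2 (volume.restrict (ball 0 R))) atTop (𝓝 0)

/-- The positivity set `{u > 0}` in `Ω`. -/
def posSet {d : ℕ} (Ω : Set (Euc d)) (u : Euc d → ℝ) : Set (Euc d) := {x | x ∈ Ω ∧ 0 < u x}

/-- The characteristic function of `{u > 0}`. -/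
def chiPos {d : ℕ} (u : Euc d → ℝ) : Euc d → ℝ := {x | 0 < u x}.indicator 1

/-- `u`, with weak gradient `Du`, is a subsonic variational solution in `Ω`. -/
structure IsSubsonicVariationalSolution (L : CompressibleLiquid) {d : ℕ} (Ω : Set (Euc d))
    (u : Euc d → ℝ) (Du : Euc d → Euc d) : Prop where
  isOpen : IsOpen Ω
  isConnected : IsConnected Ω
  isBounded : Bornology.IsBounded Ω
  meets_hyperplane : ∃ x ∈ Ω, lastCoord x = 0
  /- The fluid lies above the height `y_n = 0`, i.e. at depths where the free surface is subsonic;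
  `λ` is defined at these depths only. -/
  lastCoord_lt : ∀ x ∈ posSet Ω u, lastCoord x < L.stagnationHeight
  memW12Loc : MemW12Loc Ω u Du
  nonneg : ∀ x ∈ Ω, 0 ≤ u x
  eq_zero : ∀ x ∈ Ω, lastCoord x ≤ 0 → u x = 0
  continuousOn : ContinuousOn u Ω
  contDiffOn : ContDiffOn ℝ 2 u (posSet Ω u)
  subsonic : ∃ ε₀ : ℝ, 0 < ε₀ ∧ ∀ᵐ x ∂(volume.restrict (posSet Ω u)),
    L.IsSubsonicDensity (‖Du x‖ ^ 2) (lastCoord x) (L.H (‖Du x‖ ^ 2) (lastCoord x)) ∧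
      ε₀ ≤ L.H (‖Du x‖ ^ 2) (lastCoord x) - L.criticalDensity (lastCoord x)
  domain_variation : ∀ φ : Euc d → Euc d, ContDiff ℝ 1 φ → HasCompactSupport φ →
    tsupport φ ⊆ Ω →
    (∫ x in Ω, (L.F (‖Du x‖ ^ 2) (lastCoord x) + L.lam (lastCoord x) * chiPos u x)
        * divergence φ x)
      - 2 * (∫ x in Ω, L.dF1 (‖Du x‖ ^ 2) (lastCoord x) * inner ℝ (Du x) (fderiv ℝ φ x (Du x)))
      + (∫ x in Ω, (deriv L.lam (lastCoord x) * chiPos u x + L.dF2 (‖Du x‖ ^ 2) (lastCoord x))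
        * lastCoord (φ x)) = 0

/-- The growth condition `|∇u|² ≤ C x_n⁺` locally in `Ω`. -/
def HasLocalGrowth {d : ℕ} (Ω : Set (Euc d)) (Du : Euc d → Euc d) : Prop :=
  ∀ K ⊆ Ω, IsCompact K → ∃ C : ℝ, ∀ᵐ x ∂(volume.restrict K), ‖Du x‖ ^ 2 ≤ C * max (lastCoord x) 0

/-- The surface integral of `f` over the sphere `∂B_r(x₀)` in `ℝⁿ`, `n = d + 1`, in polar
coordinates: `r^(n-1)` times the integral of `f (x₀ + r z)` with respect to the surface measure
of the unit sphere. -/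
def sphereIntegral {d : ℕ} (f : Euc d → ℝ) (x₀ : Euc d) (r : ℝ) : ℝ :=
  r ^ d * ∫ z : sphere (0 : Euc d) 1, f (x₀ + r • (z : Euc d)) ∂((volume : Measure (Euc d)).toSphere)

/-- `U(x₀, u; r)`; the exponent is `-n-1` with `n = d + 1`. -/
def weissU (L : CompressibleLiquid) {d : ℕ} (u : Euc d → ℝ) (Du : Euc d → Euc d) (x₀ : Euc d)
    (r : ℝ) : ℝ :=
  (r ^ (d + 2))⁻¹ *
    ∫ x in ball x₀ r, (L.F (‖Du x‖ ^ 2) (lastCoord x) + L.lam (lastCoord x) * chiPos u x)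

/-- `W(x₀, u; r)`; the exponent is `-n-2` with `n = d + 1`, and `H₀ = ρ₀`. -/
def weissW (L : CompressibleLiquid) {d : ℕ} (u : Euc d → ℝ) (x₀ : Euc d) (r : ℝ) : ℝ :=
  (r ^ (d + 3))⁻¹ * sphereIntegral (fun x => u x ^ 2 / L.rho0) x₀ r

/-- `Φ(x₀, u; r) = U(x₀, u; r) - (3/2) W(x₀, u; r)`. -/
def weissPhi (L : CompressibleLiquid) {d : ℕ} (u : Euc d → ℝ) (Du : Euc d → Euc d) (x₀ : Euc d)
    (r : ℝ) : ℝ :=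
  weissU L u Du x₀ r - 3 / 2 * weissW L u x₀ r

/-- The rescaling `u(x₀ + r x) / r^(3/2)`. -/
def blowUp {d : ℕ} (u : Euc d → ℝ) (x₀ : Euc d) (r : ℝ) : Euc d → ℝ :=
  fun x => u (x₀ + r • x) / r ^ (3 / 2 : ℝ)

/-- The gradient `r (∇u)(x₀ + r x) / r^(3/2)` of the rescaling. -/
def blowUpGrad {d : ℕ} (Du : Euc d → Euc d) (x₀ : Euc d) (r : ℝ) : Euc d → Euc d :=
  fun x => (r / r ^ (3 / 2 : ℝ)) • Du (x₀ + r • x)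

end

noncomputable section

namespace CompressibleLiquid

variable (L : CompressibleLiquid)

theorem contDiffOn_deriv_p : ContDiffOn ℝ 1 (deriv L.p) (Ioi 0) :=
  L.contDiffOn_p.deriv_of_isOpen isOpen_Ioi (by norm_num)

theorem contDiffOn_deriv_p_div : ContDiffOn ℝ 1 (fun s => deriv L.p s / s) (Ioi 0) :=
  L.contDiffOn_deriv_p.div contDiffOn_id fun _ hx => ne_of_gt hx

theorem hasDerivAt_enthalpy {ρ : ℝ} (hρ : 0 < ρ) :
    HasDerivAt L.enthalpy (deriv L.p ρ / ρ) ρ := by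
  have hc := L.contDiffOn_deriv_p_div.continuousOn
  have hsub : uIcc L.rho0 ρ ⊆ Ioi 0 := by
    intro x hx
    have := hx.1
    rcases le_total L.rho0 ρ with h | h
    · simp only [h, inf_of_le_left] at this; exact lt_of_lt_of_le L.rho0_pos this
    · simp only [h, inf_of_le_right] at this; exact lt_of_lt_of_le hρ this
  refine intervalIntegral.integral_hasDerivAt_right (hc.mono hsub).intervalIntegrable ?_
    (hc.continuousAt (Ioi_mem_nhds hρ))
  exact hc.stronglyMeasurableAtFilter isOpen_Ioi ρ hρ

theorem enthalpy_rho0 : L.enthalpy L.rho0 = 0 := by simp [enthalpy]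

theorem contDiffOn_enthalpy : ContDiffOn ℝ 1 L.enthalpy (Ioi 0) := by
  refine (contDiffOn_one_iff_derivWithin isOpen_Ioi.uniqueDiffOn).2 ⟨fun x hx =>
    (L.hasDerivAt_enthalpy hx).differentiableAt.differentiableWithinAt, ?_⟩
  refine L.contDiffOn_deriv_p_div.continuousOn.congr fun x hx => ?_
  rw [derivWithin_of_isOpen isOpen_Ioi hx, (L.hasDerivAt_enthalpy hx).deriv]

/-- The function `p'(ρ) / 2 + h(ρ)` whose level `g s` is attained at the critical density. -/
def criticalHead (ρ : ℝ) : ℝ := deriv L.p ρ / 2 + L.enthalpy ρ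

theorem continuousOn_criticalHead : ContinuousOn L.criticalHead (Ioi 0) :=
  (L.contDiffOn_deriv_p.continuousOn.div_const 2).add L.contDiffOn_enthalpy.continuousOn

theorem criticalHead_rho0_pos : 0 < L.criticalHead L.rho0 := by
  have := L.deriv_p_pos _ le_rfl
  simp only [criticalHead, enthalpy_rho0]; linarith

theorem criticalHead_rho0_le {ρ : ℝ} (hρ : L.rho0 ≤ ρ) :
    L.criticalHead L.rho0 ≤ L.criticalHead ρ := by
  have hpos : ∀ x, L.rho0 ≤ x → 0 < x := fun x hx => L.rho0_pos.trans_le hx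
  have hd : ∀ x, L.rho0 ≤ x →
      HasDerivAt L.criticalHead (deriv (deriv L.p) x / 2 + deriv L.p x / x) x := fun x hx => by
    have h1 : DifferentiableAt ℝ (deriv L.p) x :=
      (L.contDiffOn_deriv_p.contDiffAt (Ioi_mem_nhds (hpos x hx))).differentiableAt (by norm_num)
    exact (h1.hasDerivAt.div_const 2).add (L.hasDerivAt_enthalpy (hpos x hx))
  have hmono : MonotoneOn L.criticalHead (Ici L.rho0) := by
    refine monotoneOn_of_deriv_nonneg (convex_Ici _)
      (L.continuousOn_criticalHead.mono fun x hx => hpos x hx) ?_ ?_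
    · intro x hx
      rw [interior_Ici] at hx
      exact (hd x hx.le).differentiableAt.differentiableWithinAt
    · intro x hx
      rw [interior_Ici] at hx
      have hx0 := hpos x (le_of_lt hx)
      rw [(hd x (le_of_lt hx)).deriv]
      have := L.stiffness x (le_of_lt hx)
      have h2 : deriv (deriv L.p) x / 2 + deriv L.p x / x
        = (2 * deriv L.p x + x * deriv (deriv L.p) x) / (2 * x) := by field_simp; ring
      rw [h2]; positivity
  exact hmono self_mem_Ici hρ hρ

theorem lt_rho0_of_criticalHead_eq {s ρ : ℝ} (hs : L.g * s < L.criticalHead L.rho0)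
    (h : L.criticalHead ρ = L.g * s) : ρ < L.rho0 := by
  by_contra! h'
  have := L.criticalHead_rho0_le h'
  linarith

theorem criticalDensity_nonneg (s : ℝ) : 0 ≤ L.criticalDensity s :=
  Real.sSup_nonneg fun _ hx => hx.1.le

theorem lt_criticalHead {s ρ : ℝ} (hs : L.g * s < L.criticalHead L.rho0)
    (hρ : L.criticalDensity s < ρ) : L.g * s < L.criticalHead ρ := by
  by_contra! h
  have hρ0 : 0 < ρ := (L.criticalDensity_nonneg s).trans_lt hρ
  have hle : ρ ≤ L.rho0 := by
    by_contra! h'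
    have := L.criticalHead_rho0_le h'.le
    linarith
  obtain ⟨x, hx, hxe⟩ := intermediate_value_Icc hle
    (L.continuousOn_criticalHead.mono fun y hy => hρ0.trans_le hy.1) ⟨h, hs.le⟩
  have : x ≤ L.criticalDensity s := by
    refine le_csSup ⟨L.rho0, fun y hy => (L.lt_rho0_of_criticalHead_eq hs hy.2).le⟩ ?_
    exact ⟨hρ0.trans_le hx.1, hxe⟩
  linarith [hx.1]

theorem IsSubsonicDensity.unique {s t ρ₁ ρ₂ : ℝ} (hs : L.g * s < L.criticalHead L.rho0)
    (h₁ : L.IsSubsonicDensity t s ρ₁) (h₂ : L.IsSubsonicDensity t s ρ₂) : ρ₁ = ρ₂ := by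
  have hpos : ∀ x ∈ Ioi (L.criticalDensity s), 0 < x :=
    fun x hx => (L.criticalDensity_nonneg s).trans_lt hx
  have hd : ∀ x ∈ Ioi (L.criticalDensity s),
      HasDerivAt (fun ρ => 2 * ρ ^ 2 * (L.g * s - L.enthalpy ρ))
        (4 * x * (L.g * s - L.criticalHead x)) x := fun x hx => by
    have hx0 := hpos x hx
    have h1 := (((hasDerivAt_id x).pow 2).const_mul 2).mul
      ((L.hasDerivAt_enthalpy hx0).const_sub (L.g * s))
    convert! h1 using 1
    simp [criticalHead]
    field_simp
    ring
  have hanti : StrictAntiOn (fun ρ => 2 * ρ ^ 2 * (L.g * s - L.enthalpy ρ))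
      (Ioi (L.criticalDensity s)) := by
    refine strictAntiOn_of_deriv_neg (convex_Ioi _)
      (fun x hx => (hd x hx).continuousAt.continuousWithinAt) fun x hx => ?_
    rw [interior_Ioi] at hx
    rw [(hd x hx).deriv]
    have := L.lt_criticalHead hs hx
    have := hpos x hx
    exact mul_neg_of_pos_of_neg (by linarith) (by linarith)
  exact hanti.injOn h₁.1 h₂.1 (h₁.2.trans h₂.2.symm)

theorem IsSubsonicDensity.H_eq {s t ρ : ℝ} (hs : L.g * s < L.criticalHead L.rho0)
    (h : L.IsSubsonicDensity t s ρ) : L.H t s = ρ := by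
  have : {ρ | L.IsSubsonicDensity t s ρ} = {ρ} := by
    ext x
    exact ⟨fun hx => hx.unique L hs h, fun hx => by rw [mem_singleton_iff.1 hx]; exact h⟩
  rw [H, this, csSup_singleton]

theorem eventually_criticalDensity_le :
    ∃ ρ₁ < L.rho0, ∀ᶠ s in 𝓝 (0 : ℝ), L.criticalDensity s ≤ ρ₁ ∧
      L.g * s < L.criticalHead L.rho0 := by
  have h0 := L.criticalHead_rho0_pos
  have hc : ∀ᶠ ρ in 𝓝 L.rho0, L.criticalHead L.rho0 / 2 < L.criticalHead ρ :=
    (L.continuousOn_criticalHead.continuousAt (Ioi_mem_nhds L.rho0_pos)).eventually_const_lt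
      (by linarith)
  obtain ⟨ε, hε, hball⟩ := Metric.eventually_nhds_iff.1 hc
  refine ⟨L.rho0 - min (ε / 2) L.rho0, by
    have : 0 < min (ε / 2) L.rho0 := lt_min (by linarith) L.rho0_pos
    linarith, ?_⟩
  have ht : Tendsto (fun s => L.g * s) (𝓝 0) (𝓝 0) := by
    have : ContinuousAt (fun s => L.g * s) 0 := by fun_prop
    simpa [ContinuousAt] using this
  filter_upwards [ht.eventually_lt_const (show (0 : ℝ) < L.criticalHead L.rho0 / 2 by linarith)]
    with s hs
  have hs' : L.g * s < L.criticalHead L.rho0 := by linarith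
  refine ⟨Real.sSup_le (fun x hx => ?_) (by linarith [min_le_right (ε / 2) L.rho0]), hs'⟩
  have hx1 := L.lt_rho0_of_criticalHead_eq hs' hx.2
  by_contra! h'
  have hd : dist x L.rho0 < ε := by
    rw [Real.dist_eq, abs_sub_lt_iff]
    constructor <;> linarith [min_le_left (ε / 2) L.rho0]
  have := hball hd
  have hx2 := hx.2
  change L.criticalHead x = _ at hx2
  linarith

/-- `t` as a function of the density and the depth, paired with the depth. -/
def bernoulliMap (q : ℝ × ℝ) : ℝ × ℝ :=
  (q.1 ^ 2 * (L.g * q.2 - L.enthalpy q.1) / (L.rho0 ^ 2 * L.g), q.2)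

theorem contDiffAt_bernoulliMap : ContDiffAt ℝ 1 L.bernoulliMap (L.rho0, 0) := by
  have h1 : ContDiffAt ℝ 1 L.enthalpy ((L.rho0, (0 : ℝ)) : ℝ × ℝ).1 :=
    L.contDiffOn_enthalpy.contDiffAt (Ioi_mem_nhds L.rho0_pos)
  have h2 : ContDiffAt ℝ 1 (fun q : ℝ × ℝ => L.enthalpy q.1) (L.rho0, 0) :=
    h1.comp (L.rho0, (0 : ℝ)) contDiffAt_fst
  unfold bernoulliMap
  fun_prop

theorem contDiffAt_H : ∃ Ht : ℝ × ℝ → ℝ, ContDiffAt ℝ 1 Ht (0, 0) ∧ Ht (0, 0) = L.rho0 ∧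
    ∀ᶠ q in 𝓝 ((0 : ℝ), (0 : ℝ)), L.H q.1 q.2 = Ht q := by
  have hg := L.g_pos
  have hr := L.rho0_pos
  have hp := L.deriv_p_pos _ le_rfl
  set c : ℝ := -(deriv L.p L.rho0) / (L.rho0 * L.g) with hc
  have hc0 : c ≠ 0 := by
    rw [hc]; exact div_ne_zero (neg_ne_zero.2 hp.ne') (by positivity)
  let A : (ℝ × ℝ) →L[ℝ] ℝ × ℝ :=
    (c • ContinuousLinearMap.fst ℝ ℝ ℝ + ContinuousLinearMap.snd ℝ ℝ ℝ).prod
      (ContinuousLinearMap.snd ℝ ℝ ℝ)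
  let B : (ℝ × ℝ) →L[ℝ] ℝ × ℝ :=
    (c⁻¹ • (ContinuousLinearMap.fst ℝ ℝ ℝ - ContinuousLinearMap.snd ℝ ℝ ℝ)).prod
      (ContinuousLinearMap.snd ℝ ℝ ℝ)
  let A' : (ℝ × ℝ) ≃L[ℝ] ℝ × ℝ := ContinuousLinearEquiv.equivOfInverse A B
    (fun x => by ext <;> simp [A, B, hc0]) (fun x => by ext <;> simp [A, B, hc0])
  have hder : HasFDerivAt L.bernoulliMap (A' : (ℝ × ℝ) →L[ℝ] ℝ × ℝ) (L.rho0, 0) := by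
    have h1 : HasFDerivAt (fun q : ℝ × ℝ => q.1) (ContinuousLinearMap.fst ℝ ℝ ℝ) (L.rho0, 0) :=
      hasFDerivAt_fst
    have h2 : HasFDerivAt (fun q : ℝ × ℝ => q.2) (ContinuousLinearMap.snd ℝ ℝ ℝ) (L.rho0, 0) :=
      hasFDerivAt_snd
    have h3 := (L.hasDerivAt_enthalpy hr).comp_hasFDerivAt_of_eq ((L.rho0, (0:ℝ))) h1 rfl
    have h4 := ((h1.pow 2).mul ((h2.const_mul L.g).sub h3)).mul_const (L.rho0 ^ 2 * L.g)⁻¹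
    have h5 := h4.prodMk h2
    have e1 : L.bernoulliMap = fun q : ℝ × ℝ =>
        (q.1 ^ 2 * (L.g * q.2 - L.enthalpy q.1) * (L.rho0 ^ 2 * L.g)⁻¹, q.2) := by
      funext q; simp [bernoulliMap, div_eq_mul_inv]
    rw [e1]
    convert! h5 using 1
    ext <;> simp [A', A, hc, enthalpy_rho0] <;> field_simp
  have hcd := L.contDiffAt_bernoulliMap
  have hT0 : L.bernoulliMap (L.rho0, 0) = (0, 0) := by simp [bernoulliMap, enthalpy_rho0]
  set I := hcd.localInverse hder one_ne_zero with hI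
  have hI0 : I (0, 0) = (L.rho0, 0) := by
    rw [← hT0]; exact hcd.localInverse_apply_image hder one_ne_zero
  have hIc : ContDiffAt ℝ 1 I (0, 0) := by
    rw [← hT0]; exact hcd.to_localInverse hder one_ne_zero
  have hright : ∀ᶠ q in 𝓝 ((0 : ℝ), (0 : ℝ)), L.bernoulliMap (I q) = q := by
    have := (hcd.hasStrictFDerivAt' hder one_ne_zero).eventually_right_inverse
    rwa [hT0] at this
  refine ⟨fun q => (I q).1, hIc.fst, by simp [hI0], ?_⟩
  obtain ⟨ρ₁, hρ₁, hev⟩ := L.eventually_criticalDensity_le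
  have hev' : ∀ᶠ q in 𝓝 ((0 : ℝ), (0 : ℝ)), L.criticalDensity q.2 ≤ ρ₁ ∧
      L.g * q.2 < L.criticalHead L.rho0 :=
    (continuous_snd.tendsto ((0 : ℝ), (0 : ℝ))).eventually hev
  have hlt : ∀ᶠ q in 𝓝 ((0 : ℝ), (0 : ℝ)), ρ₁ < (I q).1 := by
    refine hIc.fst.continuousAt.eventually_const_lt ?_
    simpa [hI0] using hρ₁
  filter_upwards [hright, hev', hlt] with q hq1 hq2 hq3
  refine IsSubsonicDensity.H_eq L hq2.2 ⟨hq2.1.trans_lt hq3, ?_⟩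
  have e1 := congrArg Prod.fst hq1
  have e2 := congrArg Prod.snd hq1
  simp only [bernoulliMap] at e1 e2
  rw [e2] at e1
  rw [div_eq_iff (by positivity)] at e1
  linarith

theorem H_self {s : ℝ} (hs : L.g * s < L.criticalHead L.rho0)
    (h : L.criticalDensity s < L.rho0) : L.H s s = L.rho0 :=
  IsSubsonicDensity.H_eq L hs ⟨h, by rw [enthalpy_rho0]; ring⟩

end CompressibleLiquid

section ParametricPrimitive

variable {b : ℝ × ℝ → ℝ}

theorem ContDiff.continuous_snd_partial (hb : ContDiff ℝ 1 b) :
    Continuous fun q : ℝ × ℝ => fderiv ℝ b q (0, 1) :=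
  (hb.continuous_fderiv one_ne_zero).clm_apply continuous_const

theorem ContDiff.hasDerivAt_snd_partial (hb : ContDiff ℝ 1 b) (t s : ℝ) :
    HasDerivAt (fun σ => b (t, σ)) (fderiv ℝ b (t, s) (0, 1)) s := by
  have h1 := (hb.differentiable one_ne_zero (t, s)).hasFDerivAt
  have h2 : HasDerivAt (fun σ : ℝ => (t, σ)) ((0 : ℝ), (1 : ℝ)) s :=
    (hasDerivAt_const s t).prodMk (hasDerivAt_id s)
  exact h1.comp_hasDerivAt s h2

theorem ContDiff.continuous_primitive_snd_partial (hb : ContDiff ℝ 1 b) :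
    Continuous fun q : ℝ × ℝ => ∫ τ in (0 : ℝ)..q.1, fderiv ℝ b (τ, q.2) (0, 1) := by
  have h : Continuous (fun p : ℝ × ℝ => ∫ τ in (0 : ℝ)..p.1, fderiv ℝ b (τ, p.2) (0, 1)) :=
    intervalIntegral.continuous_parametric_intervalIntegral_of_continuous
      (f := fun (p : ℝ × ℝ) τ => fderiv ℝ b (τ, p.2) (0, 1))
      (by
        have := hb.continuous_snd_partial
        exact this.comp (by fun_prop : Continuous fun x : (ℝ × ℝ) × ℝ => (x.2, x.1.2)))
      continuous_fst
  exact h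

theorem ContDiff.hasDerivAt_primitive_snd (hb : ContDiff ℝ 1 b) {M : ℝ}
    (hM : ∀ q, |fderiv ℝ b q (0, 1)| ≤ M) (t s : ℝ) :
    HasDerivAt (fun σ => ∫ τ in (0 : ℝ)..t, b (τ, σ))
      (∫ τ in (0 : ℝ)..t, fderiv ℝ b (τ, s) (0, 1)) s := by
  have hc := hb.continuous
  have hcd := hb.continuous_snd_partial
  refine (intervalIntegral.hasDerivAt_integral_of_dominated_loc_of_deriv_le (s := univ)
    (F := fun σ τ => b (τ, σ)) (F' := fun σ τ => fderiv ℝ b (τ, σ) (0, 1))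
    (bound := fun _ => M) univ_mem ?_ ?_ ?_ ?_ ?_ ?_).2
  · exact Eventually.of_forall fun σ =>
      (hc.comp (by fun_prop : Continuous fun τ : ℝ => (τ, σ))).aestronglyMeasurable
  · exact (hc.comp (by fun_prop : Continuous fun τ : ℝ => (τ, s))).intervalIntegrable _ _
  · exact (hcd.comp (by fun_prop : Continuous fun τ : ℝ => (τ, s))).aestronglyMeasurable
  · exact Eventually.of_forall fun τ _ σ _ => hM _
  · exact intervalIntegrable_const
  · exact Eventually.of_forall fun τ _ σ _ => hb.hasDerivAt_snd_partial τ σ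

theorem ContDiff.hasFDerivAt_primitive (hb : ContDiff ℝ 1 b) {M : ℝ}
    (hM : ∀ q, |fderiv ℝ b q (0, 1)| ≤ M) (q : ℝ × ℝ) :
    HasFDerivAt (fun q : ℝ × ℝ => ∫ τ in (0 : ℝ)..q.1, b (τ, q.2))
      (b q • ContinuousLinearMap.fst ℝ ℝ ℝ +
        (∫ τ in (0 : ℝ)..q.1, fderiv ℝ b (τ, q.2) (0, 1)) • ContinuousLinearMap.snd ℝ ℝ ℝ) q := by
  have hc := hb.continuous
  have h := hasStrictFDerivAt_uncurry_coprod (𝕜 := ℝ) (u := q)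
    (f := fun t s => ∫ τ in (0 : ℝ)..t, b (τ, s))
    (f₁ := fun t s => ContinuousLinearMap.toSpanSingleton ℝ (b (t, s)))
    (f₂ := fun t s => ContinuousLinearMap.toSpanSingleton ℝ
      (∫ τ in (0 : ℝ)..t, fderiv ℝ b (τ, s) (0, 1))) ?_ ?_ ?_ ?_
  · convert! h.hasFDerivAt using 1
    ext <;> simp [Function.HasUncurry.uncurry]
  · refine Eventually.of_forall fun v => ?_
    have hcs : Continuous fun τ : ℝ => b (τ, v.2) := by fun_prop
    exact (intervalIntegral.integral_hasDerivAt_right (hcs.intervalIntegrable _ _)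
      (hcs.stronglyMeasurableAtFilter _ _) hcs.continuousAt).hasFDerivAt
  · exact Eventually.of_forall fun v => (hb.hasDerivAt_primitive_snd hM v.1 v.2).hasFDerivAt
  · have : Continuous fun q : ℝ × ℝ => ContinuousLinearMap.toSpanSingleton ℝ (b q) :=
      (ContinuousLinearMap.toSpanSingletonCLE (𝕜 := ℝ) (E := ℝ)).continuous.comp hc
    exact this.continuousAt
  · have : Continuous fun q : ℝ × ℝ => ContinuousLinearMap.toSpanSingleton ℝ
        (∫ τ in (0 : ℝ)..q.1, fderiv ℝ b (τ, q.2) (0, 1)) :=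
      (ContinuousLinearMap.toSpanSingletonCLE (𝕜 := ℝ) (E := ℝ)).continuous.comp
        hb.continuous_primitive_snd_partial
    exact this.continuousAt

end ParametricPrimitive

namespace CompressibleLiquid

/-- Regularity of the constitutive functions near `(t, s) = (0, 0)`, and the size of their
deviation from the incompressible case. -/
structure RegularNearZero (L : CompressibleLiquid) (δ K : ℝ) : Prop where
  radius_pos : 0 < δ
  const_nonneg : 0 ≤ K
  contDiffOn_dF1 : ContDiffOn ℝ 1 (fun q : ℝ × ℝ => L.dF1 q.1 q.2) (ball 0 δ)
  hasFDerivAt_F : ∀ q ∈ ball (0 : ℝ × ℝ) δ, HasFDerivAt (fun q : ℝ × ℝ => L.F q.1 q.2)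
    (L.dF1 q.1 q.2 • ContinuousLinearMap.fst ℝ ℝ ℝ +
      L.dF2 q.1 q.2 • ContinuousLinearMap.snd ℝ ℝ ℝ) q
  continuousOn_dF2 : ContinuousOn (fun q : ℝ × ℝ => L.dF2 q.1 q.2) (ball 0 δ)
  hasDerivAt_lam : ∀ s ∈ ball (0 : ℝ) δ, HasDerivAt L.lam (deriv L.lam s) s
  continuousOn_deriv_lam : ContinuousOn (deriv L.lam) (ball 0 δ)
  dF1_sub_le : ∀ q ∈ ball (0 : ℝ × ℝ) δ, |L.dF1 q.1 q.2 - 1 / L.rho0| ≤ K * ‖q‖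
  F_sub_le : ∀ q ∈ ball (0 : ℝ × ℝ) δ, |L.F q.1 q.2 - q.1 / L.rho0| ≤ K * ‖q‖ * |q.1|
  dF2_le : ∀ q ∈ ball (0 : ℝ × ℝ) δ, |L.dF2 q.1 q.2| ≤ K * |q.1|
  lam_sub_le : ∀ s ∈ ball (0 : ℝ) δ, |L.lam s - s / L.rho0| ≤ K * |s| * |s|
  deriv_lam_sub_le : ∀ s ∈ ball (0 : ℝ) δ, |deriv L.lam s - 1 / L.rho0| ≤ K * |s|

theorem exists_contDiff_eqOn_dF1 (L : CompressibleLiquid) :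
    ∃ b : ℝ × ℝ → ℝ, ∃ δ > 0, ContDiff ℝ 1 b ∧ HasCompactSupport b ∧ b 0 = 1 / L.rho0 ∧
      (∀ q ∈ ball (0 : ℝ × ℝ) δ, L.dF1 q.1 q.2 = b q) ∧
      ∀ s ∈ ball (0 : ℝ) δ, L.dF1 s s = 1 / L.rho0 := by
  obtain ⟨Ht, hHt, hHt0, hev⟩ := L.contDiffAt_H
  obtain ⟨ρ₁, hρ₁, hcr⟩ := L.eventually_criticalDensity_le
  have hinv : ContDiffAt ℝ 1 (fun q => (Ht q)⁻¹) (0, 0) := by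
    refine hHt.inv ?_
    rw [hHt0]; exact L.rho0_pos.ne'
  have hCD : ∀ᶠ q in 𝓝 ((0 : ℝ), (0 : ℝ)), ContDiffAt ℝ 1 (fun q => (Ht q)⁻¹) q :=
    hinv.eventually (by simp)
  obtain ⟨ε₁, hε₁, h₁⟩ := Metric.eventually_nhds_iff_ball.1 (hCD.and hev)
  obtain ⟨ε₂, hε₂, h₂⟩ := Metric.eventually_nhds_iff_ball.1 hcr
  let f : ContDiffBump (0 : ℝ × ℝ) := ⟨ε₁ / 4, ε₁ / 2, by linarith, by linarith⟩
  refine ⟨fun q => f q * (Ht q)⁻¹, min (ε₁ / 4) ε₂, lt_min (by linarith) hε₂, ?_, ?_, ?_, ?_, ?_⟩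
  · refine contDiff_iff_contDiffAt.2 fun q => ?_
    by_cases hq : q ∉ tsupport fun q => f q * (Ht q)⁻¹
    · exact contDiffAt_const.congr_of_eventuallyEq (notMem_tsupport_iff_eventuallyEq.1 hq)
    have hq := not_not.1 hq
    have hq' : q ∈ tsupport f := tsupport_mul_subset_left hq
    rw [f.tsupport_eq] at hq'
    exact f.contDiff.contDiffAt.mul (h₁ q (closedBall_subset_ball (by simp [f]; linarith) hq')).1
  · exact f.hasCompactSupport.mul_right
  · have : f (0 : ℝ × ℝ) = 1 := f.eventuallyEq_one.self_of_nhds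
    have h0 : Ht 0 = L.rho0 := hHt0
    simp [this, h0]
  · intro q hq
    have hq1 : q ∈ closedBall (0 : ℝ × ℝ) (ε₁ / 4) :=
      ball_subset_closedBall (ball_subset_ball (min_le_left _ _) hq)
    have : f q = 1 := f.one_of_mem_closedBall hq1
    simp only [this, one_mul, dF1]
    rw [(h₁ q (closedBall_subset_ball (by linarith) hq1)).2, one_div]
  · intro s hs
    have := h₂ s (ball_subset_ball (min_le_right _ _) hs)
    rw [dF1, L.H_self this.2 (this.1.trans_lt hρ₁)]

theorem exists_regularNearZero (L : CompressibleLiquid) : ∃ δ K, L.RegularNearZero δ K := by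
  obtain ⟨b, δ, hδ, hb, hbs, hb0, hbeq, hbdiag⟩ := L.exists_contDiff_eqOn_dF1
  obtain ⟨K, hK⟩ := (hbs.fderiv (𝕜 := ℝ)).exists_bound_of_continuous
    (hb.continuous_fderiv one_ne_zero)
  have hK0 : 0 ≤ K := (norm_nonneg _).trans (hK 0)
  have hM : ∀ q, |fderiv ℝ b q (0, 1)| ≤ K := fun q => by
    refine ((fderiv ℝ b q).le_opNorm (0, 1)).trans ?_
    rw [Prod.norm_mk]; simpa using hK q
  have hlip : ∀ q, |b q - 1 / L.rho0| ≤ K * ‖q‖ := fun q => by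
    have := convex_univ.norm_image_sub_le_of_norm_fderiv_le (𝕜 := ℝ) (f := b) (x := 0) (y := q)
      (fun x _ => hb.differentiable one_ne_zero x) (fun x _ => hK x) (mem_univ _) (mem_univ _)
    simpa [hb0] using this
  have hmem : ∀ q : ℝ × ℝ, q ∈ ball (0 : ℝ × ℝ) δ ↔ |q.1| < δ ∧ |q.2| < δ := fun q => by
    rw [mem_ball_zero_iff, Prod.norm_def, max_lt_iff]; rfl
  have hin : ∀ q ∈ ball (0 : ℝ × ℝ) δ, ∀ τ ∈ uIcc 0 q.1, (τ, q.2) ∈ ball (0 : ℝ × ℝ) δ ∧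
      ‖(τ, q.2)‖ ≤ ‖q‖ := fun q hq τ hτ => by
    have h1 : |τ| ≤ |q.1| := by
      have := abs_sub_left_of_mem_uIcc hτ
      simpa using this
    rw [hmem] at hq
    refine ⟨(hmem _).2 ⟨h1.trans_lt hq.1, hq.2⟩, ?_⟩
    rw [Prod.norm_def, Prod.norm_def]
    exact max_le_max h1 le_rfl
  have hF : ∀ q ∈ ball (0 : ℝ × ℝ) δ, L.F q.1 q.2 = ∫ τ in (0 : ℝ)..q.1, b (τ, q.2) :=
    fun q hq => intervalIntegral.integral_congr fun τ hτ => hbeq _ (hin q hq τ hτ).1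
  set F2 : ℝ × ℝ → ℝ := fun q => ∫ τ in (0 : ℝ)..q.1, fderiv ℝ b (τ, q.2) (0, 1) with hF2
  have hdF2 : ∀ q ∈ ball (0 : ℝ × ℝ) δ, L.dF2 q.1 q.2 = F2 q := fun q hq => by
    have hev : (fun σ => L.F q.1 σ) =ᶠ[𝓝 q.2] fun σ => ∫ τ in (0 : ℝ)..q.1, b (τ, σ) := by
      have hc : Continuous fun σ : ℝ => (q.1, σ) := by fun_prop
      filter_upwards [hc.continuousAt.preimage_mem_nhds (isOpen_ball.mem_nhds hq)] with σ hσ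
      exact hF (q.1, σ) hσ
    rw [dF2, hev.deriv_eq]
    exact (hb.hasDerivAt_primitive_snd hM q.1 q.2).deriv
  have hF2le : ∀ q, |F2 q| ≤ K * |q.1| := fun q => by
    have := intervalIntegral.norm_integral_le_of_norm_le_const (a := (0 : ℝ)) (b := q.1) (C := K)
      (f := fun τ => fderiv ℝ b (τ, q.2) (0, 1)) fun τ _ => hM _
    simpa using this
  have hFd : ∀ q ∈ ball (0 : ℝ × ℝ) δ, HasFDerivAt (fun q : ℝ × ℝ => L.F q.1 q.2)
      (L.dF1 q.1 q.2 • ContinuousLinearMap.fst ℝ ℝ ℝ +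
        L.dF2 q.1 q.2 • ContinuousLinearMap.snd ℝ ℝ ℝ) q := fun q hq => by
    rw [hbeq q hq, hdF2 q hq]
    refine (hb.hasFDerivAt_primitive hM q).congr_of_eventuallyEq ?_
    filter_upwards [isOpen_ball.mem_nhds hq] with x hx using hF x hx
  have hdiag : ∀ s ∈ ball (0 : ℝ) δ, ((s, s) : ℝ × ℝ) ∈ ball (0 : ℝ × ℝ) δ := fun s hs => by
    rw [mem_ball_zero_iff, Real.norm_eq_abs] at hs
    exact (hmem _).2 ⟨hs, hs⟩
  have hlam : ∀ s ∈ ball (0 : ℝ) δ, L.lam s = 2 * s / L.rho0 - L.F s s := fun s hs => by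
    rw [lam, Lam, hbdiag s hs]; ring
  have hlamd : ∀ s ∈ ball (0 : ℝ) δ, HasDerivAt L.lam (1 / L.rho0 - F2 (s, s)) s :=
    fun s hs => by
    have h1 := (hFd _ (hdiag s hs)).comp_hasDerivAt_of_eq s
      ((hasDerivAt_id s).prodMk (hasDerivAt_id s)) rfl
    have h2 := (((hasDerivAt_id s).const_mul 2).div_const L.rho0).sub h1
    have h3 : HasDerivAt L.lam _ s := h2.congr_of_eventuallyEq (by
      filter_upwards [isOpen_ball.mem_nhds hs] with x hx
      simpa using hlam x hx)
    convert! h3 using 1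
    have e1 := hbdiag s hs
    have e2 := hdF2 _ (hdiag s hs)
    simp only at e1 e2
    simp [e1, e2]
    ring
  refine ⟨δ, 2 * K, hδ, by linarith, ?_, hFd, ?_, fun s hs => ?_, ?_, fun q hq => ?_, fun q hq => ?_,
    fun q hq => ?_, fun s hs => ?_, fun s hs => ?_⟩
  · exact hb.contDiffOn.congr hbeq
  · exact hb.continuous_primitive_snd_partial.continuousOn.congr hdF2
  · exact (hlamd s hs).differentiableAt.hasDerivAt
  · have : Continuous fun s => 1 / L.rho0 - F2 (s, s) :=
      continuous_const.sub (hb.continuous_primitive_snd_partial.comp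
        (by fun_prop : Continuous fun s : ℝ => (s, s)))
    exact this.continuousOn.congr fun s hs => (hlamd s hs).deriv
  · rw [hbeq q hq]
    exact (hlip q).trans (by nlinarith [norm_nonneg q])
  · have hc : Continuous fun τ : ℝ => b (τ, q.2) := by fun_prop
    have e : L.F q.1 q.2 - q.1 / L.rho0 = ∫ τ in (0 : ℝ)..q.1, (b (τ, q.2) - 1 / L.rho0) := by
      rw [hF q hq, intervalIntegral.integral_sub (hc.intervalIntegrable _ _)
        intervalIntegrable_const]
      simp; ring
    rw [e]
    have := intervalIntegral.norm_integral_le_of_norm_le_const (a := (0 : ℝ)) (b := q.1)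
      (C := K * ‖q‖) (f := fun τ => b (τ, q.2) - 1 / L.rho0) fun τ hτ =>
        (hlip _).trans (mul_le_mul_of_nonneg_left (hin q hq τ (uIoc_subset_uIcc hτ)).2 hK0)
    simp only [sub_zero, Real.norm_eq_abs] at this
    refine this.trans ?_
    have h1 : 0 ≤ K * ‖q‖ * |q.1| := by positivity
    linarith
  · rw [hdF2 q hq]
    exact (hF2le q).trans (by nlinarith [abs_nonneg q.1])
  · have hq := hdiag s hs
    have hc : Continuous fun τ : ℝ => b (τ, s) := by fun_prop
    have e : L.lam s - s / L.rho0 = -∫ τ in (0 : ℝ)..s, (b (τ, s) - 1 / L.rho0) := by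
      rw [hlam s hs, hF (s, s) hq, intervalIntegral.integral_sub (hc.intervalIntegrable _ _)
        intervalIntegrable_const]
      simp; ring
    rw [e, abs_neg]
    have := intervalIntegral.norm_integral_le_of_norm_le_const (a := (0 : ℝ)) (b := s)
      (C := K * |s|) (f := fun τ => b (τ, s) - 1 / L.rho0) fun τ hτ =>
        (hlip _).trans (mul_le_mul_of_nonneg_left ((hin (s, s) hq τ (uIoc_subset_uIcc hτ)).2.trans
          (by simp [Prod.norm_def])) hK0)
    simp only [sub_zero, Real.norm_eq_abs] at this
    refine this.trans ?_
    have h1 : 0 ≤ K * |s| * |s| := by positivity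
    linarith
  · rw [(hlamd s hs).deriv, sub_sub_cancel_left, abs_neg]
    exact (hF2le (s, s)).trans (by nlinarith [abs_nonneg s])

end CompressibleLiquid

section TestFunctions

variable {d : ℕ}

theorem integrable_mul_of_tsupport_subset {U : Set (Euc d)} (hU : IsOpen U) {f ζ : Euc d → ℝ}
    (hf : ContinuousOn f U) (hζ : Continuous ζ) (hζc : HasCompactSupport ζ)
    (hζU : tsupport ζ ⊆ U) : Integrable (fun x => f x * ζ x) := by
  have hs : tsupport (fun x => f x * ζ x) ⊆ tsupport ζ := tsupport_mul_subset_right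
  refine ((hf.mul hζ.continuousOn).continuous_of_tsupport_subset hU
    (hs.trans hζU)).integrable_of_hasCompactSupport hζc.mul_left

theorem integral_mul_fderiv_eq_neg_of_tsupport_subset {U : Set (Euc d)} (hU : IsOpen U)
    {f ζ : Euc d → ℝ} (hf : ContDiffOn ℝ 1 f U) (hζ : ContDiff ℝ 1 ζ) (hζc : HasCompactSupport ζ)
    (hζU : tsupport ζ ⊆ U) (e : Euc d) :
    ∫ x, f x * fderiv ℝ ζ x e = -∫ x, fderiv ℝ f x e * ζ x := by
  have hζ' : Continuous fun x => fderiv ℝ ζ x e :=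
    (hζ.continuous_fderiv one_ne_zero).clm_apply continuous_const
  refine integral_mul_fderiv_eq_neg_fderiv_mul_of_integrable ?_ ?_ ?_ ?_ ?_
  · exact integrable_mul_of_tsupport_subset hU
      ((hf.continuousOn_fderiv_of_isOpen hU le_rfl).clm_apply continuousOn_const)
      hζ.continuous hζc hζU
  · exact integrable_mul_of_tsupport_subset hU hf.continuousOn hζ' (hζc.fderiv_apply (𝕜 := ℝ) e)
      ((tsupport_fderiv_apply_subset ℝ e).trans hζU)
  · exact integrable_mul_of_tsupport_subset hU hf.continuousOn hζ.continuous hζc hζU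
  · exact fun x hx => (hf.contDiffAt (hU.mem_nhds (hζU hx))).differentiableAt one_ne_zero
  · exact fun x _ => hζ.differentiable one_ne_zero x

theorem Euc.sum_smul_single (w : Euc d) : ∑ i, w i • EuclideanSpace.single i (1 : ℝ) = w := by
  ext j
  simp [Finset.sum_apply, Pi.single_apply]

theorem Euc.fderiv_apply_eq_sum (ζ : Euc d → ℝ) (x w : Euc d) :
    fderiv ℝ ζ x w = ∑ i, w i * fderiv ℝ ζ x (EuclideanSpace.single i 1) := by
  conv_lhs => rw [← Euc.sum_smul_single w]
  simp only [map_sum, map_smul, smul_eq_mul]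

/-- The derivative of `ramp ε`: `0` below `ε`, `1` above `2 ε` and affine in between. -/
def rampDeriv (ε τ : ℝ) : ℝ := max 0 (min 1 (τ / ε - 1))

/-- A `C¹` approximation of the positive part which vanishes below `ε`. -/
def ramp (ε t : ℝ) : ℝ := ∫ τ in (0 : ℝ)..t, rampDeriv ε τ

theorem continuous_rampDeriv (ε : ℝ) : Continuous (rampDeriv ε) := by
  unfold rampDeriv; fun_prop

theorem rampDeriv_nonneg (ε τ : ℝ) : 0 ≤ rampDeriv ε τ := le_max_left _ _

theorem rampDeriv_le_one (ε τ : ℝ) : rampDeriv ε τ ≤ 1 :=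
  max_le zero_le_one (min_le_left _ _)

theorem rampDeriv_eq_zero {ε τ : ℝ} (hε : 0 < ε) (h : τ ≤ ε) : rampDeriv ε τ = 0 := by
  have : τ / ε ≤ 1 := (div_le_one hε).2 h
  exact max_eq_left ((min_le_right _ _).trans (by linarith))

theorem rampDeriv_eq_one {ε τ : ℝ} (hε : 0 < ε) (h : 2 * ε ≤ τ) : rampDeriv ε τ = 1 := by
  have : 2 ≤ τ / ε := (le_div_iff₀ hε).2 h
  rw [rampDeriv, min_eq_left (by linarith), max_eq_right zero_le_one]

theorem hasDerivAt_ramp (ε t : ℝ) : HasDerivAt (ramp ε) (rampDeriv ε t) t :=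
  intervalIntegral.integral_hasDerivAt_right ((continuous_rampDeriv ε).intervalIntegrable _ _)
    ((continuous_rampDeriv ε).stronglyMeasurableAtFilter _ _) (continuous_rampDeriv ε).continuousAt

theorem contDiff_ramp (ε : ℝ) : ContDiff ℝ 1 (ramp ε) := by
  refine contDiff_one_iff_deriv.2 ⟨fun t => (hasDerivAt_ramp ε t).differentiableAt, ?_⟩
  rw [show deriv (ramp ε) = rampDeriv ε from funext fun t => (hasDerivAt_ramp ε t).deriv]
  exact continuous_rampDeriv ε

theorem ramp_eq_zero {ε t : ℝ} (hε : 0 < ε) (h : t ≤ ε) : ramp ε t = 0 := by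
  have : ∀ τ ∈ uIcc 0 t, rampDeriv ε τ = 0 := fun τ hτ => by
    refine rampDeriv_eq_zero hε (hτ.2.trans ?_)
    exact max_le hε.le h
  rw [ramp, intervalIntegral.integral_congr this]
  simp

theorem ramp_nonneg {ε t : ℝ} (ht : 0 ≤ t) : 0 ≤ ramp ε t :=
  intervalIntegral.integral_nonneg ht fun τ _ => rampDeriv_nonneg ε τ

theorem lipschitzWith_ramp (ε : ℝ) : LipschitzWith 1 (ramp ε) := by
  refine lipschitzWith_of_nnnorm_deriv_le (fun t => (hasDerivAt_ramp ε t).differentiableAt)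
    fun t => ?_
  rw [(hasDerivAt_ramp ε t).deriv, ← NNReal.coe_le_coe]
  simp [abs_of_nonneg (rampDeriv_nonneg ε t), rampDeriv_le_one]

theorem ramp_le {ε t : ℝ} (ht : 0 ≤ t) : ramp ε t ≤ t := by
  have := (lipschitzWith_ramp ε).dist_le_mul t 0
  simp only [Real.dist_eq, NNReal.coe_one, one_mul, sub_zero, abs_of_nonneg ht] at this
  have h0 : ramp ε 0 = 0 := by simp [ramp]
  rw [h0, sub_zero, abs_of_nonneg (ramp_nonneg ht)] at this
  exact this

theorem sub_le_ramp {ε t : ℝ} (hε : 0 < ε) (ht : 0 ≤ t) : t - 2 * ε ≤ ramp ε t := by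
  rcases le_total t (2 * ε) with h | h
  · linarith [ramp_nonneg (ε := ε) ht]
  · have h1 : ramp ε t - ramp ε (2 * ε) = t - 2 * ε := by
      rw [ramp, ramp, intervalIntegral.integral_interval_sub_left
        ((continuous_rampDeriv ε).intervalIntegrable _ _)
        ((continuous_rampDeriv ε).intervalIntegrable _ _)]
      have : ∀ τ ∈ uIcc (2 * ε) t, rampDeriv ε τ = 1 := fun τ hτ => by
        rw [uIcc_of_le h] at hτ
        exact rampDeriv_eq_one hε hτ.1
      rw [intervalIntegral.integral_congr this]; simp
    linarith [ramp_nonneg (ε := ε) (t := 2 * ε) (by linarith)]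

theorem tendsto_rampDeriv {ε : ℕ → ℝ} (hε : ∀ k, 0 < ε k) (h0 : Tendsto ε atTop (𝓝 0)) {t : ℝ}
    (ht : 0 < t) : Tendsto (fun k => rampDeriv (ε k) t) atTop (𝓝 1) := by
  refine tendsto_const_nhds.congr' ?_
  filter_upwards [h0.eventually_lt_const (show 0 < t / 2 by linarith)] with k hk
  exact (rampDeriv_eq_one (hε k) (by linarith)).symm

theorem tendsto_ramp {ε : ℕ → ℝ} (hε : ∀ k, 0 < ε k) (h0 : Tendsto ε atTop (𝓝 0)) {t : ℝ}
    (ht : 0 ≤ t) : Tendsto (fun k => ramp (ε k) t) atTop (𝓝 t) := by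
  refine tendsto_of_tendsto_of_tendsto_of_le_of_le (g := fun k => t - 2 * ε k) (h := fun _ => t)
    ?_ tendsto_const_nhds (fun k => sub_le_ramp (hε k) ht) fun k => ramp_le ht
  simpa using (tendsto_const_nhds (x := t)).sub (h0.const_mul 2)

/-- The radial profile with derivative `-θ` vanishing at `R`. -/
def radialProfile (θ : ℝ → ℝ) (R r : ℝ) : ℝ := ∫ s in r..R, θ s

variable {θ : ℝ → ℝ} {R a b : ℝ}

theorem hasDerivAt_radialProfile (hθ : Continuous θ) (r : ℝ) :
    HasDerivAt (radialProfile θ R) (-θ r) r :=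
  intervalIntegral.integral_hasDerivAt_left (hθ.intervalIntegrable _ _)
    (hθ.stronglyMeasurableAtFilter _ _) hθ.continuousAt

theorem radialProfile_eq_zero (hb : b ≤ R) (h0 : ∀ s, b ≤ s → θ s = 0) {r : ℝ} (hr : b ≤ r) :
    radialProfile θ R r = 0 := by
  have : ∀ s ∈ uIcc r R, θ s = 0 := fun s hs => h0 s ((le_min hr hb).trans hs.1)
  rw [radialProfile, intervalIntegral.integral_congr this]; simp

theorem radialProfile_eq_of_le (hθ : Continuous θ) (h0 : ∀ s, s ≤ a → θ s = 0) {r : ℝ}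
    (hr : r ≤ a) : radialProfile θ R r = radialProfile θ R a := by
  have : ∀ s ∈ uIcc r a, θ s = 0 := fun s hs => h0 s (hs.2.trans (max_le hr le_rfl))
  rw [radialProfile, radialProfile, ← intervalIntegral.integral_add_adjacent_intervals
    (hθ.intervalIntegrable r a) (hθ.intervalIntegrable a R), intervalIntegral.integral_congr this]
  simp

/-- The radial cut-off function `x ↦ g(|x|)` with `g' = -θ`. -/
def radialCutoff (d : ℕ) (θ : ℝ → ℝ) (R : ℝ) (y : Euc d) : ℝ := radialProfile θ R ‖y‖

theorem hasFDerivAt_radialCutoff (hθ : Continuous θ) (ha : 0 < a) (h0 : ∀ s, s ≤ a → θ s = 0)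
    (y : Euc d) : HasFDerivAt (radialCutoff d θ R) (-(θ ‖y‖ / ‖y‖) • innerSL ℝ y) y := by
  by_cases hy : ‖y‖ < a
  · have : radialCutoff d θ R =ᶠ[𝓝 y] fun _ => radialProfile θ R a := by
      filter_upwards [(continuous_norm.tendsto y).eventually_lt_const hy] with z hz
      exact radialProfile_eq_of_le hθ h0 hz.le
    rw [h0 _ hy.le]
    simpa using (hasFDerivAt_const (radialProfile θ R a) y).congr_of_eventuallyEq this
  · have hy0 : 0 < ‖y‖ := ha.trans_le (not_lt.1 hy)
    have h1 : HasFDerivAt (fun z : Euc d => ‖z‖) ((1 / ‖y‖) • innerSL ℝ y) y := by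
      have h2 := (hasStrictFDerivAt_norm_sq y).hasFDerivAt.sqrt (by positivity)
      have e : (fun z : Euc d => √(‖z‖ ^ 2)) = fun z => ‖z‖ := by
        funext z; exact Real.sqrt_sq (norm_nonneg z)
      rw [e, Real.sqrt_sq (norm_nonneg y)] at h2
      convert! h2 using 1
      ext w
      simp
      field_simp
    convert! (hasDerivAt_radialProfile (R := R) hθ ‖y‖).comp_hasFDerivAt y h1 using 1
    ext w; simp; ring

theorem contDiff_radialCutoff (hθ : Continuous θ) (ha : 0 < a) (h0 : ∀ s, s ≤ a → θ s = 0) :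
    ContDiff ℝ 1 (radialCutoff d θ R) := by
  refine contDiff_one_iff_fderiv.2
    ⟨fun y => (hasFDerivAt_radialCutoff hθ ha h0 y).differentiableAt, ?_⟩
  rw [show fderiv ℝ (radialCutoff d θ R) = fun y => -(θ ‖y‖ / ‖y‖) • innerSL ℝ y from
    funext fun y => (hasFDerivAt_radialCutoff hθ ha h0 y).fderiv]
  have e : (fun y : Euc d => -(θ ‖y‖ / ‖y‖) • innerSL ℝ y) =
      fun y : Euc d => -(θ ‖y‖ / max ‖y‖ a) • innerSL ℝ y := by
    funext y
    rcases le_total ‖y‖ a with h | h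
    · rw [h0 _ h]; simp
    · rw [max_eq_left h]
  rw [e]
  have hne : ∀ y : Euc d, max ‖y‖ a ≠ 0 := fun y => (ha.trans_le (le_max_right _ _)).ne'
  have hc : Continuous fun y : Euc d => θ ‖y‖ / max ‖y‖ a :=
    (hθ.comp continuous_norm).div (by fun_prop) hne
  exact hc.neg.smul (innerSL ℝ).continuous

theorem radialCutoff_eq_zero (hb : b ≤ R) (h0 : ∀ s, b ≤ s → θ s = 0) {y : Euc d}
    (hy : b ≤ ‖y‖) : radialCutoff d θ R y = 0 := radialProfile_eq_zero hb h0 hy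

theorem tsupport_radialCutoff_subset (hb : b ≤ R) (h0 : ∀ s, b ≤ s → θ s = 0) :
    tsupport (radialCutoff d θ R) ⊆ closedBall 0 b := by
  refine closure_minimal (fun y hy => ?_) isClosed_closedBall
  by_contra h
  rw [mem_closedBall_zero_iff, not_le] at h
  exact hy (radialCutoff_eq_zero hb h0 h.le)

theorem hasCompactSupport_radialCutoff (hb : b ≤ R) (h0 : ∀ s, b ≤ s → θ s = 0) :
    HasCompactSupport (radialCutoff d θ R) :=
  (isCompact_closedBall (0 : Euc d) b).of_isClosed_subset (isClosed_tsupport _)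
    (tsupport_radialCutoff_subset hb h0)

theorem divergence_smul_id {η : Euc d → ℝ} (hη : ContDiff ℝ 1 η) (y : Euc d) :
    divergence (fun y => η y • y) y = (d + 1) * η y + fderiv ℝ η y y := by
  have hd := hη.differentiable one_ne_zero y
  have h1 : HasFDerivAt (fun y => η y • y) _ y := hd.hasFDerivAt.smul (hasFDerivAt_id y)
  rw [divergence, h1.fderiv, Euc.fderiv_apply_eq_sum η y y]
  simp [Finset.sum_add_distrib, mul_comm]

theorem fderiv_smul_id_apply {η : Euc d → ℝ} (hη : ContDiff ℝ 1 η) (y w : Euc d) :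
    fderiv ℝ (fun y => η y • y) y w = η y • w + fderiv ℝ η y w • y := by
  have hd := hη.differentiable one_ne_zero y
  have h1 : HasFDerivAt (fun y => η y • y) _ y := hd.hasFDerivAt.smul (hasFDerivAt_id y)
  rw [h1.fderiv]; simp

end TestFunctions

section RadialLimit

variable {d : ℕ} {R ρ σ : ℝ}

/-- Continuous functions increasing to the indicator function of `(ρ, σ)`. -/
def trapezoid (ρ σ : ℝ) (k : ℕ) (s : ℝ) : ℝ := min 1 (k * max 0 (min (s - ρ) (σ - s)))

theorem continuous_trapezoid (k : ℕ) : Continuous (trapezoid ρ σ k) := by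
  unfold trapezoid; fun_prop

theorem trapezoid_nonneg (k : ℕ) (s : ℝ) : 0 ≤ trapezoid ρ σ k s :=
  le_min zero_le_one (mul_nonneg k.cast_nonneg (le_max_left _ _))

theorem trapezoid_le_one (k : ℕ) (s : ℝ) : trapezoid ρ σ k s ≤ 1 := min_le_left _ _

theorem trapezoid_eq_zero {k : ℕ} {s : ℝ} (h : s ≤ ρ ∨ σ ≤ s) : trapezoid ρ σ k s = 0 := by
  have : min (s - ρ) (σ - s) ≤ 0 := by
    rcases h with h | h
    · exact (min_le_left _ _).trans (by linarith)
    · exact (min_le_right _ _).trans (by linarith)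
  simp [trapezoid, max_eq_left this]

theorem tendsto_trapezoid (s : ℝ) :
    Tendsto (fun k => trapezoid ρ σ k s) atTop (𝓝 ((Ioo ρ σ).indicator 1 s)) := by
  by_cases hs : s ∈ Ioo ρ σ
  · have hpos : 0 < min (s - ρ) (σ - s) := lt_min (by linarith [hs.1]) (by linarith [hs.2])
    rw [indicator_of_mem hs]
    refine tendsto_const_nhds.congr' ?_
    have h1 : Tendsto (fun k : ℕ => (k : ℝ) * max 0 (min (s - ρ) (σ - s))) atTop atTop :=
      tendsto_natCast_atTop_atTop.atTop_mul_const (lt_max_of_lt_right hpos)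
    filter_upwards [h1.eventually_ge_atTop 1] with k hk
    exact (min_eq_left hk).symm
  · rw [indicator_of_notMem hs]
    refine tendsto_const_nhds.congr fun k => (trapezoid_eq_zero ?_).symm
    rw [mem_Ioo, not_and_or, not_lt, not_lt] at hs
    exact hs

theorem integral_radial_indicator_eq_zero {P Q : Euc d → ℝ}
    (hP : IntegrableOn P (ball 0 R)) (hQ : IntegrableOn Q (ball 0 R))
    {f : ℝ → ℝ} (hf : Continuous f)
    (h : ∀ θ : ℝ → ℝ, Continuous θ → (∀ s, s ≤ ρ → θ s = 0) → (∀ s, σ ≤ s → θ s = 0) →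
      ∫ y in ball (0 : Euc d) R, (P y * radialProfile θ R ‖y‖ + Q y * θ ‖y‖) = 0) :
    ∫ y in ball (0 : Euc d) R, (P y * radialProfile ((Ioo ρ σ).indicator f) R ‖y‖ +
      Q y * (Ioo ρ σ).indicator f ‖y‖) = 0 := by
  obtain ⟨M, hM⟩ := (isCompact_Icc (a := ρ) (b := σ)).exists_bound_of_continuousOn hf.continuousOn
  have hM' : ∀ k s, |trapezoid ρ σ k s * f s| ≤ |M| := fun k s => by
    by_cases hs : s ∈ Ioo ρ σ
    · rw [abs_mul, abs_of_nonneg (trapezoid_nonneg k s)]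
      have h1 := hM s ⟨hs.1.le, hs.2.le⟩
      rw [Real.norm_eq_abs] at h1
      exact (mul_le_of_le_one_left (abs_nonneg _) (trapezoid_le_one k s)).trans
        (h1.trans (le_abs_self M))
    · rw [mem_Ioo, not_and_or, not_lt, not_lt] at hs
      rw [trapezoid_eq_zero hs]; simp
  have hc : ∀ k, Continuous fun s => trapezoid ρ σ k s * f s :=
    fun k => (continuous_trapezoid k).mul hf
  have hlim : ∀ s, Tendsto (fun k => trapezoid ρ σ k s * f s) atTop
      (𝓝 ((Ioo ρ σ).indicator f s)) := fun s => by
    have := (tendsto_trapezoid (ρ := ρ) (σ := σ) s).mul_const (f s)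
    convert this using 2
    by_cases hs : s ∈ Ioo ρ σ <;> simp [hs]
  have hlim' : ∀ r, Tendsto (fun k => radialProfile (fun s => trapezoid ρ σ k s * f s) R r) atTop
      (𝓝 (radialProfile ((Ioo ρ σ).indicator f) R r)) := fun r => by
    refine intervalIntegral.tendsto_integral_filter_of_dominated_convergence (fun _ => |M|)
      (Eventually.of_forall fun k => (hc k).aestronglyMeasurable)
      (Eventually.of_forall fun k => Eventually.of_forall fun s _ => hM' k s)
      intervalIntegrable_const (Eventually.of_forall fun s _ => hlim s)
  have hb : ∀ k, ∀ r ∈ Icc 0 R,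
      |radialProfile (fun s => trapezoid ρ σ k s * f s) R r| ≤ |M| * R := fun k r hr => by
    have := intervalIntegral.norm_integral_le_of_norm_le_const (a := r) (b := R) (C := |M|)
      (f := fun s => trapezoid ρ σ k s * f s) fun s _ => hM' k s
    refine this.trans (mul_le_mul_of_nonneg_left ?_ (abs_nonneg M))
    rw [abs_of_nonneg (by linarith [hr.2])]; linarith [hr.1]
  have hcp : ∀ k, Continuous (radialProfile (fun s => trapezoid ρ σ k s * f s) R) := fun k =>
    continuous_iff_continuousAt.2 fun r => (hasDerivAt_radialProfile (hc k) r).continuousAt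
  have hzero : ∀ k, ∫ y in ball (0 : Euc d) R,
      (P y * radialProfile (fun s => trapezoid ρ σ k s * f s) R ‖y‖ +
        Q y * (trapezoid ρ σ k ‖y‖ * f ‖y‖)) = 0 := fun k =>
    h _ (hc k) (fun s hs => by rw [trapezoid_eq_zero (.inl hs), zero_mul])
      (fun s hs => by rw [trapezoid_eq_zero (.inr hs), zero_mul])
  refine tendsto_nhds_unique (tendsto_integral_of_dominated_convergence
    (fun y => |P y| * (|M| * R) + |Q y| * |M|) (fun k => ?_) ?_ (fun k => ?_) ?_)
    (tendsto_const_nhds.congr fun k => (hzero k).symm)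
  · exact (hP.aestronglyMeasurable.mul ((hcp k).comp continuous_norm).aestronglyMeasurable).add
      (hQ.aestronglyMeasurable.mul ((hc k).comp continuous_norm).aestronglyMeasurable)
  · exact (hP.abs.mul_const _).add (hQ.abs.mul_const _)
  · filter_upwards [ae_restrict_mem measurableSet_ball] with y hy
    have hy' : ‖y‖ < R := mem_ball_zero_iff.1 hy
    refine (norm_add_le _ _).trans (add_le_add ?_ ?_)
    · rw [norm_mul]
      exact mul_le_mul_of_nonneg_left (hb k _ ⟨norm_nonneg y, hy'.le⟩) (norm_nonneg _)
    · rw [norm_mul]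
      exact mul_le_mul_of_nonneg_left (hM' k _) (norm_nonneg _)
  · exact Eventually.of_forall fun y =>
      ((hlim' ‖y‖).const_mul _).add ((hlim ‖y‖).const_mul _)

end RadialLimit

section PolarCoordinates

variable {d : ℕ}

theorem integral_eq_integral_sphere {f : Euc d → ℝ} (hf : Integrable f) :
    ∫ x, f x = ∫ z : sphere (0 : Euc d) 1, (∫ r in Ioi (0 : ℝ), r ^ d * f (r • (z : Euc d)))
      ∂((volume : Measure (Euc d)).toSphere) := by
  have hdim : Module.finrank ℝ (Euc d) - 1 = d := by simp
  have hmp := (volume : Measure (Euc d)).measurePreserving_homeomorphUnitSphereProd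
  rw [hdim] at hmp
  have hemb := (homeomorphUnitSphereProd (Euc d)).measurableEmbedding
  set g : sphere (0 : Euc d) 1 × Ioi (0 : ℝ) → ℝ := fun p => f (p.2.1 • (p.1 : Euc d)) with hg
  have hgf : ∀ x : ({0}ᶜ : Set (Euc d)), g (homeomorphUnitSphereProd (Euc d) x) = f x.1 :=
    fun x => by
      have := congrArg Subtype.val ((homeomorphUnitSphereProd (Euc d)).symm_apply_apply x)
      rw [homeomorphUnitSphereProd_symm_apply_coe] at this
      rw [hg]; exact congrArg f this
  have hint : Integrable g ((volume : Measure (Euc d)).toSphere.prod (.volumeIoiPow d)) := by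
    rw [← hmp.integrable_comp_emb hemb]
    have : IntegrableOn f ({0}ᶜ : Set (Euc d)) := hf.integrableOn
    rw [integrableOn_iff_comap_subtypeVal (measurableSet_singleton _).compl] at this
    exact this.congr (Eventually.of_forall fun x => (hgf x).symm)
  calc ∫ x, f x = ∫ x : ({(0)}ᶜ : Set (Euc d)), f x.1 ∂((volume : Measure (Euc d)).comap (↑)) := by
        rw [integral_subtype_comap (measurableSet_singleton _).compl f, restrict_compl_singleton]
    _ = ∫ p, g p ∂((volume : Measure (Euc d)).toSphere.prod (.volumeIoiPow d)) := by
        rw [← hmp.integral_comp hemb]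
        exact integral_congr_ae (Eventually.of_forall fun x => (hgf x).symm)
    _ = ∫ z, (∫ r, g (z, r) ∂(.volumeIoiPow d)) ∂((volume : Measure (Euc d)).toSphere) :=
        integral_prod _ hint
    _ = _ := by
        refine integral_congr_ae (Eventually.of_forall fun z => ?_)
        simp only [Measure.volumeIoiPow, ENNReal.ofReal]
        rw [integral_withDensity_eq_integral_smul,
          integral_subtype_comap measurableSet_Ioi
            fun a => Real.toNNReal (a ^ d) • f (a • (z : Euc d)),
          setIntegral_congr_fun measurableSet_Ioi fun x hx => ?_]
        · rw [NNReal.smul_def, Real.coe_toNNReal _ (pow_nonneg hx.out.le _), smul_eq_mul]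
        · exact (measurable_subtype_coe.pow_const _).real_toNNReal

/-- The open spherical shell `ρ < |x| < σ`. -/
def shell (d : ℕ) (ρ σ : ℝ) : Set (Euc d) := {x | ‖x‖ ∈ Ioo ρ σ}

theorem measurableSet_shell (ρ σ : ℝ) : MeasurableSet (shell d ρ σ) :=
  (isOpen_Ioo.preimage continuous_norm).measurableSet

theorem shell_subset_ball {ρ σ R : ℝ} (h : σ ≤ R) : shell d ρ σ ⊆ ball 0 R :=
  fun _ hx => mem_ball_zero_iff.2 (hx.2.trans_le h)

theorem setIntegral_shell {f : Euc d → ℝ} {ρ σ : ℝ} (hρ : 0 ≤ ρ)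
    (hf : IntegrableOn f (shell d ρ σ)) :
    ∫ x in shell d ρ σ, f x = ∫ z : sphere (0 : Euc d) 1, (∫ r in Ioo ρ σ, r ^ d * f (r • (z : Euc d)))
      ∂((volume : Measure (Euc d)).toSphere) := by
  rw [← integral_indicator (measurableSet_shell ρ σ),
    integral_eq_integral_sphere ((integrable_indicator_iff (measurableSet_shell ρ σ)).2 hf)]
  refine integral_congr_ae (Eventually.of_forall fun z => ?_)
  have e : ∀ r ∈ Ioi (0 : ℝ), r ^ d * (shell d ρ σ).indicator f (r • (z : Euc d)) =
      (Ioo ρ σ).indicator (fun r => r ^ d * f (r • (z : Euc d))) r := fun r hr => by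
    have hn : ‖r • (z : Euc d)‖ = r := by
      rw [norm_smul, norm_eq_of_mem_sphere z, mul_one, Real.norm_of_nonneg (le_of_lt hr)]
    by_cases h : r ∈ Ioo ρ σ
    · have h' : r • (z : Euc d) ∈ shell d ρ σ := by rw [shell, mem_ofPred_eq, hn]; exact h
      rw [indicator_of_mem h', indicator_of_mem h]
    · have h' : r • (z : Euc d) ∉ shell d ρ σ := by rw [shell, mem_ofPred_eq, hn]; exact h
      rw [indicator_of_notMem h', indicator_of_notMem h, mul_zero]
  have hsub : Ioo ρ σ ⊆ Ioi (0 : ℝ) := fun r hr => hρ.trans_lt hr.1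
  simp only
  rw [setIntegral_congr_fun measurableSet_Ioi e, setIntegral_indicator measurableSet_Ioo,
    inter_eq_self_of_subset_right hsub]

end PolarCoordinates

/-- A subsonic variational solution in a small ball centred at a point of the hyperplane
`{x_n = 0}` (translated to the origin). The field `G` is the classical gradient in `{v > 0}`,
extended by `0`, and the constitutive functions are regular at all occurring arguments. -/
structure IsLocalSolution (L : CompressibleLiquid) {d : ℕ} (R C δ K : ℝ) (v : Euc d → ℝ)
    (G : Euc d → Euc d) : Prop where
  radius_pos : 0 < R
  growth_nonneg : 0 ≤ C
  regular : L.RegularNearZero δ K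
  radius_lt : R < δ
  growth_lt : C * R < δ
  continuousOn : ContinuousOn v (ball 0 R)
  nonneg : ∀ y ∈ ball (0 : Euc d) R, 0 ≤ v y
  eq_zero : ∀ y ∈ ball (0 : Euc d) R, lastCoord y ≤ 0 → v y = 0
  contDiffOn : ContDiffOn ℝ 2 v (posSet (ball 0 R) v)
  hasGradientAt : ∀ y ∈ posSet (ball 0 R) v, HasGradientAt v (G y) y
  grad_eq_zero : ∀ y, y ∉ posSet (ball 0 R) v → G y = 0
  grad_le : ∀ y ∈ ball (0 : Euc d) R, ‖G y‖ ^ 2 ≤ C * max (lastCoord y) 0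
  domain_variation : ∀ φ : Euc d → Euc d, ContDiff ℝ 1 φ → HasCompactSupport φ →
    tsupport φ ⊆ ball 0 R →
    (∫ x, (L.F (‖G x‖ ^ 2) (lastCoord x) + L.lam (lastCoord x) * chiPos v x) * divergence φ x)
      - 2 * (∫ x, L.dF1 (‖G x‖ ^ 2) (lastCoord x) * inner ℝ (G x) (fderiv ℝ φ x (G x)))
      + (∫ x, (deriv L.lam (lastCoord x) * chiPos v x + L.dF2 (‖G x‖ ^ 2) (lastCoord x))
        * lastCoord (φ x)) = 0

theorem abs_lastCoord_le {d : ℕ} (y : Euc d) : |lastCoord y| ≤ ‖y‖ :=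
  PiLp.norm_apply_le y (Fin.last d)

theorem contDiff_lastCoord {d : ℕ} {n : WithTop ℕ∞} :
    ContDiff ℝ n (lastCoord : Euc d → ℝ) := by
  unfold lastCoord; fun_prop

theorem continuous_lastCoord {d : ℕ} : Continuous (lastCoord : Euc d → ℝ) :=
  (contDiff_lastCoord (n := 0)).continuous

theorem fderiv_lastCoord_apply {d : ℕ} (y w : Euc d) :
    fderiv ℝ (lastCoord : Euc d → ℝ) y w = lastCoord w := by
  have : (lastCoord : Euc d → ℝ) = EuclideanSpace.proj (𝕜 := ℝ) (Fin.last d) := rfl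
  rw [this, ContinuousLinearMap.fderiv]

namespace IsLocalSolution

variable {L : CompressibleLiquid} {d : ℕ} {R C δ K : ℝ} {v : Euc d → ℝ} {G : Euc d → Euc d}

theorem isOpen_posSet (h : IsLocalSolution L R C δ K v G) : IsOpen (posSet (ball 0 R) v) :=
  h.continuousOn.isOpen_inter_preimage isOpen_ball isOpen_Ioi

theorem fderiv_eq (h : IsLocalSolution L R C δ K v G) {y : Euc d} (hy : y ∈ posSet (ball 0 R) v)
    (w : Euc d) : fderiv ℝ v y w = inner ℝ (G y) w := by
  rw [(h.hasGradientAt y hy).hasFDerivAt.fderiv]; rfl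

theorem eq_zero_of_notMem (h : IsLocalSolution L R C δ K v G) {y : Euc d}
    (hy : y ∈ ball 0 R) (hy' : y ∉ posSet (ball 0 R) v) : v y = 0 :=
  le_antisymm (not_lt.1 fun h' => hy' ⟨hy, h'⟩) (h.nonneg y hy)

theorem contDiffOn_grad_apply (h : IsLocalSolution L R C δ K v G) (w : Euc d) :
    ContDiffOn ℝ 1 (fun y => inner ℝ (G y) w) (posSet (ball 0 R) v) := by
  have h1 : ContDiffOn ℝ 1 (fderiv ℝ v) (posSet (ball 0 R) v) :=
    h.contDiffOn.fderiv_of_isOpen h.isOpen_posSet (by norm_num)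
  exact (h1.clm_apply contDiffOn_const).congr fun y hy => (h.fderiv_eq hy w).symm

theorem contDiffOn_grad_coord (h : IsLocalSolution L R C δ K v G) (i : Fin (d + 1)) :
    ContDiffOn ℝ 1 (fun y => G y i) (posSet (ball 0 R) v) :=
  (h.contDiffOn_grad_apply (EuclideanSpace.single i 1)).congr fun y _ => by
    simp [EuclideanSpace.inner_single_right]

theorem contDiffOn_grad (h : IsLocalSolution L R C δ K v G) :
    ContDiffOn ℝ 1 G (posSet (ball 0 R) v) :=
  contDiffOn_euclidean.2 h.contDiffOn_grad_coord

theorem norm_grad_sq_le (h : IsLocalSolution L R C δ K v G) {y : Euc d} (hy : y ∈ ball 0 R) :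
    ‖G y‖ ^ 2 ≤ C * ‖y‖ := by
  refine (h.grad_le y hy).trans (mul_le_mul_of_nonneg_left ?_ h.growth_nonneg)
  exact max_le ((le_abs_self _).trans (abs_lastCoord_le y)) (norm_nonneg y)

theorem arg_mem_ball (h : IsLocalSolution L R C δ K v G) {y : Euc d} (hy : y ∈ ball 0 R) :
    ((‖G y‖ ^ 2, lastCoord y) : ℝ × ℝ) ∈ ball (0 : ℝ × ℝ) δ := by
  have hy' : ‖y‖ < R := mem_ball_zero_iff.1 hy
  rw [mem_ball_zero_iff, Prod.norm_mk, max_lt_iff, Real.norm_of_nonneg (by positivity)]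
  refine ⟨(h.norm_grad_sq_le hy).trans_lt ?_, (abs_lastCoord_le y).trans_lt (hy'.trans h.radius_lt)⟩
  exact (mul_le_mul_of_nonneg_left hy'.le h.growth_nonneg).trans_lt h.growth_lt

theorem lastCoord_mem_ball (h : IsLocalSolution L R C δ K v G) {y : Euc d} (hy : y ∈ ball 0 R) :
    lastCoord y ∈ ball (0 : ℝ) δ := by
  rw [mem_ball_zero_iff]
  exact (abs_lastCoord_le y).trans_lt ((mem_ball_zero_iff.1 hy).trans h.radius_lt)

theorem norm_arg_le (h : IsLocalSolution L R C δ K v G) {y : Euc d} (hy : y ∈ ball 0 R) :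
    ‖((‖G y‖ ^ 2, lastCoord y) : ℝ × ℝ)‖ ≤ (C + 1) * ‖y‖ := by
  rw [Prod.norm_mk, Real.norm_of_nonneg (by positivity)]
  have := h.norm_grad_sq_le hy
  have h2 := abs_lastCoord_le y
  have h3 := mul_nonneg h.growth_nonneg (norm_nonneg y)
  refine max_le (by linarith [norm_nonneg y]) ?_
  rw [Real.norm_eq_abs]
  linarith

/-- The coefficient `∂₁F(|∇v|²; x_n)`. -/
def coeff (L : CompressibleLiquid) (G : Euc d → Euc d) (y : Euc d) : ℝ :=
  L.dF1 (‖G y‖ ^ 2) (lastCoord y)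

/-- The energy density `F(|∇v|²; x_n) + λ(x_n) χ_{v > 0}`. -/
def energy (L : CompressibleLiquid) (v : Euc d → ℝ) (G : Euc d → Euc d) (y : Euc d) : ℝ :=
  L.F (‖G y‖ ^ 2) (lastCoord y) + L.lam (lastCoord y) * chiPos v y

/-- The density `λ'(x_n) χ_{v > 0} + ∂₂F(|∇v|²; x_n)` of the gravity term. -/
def force (L : CompressibleLiquid) (v : Euc d → ℝ) (G : Euc d → Euc d) (y : Euc d) : ℝ :=
  deriv L.lam (lastCoord y) * chiPos v y + L.dF2 (‖G y‖ ^ 2) (lastCoord y)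

theorem chiPos_of_pos {y : Euc d} (h : 0 < v y) : chiPos v y = 1 :=
  indicator_of_mem (s := {x | 0 < v x}) h _

theorem chiPos_of_eq_zero {y : Euc d} (h : v y = 0) : chiPos v y = 0 :=
  indicator_of_notMem (s := {x | 0 < v x}) (by simp [h]) _

theorem contDiffOn_coeff (h : IsLocalSolution L R C δ K v G) :
    ContDiffOn ℝ 1 (coeff L G) (posSet (ball 0 R) v) := by
  have h1 : ContDiffOn ℝ 1 (fun y => ((‖G y‖ ^ 2, lastCoord y) : ℝ × ℝ)) (posSet (ball 0 R) v) :=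
    (h.contDiffOn_grad.norm_sq ℝ).prodMk contDiff_lastCoord.contDiffOn
  exact h.regular.contDiffOn_dF1.comp h1 fun y hy => h.arg_mem_ball hy.1

theorem hasFDerivAt_energy (h : IsLocalSolution L R C δ K v G) {y : Euc d}
    (hy : y ∈ posSet (ball 0 R) v) : HasFDerivAt (energy L v G)
      (coeff L G y • fderiv ℝ (fun y => ‖G y‖ ^ 2) y +
        force L v G y • fderiv ℝ lastCoord y) y := by
  have hG : DifferentiableAt ℝ (fun y => ‖G y‖ ^ 2) y :=
    (((h.contDiffOn_grad.norm_sq ℝ).contDiffAt (h.isOpen_posSet.mem_nhds hy))).differentiableAt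
      one_ne_zero
  have hl : DifferentiableAt ℝ (lastCoord : Euc d → ℝ) y :=
    (contDiff_lastCoord (n := 1)).differentiable one_ne_zero y
  have h1 := HasFDerivAt.comp (g := fun q : ℝ × ℝ => L.F q.1 q.2)
    (f := fun y => ((‖G y‖ ^ 2, lastCoord y) : ℝ × ℝ)) y
    (h.regular.hasFDerivAt_F _ (h.arg_mem_ball hy.1)) (hG.hasFDerivAt.prodMk hl.hasFDerivAt)
  have h2 := (h.regular.hasDerivAt_lam _ (h.lastCoord_mem_ball hy.1)).comp_hasFDerivAt y
    hl.hasFDerivAt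
  have e : energy L v G =ᶠ[𝓝 y]
      fun y => L.F (‖G y‖ ^ 2) (lastCoord y) + L.lam (lastCoord y) := by
    filter_upwards [h.isOpen_posSet.mem_nhds hy] with z hz
    rw [energy, chiPos_of_pos hz.2, mul_one]
  have h3 := (h1.add h2).congr_of_eventuallyEq e
  convert! h3 using 1
  ext w
  simp [coeff, force, chiPos_of_pos hy.2]
  ring

theorem continuousOn_force (h : IsLocalSolution L R C δ K v G) :
    ContinuousOn (force L v G) (posSet (ball 0 R) v) := by
  have h1 : ContinuousOn (fun y => ((‖G y‖ ^ 2, lastCoord y) : ℝ × ℝ)) (posSet (ball 0 R) v) :=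
    ((h.contDiffOn_grad.norm_sq ℝ).prodMk contDiff_lastCoord.contDiffOn).continuousOn
  have h2 : ContinuousOn (fun y => deriv L.lam (lastCoord y)) (posSet (ball 0 R) v) :=
    h.regular.continuousOn_deriv_lam.comp continuous_lastCoord.continuousOn
      fun y hy => h.lastCoord_mem_ball hy.1
  refine (h2.add (h.regular.continuousOn_dF2.comp h1 fun y hy => h.arg_mem_ball hy.1)).congr ?_
  intro y hy
  simp [force, chiPos_of_pos hy.2]

theorem contDiffOn_energy (h : IsLocalSolution L R C δ K v G) :
    ContDiffOn ℝ 1 (energy L v G) (posSet (ball 0 R) v) := by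
  have hU := h.isOpen_posSet
  refine (contDiffOn_succ_iff_fderiv_of_isOpen (n := 0) hU).2
    ⟨fun y hy => (h.hasFDerivAt_energy hy).differentiableAt.differentiableWithinAt, by simp, ?_⟩
  rw [contDiffOn_zero]
  have h1 := (h.contDiffOn_grad.norm_sq ℝ).continuousOn_fderiv_of_isOpen hU le_rfl
  have h2 : Continuous (fderiv ℝ (lastCoord : Euc d → ℝ)) :=
    (contDiff_lastCoord (n := 1)).continuous_fderiv one_ne_zero
  exact ((h.contDiffOn_coeff.continuousOn.smul h1).add
    (h.continuousOn_force.smul h2.continuousOn)).congr fun y hy => (h.hasFDerivAt_energy hy).fderiv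

end IsLocalSolution

namespace IsLocalSolution

variable {L : CompressibleLiquid} {d : ℕ} {R C δ K : ℝ} {v : Euc d → ℝ} {G : Euc d → Euc d}

/-- The coordinate vectors of `ℝⁿ`. -/
abbrev coordVec (i : Fin (d + 1)) : Euc d := EuclideanSpace.single i 1

/-- The divergence of the flux `∂₁F(|∇v|²; x_n) ∇v`. -/
def divFlux (L : CompressibleLiquid) (G : Euc d → Euc d) (y : Euc d) : ℝ :=
  ∑ j, fderiv ℝ (fun y => coeff L G y * G y j) y (coordVec j)

theorem fderiv_grad_coord_symm (h : IsLocalSolution L R C δ K v G) {y : Euc d}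
    (hy : y ∈ posSet (ball 0 R) v) (i j : Fin (d + 1)) :
    fderiv ℝ (fun y => G y i) y (coordVec j) = fderiv ℝ (fun y => G y j) y (coordVec i) := by
  have hU := h.isOpen_posSet.mem_nhds hy
  have hcd := h.contDiffOn.contDiffAt hU
  have hsymm : IsSymmSndFDerivAt ℝ v y := hcd.isSymmSndFDerivAt (by simp)
  have hd : DifferentiableAt ℝ (fderiv ℝ v) y :=
    (hcd.fderiv_right (m := 1) (by norm_num)).differentiableAt one_ne_zero
  have key : ∀ i j : Fin (d + 1), fderiv ℝ (fun y => G y i) y (coordVec j) =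
      fderiv ℝ (fderiv ℝ v) y (coordVec j) (coordVec i) := fun i j => by
    have e : (fun y => G y i) =ᶠ[𝓝 y] fun y => fderiv ℝ v y (coordVec i) := by
      filter_upwards [hU] with z hz
      rw [h.fderiv_eq hz]
      simp [EuclideanSpace.inner_single_right]
    rw [e.fderiv_eq]
    have := (hd.hasFDerivAt.clm_apply (hasFDerivAt_const (coordVec i) y)).fderiv
    rw [this]; simp
  rw [key, key, hsymm.eq]

theorem continuousOn_divFlux (h : IsLocalSolution L R C δ K v G) :
    ContinuousOn (divFlux L G) (posSet (ball 0 R) v) := by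
  refine continuousOn_finsetSum _ fun j _ => ?_
  exact ((h.contDiffOn_coeff.mul (h.contDiffOn_grad_coord j)).continuousOn_fderiv_of_isOpen
    h.isOpen_posSet le_rfl).clm_apply continuousOn_const

theorem fderiv_normSq_apply (h : IsLocalSolution L R C δ K v G) {y : Euc d}
    (hy : y ∈ posSet (ball 0 R) v) (w : Euc d) :
    fderiv ℝ (fun y => ‖G y‖ ^ 2) y w = 2 * ∑ j, G y j * fderiv ℝ (fun y => G y j) y w := by
  have hU := h.isOpen_posSet.mem_nhds hy
  have hd : ∀ j, HasFDerivAt (fun y => G y j) (fderiv ℝ (fun y => G y j) y) y := fun j =>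
    (((h.contDiffOn_grad_coord j).contDiffAt hU).differentiableAt one_ne_zero).hasFDerivAt
  have e : (fun y => ‖G y‖ ^ 2) = fun y => ∑ j, G y j ^ 2 := by
    funext y; exact EuclideanSpace.real_norm_sq_eq _
  rw [e, (HasFDerivAt.fun_sum fun j _ => (hd j).pow 2).fderiv, Finset.mul_sum]
  simp [mul_assoc]

theorem domain_variation_coord (h : IsLocalSolution L R C δ K v G) (i : Fin (d + 1))
    {η : Euc d → ℝ} (hη : ContDiff ℝ 1 η) (hηc : HasCompactSupport η)
    (hηU : tsupport η ⊆ ball 0 R) :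
    (∫ x, energy L v G x * fderiv ℝ η x (coordVec i))
      - 2 * (∫ x, coeff L G x * (fderiv ℝ η x (G x) * G x i))
      + (∫ x, force L v G x * (η x * lastCoord (coordVec i))) = 0 := by
  have hfd : ∀ x w, fderiv ℝ (fun x => η x • coordVec i) x w = fderiv ℝ η x w • coordVec i :=
    fun x w => by
      rw [((hη.differentiable one_ne_zero x).hasFDerivAt.smul_const (coordVec i)).fderiv]
      simp
  have := h.domain_variation (fun x => η x • coordVec i) (hη.smul contDiff_const)
    (hηc.smul_right) ((tsupport_smul_subset_left η _).trans hηU)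
  have e1 : ∀ x, divergence (fun x => η x • coordVec i) x = fderiv ℝ η x (coordVec i) :=
    fun x => by simp [divergence, hfd]
  have e2 : ∀ x, inner ℝ (G x) (fderiv ℝ (fun x => η x • coordVec i) x (G x)) =
      fderiv ℝ η x (G x) * G x i := fun x => by
    rw [hfd, inner_smul_right]; simp [EuclideanSpace.inner_single_right]
  have e3 : ∀ x, lastCoord (η x • coordVec i) = η x * lastCoord (coordVec i) := fun x => by
    simp [lastCoord]
  simp only [e1, e2, e3] at this
  exact this

theorem divFlux_mul_grad_eq_zero (h : IsLocalSolution L R C δ K v G) {y : Euc d}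
    (hy : y ∈ posSet (ball 0 R) v) (i : Fin (d + 1)) : divFlux L G y * G y i = 0 := by
  have hU := h.isOpen_posSet
  have hc := h.contDiffOn_coeff
  have hG := h.contDiffOn_grad_coord
  set f : Euc d → ℝ := fun x => -fderiv ℝ (energy L v G) x (coordVec i)
    + 2 * ∑ j, fderiv ℝ (fun x => coeff L G x * G x j * G x i) x (coordVec j)
    + force L v G x * lastCoord (coordVec i) with hf
  have hP : ∀ j, ContDiffOn ℝ 1 (fun x => coeff L G x * G x j * G x i) (posSet (ball 0 R) v) :=
    fun j => (hc.mul (hG j)).mul (hG i)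
  have hPd : ∀ j, ContinuousOn
      (fun x => fderiv ℝ (fun x => coeff L G x * G x j * G x i) x (coordVec j))
      (posSet (ball 0 R) v) := fun j =>
    ((hP j).continuousOn_fderiv_of_isOpen hU le_rfl).clm_apply continuousOn_const
  have hEd : ContinuousOn (fun x => fderiv ℝ (energy L v G) x (coordVec i))
      (posSet (ball 0 R) v) :=
    (h.contDiffOn_energy.continuousOn_fderiv_of_isOpen hU le_rfl).clm_apply continuousOn_const
  have hfc : ContinuousOn f (posSet (ball 0 R) v) :=
    (hEd.neg.add (continuousOn_const.mul (continuousOn_finsetSum _ fun j _ => hPd j))).add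
      (h.continuousOn_force.mul continuousOn_const)
  have hint : ∀ η : Euc d → ℝ, ContDiff ℝ ∞ η → HasCompactSupport η →
      tsupport η ⊆ posSet (ball 0 R) v → ∫ x, η x • f x = 0 := fun η hη hηc hηU => by
    have hη1 : ContDiff ℝ 1 η := hη.of_le (by exact_mod_cast le_top)
    have hdv := h.domain_variation_coord i hη1 hηc (hηU.trans fun x hx => hx.1)
    have hηd : ∀ w, Continuous fun x => fderiv ℝ η x w := fun w =>
      (hη1.continuous_fderiv one_ne_zero).clm_apply continuous_const
    have hηs : ∀ w, tsupport (fun x => fderiv ℝ η x w) ⊆ posSet (ball 0 R) v := fun w =>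
      (tsupport_fderiv_apply_subset ℝ w).trans hηU
    have i1 := integrable_mul_of_tsupport_subset hU hEd hη.continuous hηc hηU
    have i2 := fun j => integrable_mul_of_tsupport_subset hU (hPd j) hη.continuous hηc hηU
    have i3 := integrable_mul_of_tsupport_subset hU
      (h.continuousOn_force.mul (continuousOn_const (c := lastCoord (coordVec i))))
      hη.continuous hηc hηU
    have i4 := fun j => integrable_mul_of_tsupport_subset hU (hP j).continuousOn
      (hηd (coordVec j)) (hηc.fderiv_apply (𝕜 := ℝ) _) (hηs _)
    rw [integral_mul_fderiv_eq_neg_of_tsupport_subset hU h.contDiffOn_energy hη1 hηc hηU] at hdv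
    have e2 : ∫ x, coeff L G x * (fderiv ℝ η x (G x) * G x i) =
        -∑ j, ∫ x, fderiv ℝ (fun x => coeff L G x * G x j * G x i) x (coordVec j) * η x := by
      rw [← Finset.sum_neg_distrib]
      simp_rw [← fun j =>
        integral_mul_fderiv_eq_neg_of_tsupport_subset hU (hP j) hη1 hηc hηU (coordVec j)]
      rw [← integral_finsetSum _ fun j _ => i4 j]
      congr 1
      funext x
      rw [Euc.fderiv_apply_eq_sum η x (G x), Finset.sum_mul, Finset.mul_sum]
      exact Finset.sum_congr rfl fun j _ => by ring
    have e3 : ∫ x, η x • f x = -(∫ x, fderiv ℝ (energy L v G) x (coordVec i) * η x)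
        + 2 * (∑ j, ∫ x, fderiv ℝ (fun x => coeff L G x * G x j * G x i) x (coordVec j) * η x)
        + ∫ x, force L v G x * (η x * lastCoord (coordVec i)) := by
      have j1 : Integrable fun x => -(fderiv ℝ (energy L v G) x (coordVec i) * η x) := i1.neg
      have j2 : Integrable fun x => 2 * ∑ j,
          fderiv ℝ (fun x => coeff L G x * G x j * G x i) x (coordVec j) * η x :=
        (integrable_finsetSum _ fun j _ => i2 j).const_mul 2
      have j12 : Integrable fun x => -(fderiv ℝ (energy L v G) x (coordVec i) * η x) + 2 * ∑ j,
          fderiv ℝ (fun x => coeff L G x * G x j * G x i) x (coordVec j) * η x := j1.add j2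
      have j3 : Integrable fun x => force L v G x * (η x * lastCoord (coordVec i)) :=
        i3.congr (Eventually.of_forall fun x => by simp; ring)
      rw [← integral_finsetSum _ fun j _ => i2 j, ← integral_const_mul, ← integral_neg,
        ← integral_add j1 j2, ← integral_add j12 j3]
      congr 1
      funext x
      simp only [hf, smul_eq_mul, ← Finset.sum_mul]
      ring
    rw [e3]
    rw [e2] at hdv
    linarith
  have hae := hU.ae_eq_zero_of_integral_contDiff_smul_eq_zero
    (hfc.locallyIntegrableOn hU.measurableSet) hint
  have hzero : f y = 0 := by
    have : f =ᵐ[volume.restrict (posSet (ball 0 R) v)] fun _ => 0 := by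
      rw [Filter.EventuallyEq, ae_restrict_iff' hU.measurableSet]; exact hae
    exact Measure.eqOn_open_of_ae_eq this hU hfc continuousOn_const hy
  have hmem := hU.mem_nhds hy
  have e4 : fderiv ℝ (energy L v G) y (coordVec i) =
      coeff L G y * (2 * ∑ j, G y j * fderiv ℝ (fun y => G y j) y (coordVec i)) +
        force L v G y * lastCoord (coordVec i) := by
    rw [(h.hasFDerivAt_energy hy).fderiv]
    simp only [add_apply, smul_apply, smul_eq_mul,
      fderiv_lastCoord_apply, h.fderiv_normSq_apply hy]
  have e5 : ∀ j, fderiv ℝ (fun x => coeff L G x * G x j * G x i) y (coordVec j) =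
      fderiv ℝ (fun x => coeff L G x * G x j) y (coordVec j) * G y i +
        coeff L G y * (G y j * fderiv ℝ (fun y => G y j) y (coordVec i)) := fun j => by
    have h1 := (((hc.mul (hG j)).contDiffAt hmem).differentiableAt one_ne_zero).hasFDerivAt
    have h2 := (((hG i).contDiffAt hmem).differentiableAt one_ne_zero).hasFDerivAt
    rw [(h1.fun_mul h2).fderiv, ← h.fderiv_grad_coord_symm hy i j]
    simp
    ring
  have e6 : f y = 2 * (divFlux L G y * G y i) := by
    simp only [hf, e4, e5, Finset.sum_add_distrib, ← Finset.sum_mul, ← Finset.mul_sum, divFlux]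
    ring
  linarith

/-- The equation `div(∂₁F(|∇v|²; x_n) ∇v) = 0` holds in `{v > 0}`. -/
theorem divFlux_eq_zero (h : IsLocalSolution L R C δ K v G) {y : Euc d}
    (hy : y ∈ posSet (ball 0 R) v) : divFlux L G y = 0 := by
  by_contra hne
  have hopen : IsOpen (posSet (ball 0 R) v ∩ {z | divFlux L G z ≠ 0}) :=
    h.continuousOn_divFlux.isOpen_inter_preimage h.isOpen_posSet isOpen_ne
  apply hne
  refine Finset.sum_eq_zero fun j _ => ?_
  have : (fun z => coeff L G z * G z j) =ᶠ[𝓝 y] fun _ => 0 := by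
    filter_upwards [hopen.mem_nhds ⟨hy, hne⟩] with z hz
    rw [(mul_eq_zero.1 (h.divFlux_mul_grad_eq_zero hz.1 j)).resolve_left hz.2, mul_zero]
  rw [this.fderiv_eq]
  simp

/-- Weak form of the equation in `{v > 0}`. -/
theorem integral_coeff_mul_fderiv_grad_eq_zero (h : IsLocalSolution L R C δ K v G)
    {ζ : Euc d → ℝ} (hζ : ContDiff ℝ 1 ζ) (hζc : HasCompactSupport ζ)
    (hζU : tsupport ζ ⊆ posSet (ball 0 R) v) :
    ∫ x, coeff L G x * fderiv ℝ ζ x (G x) = 0 := by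
  have hU := h.isOpen_posSet
  have hP : ∀ j, ContDiffOn ℝ 1 (fun x => coeff L G x * G x j) (posSet (ball 0 R) v) :=
    fun j => h.contDiffOn_coeff.mul (h.contDiffOn_grad_coord j)
  have hPd : ∀ j, ContinuousOn
      (fun x => fderiv ℝ (fun x => coeff L G x * G x j) x (coordVec j))
      (posSet (ball 0 R) v) := fun j =>
    ((hP j).continuousOn_fderiv_of_isOpen hU le_rfl).clm_apply continuousOn_const
  have hζd : ∀ w, Continuous fun x => fderiv ℝ ζ x w := fun w =>
    (hζ.continuous_fderiv one_ne_zero).clm_apply continuous_const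
  have i4 := fun j => integrable_mul_of_tsupport_subset hU (hP j).continuousOn
    (hζd (coordVec j)) (hζc.fderiv_apply (𝕜 := ℝ) _)
    ((tsupport_fderiv_apply_subset ℝ _).trans hζU)
  have e1 : ∀ x, coeff L G x * fderiv ℝ ζ x (G x) =
      ∑ j, coeff L G x * G x j * fderiv ℝ ζ x (coordVec j) := fun x => by
    rw [Euc.fderiv_apply_eq_sum ζ x (G x), Finset.mul_sum]
    exact Finset.sum_congr rfl fun j _ => by ring
  simp_rw [e1]
  rw [integral_finsetSum _ fun j _ => i4 j]
  simp_rw [fun j => integral_mul_fderiv_eq_neg_of_tsupport_subset hU (hP j) hζ hζc hζU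
    (coordVec j)]
  rw [Finset.sum_neg_distrib, ← integral_finsetSum _ fun j _ =>
    integrable_mul_of_tsupport_subset hU (hPd j) hζ.continuous hζc hζU]
  simp_rw [← Finset.sum_mul]
  rw [neg_eq_zero]
  refine integral_eq_zero_of_ae (Eventually.of_forall fun x => ?_)
  by_cases hx : x ∈ posSet (ball 0 R) v
  · have := h.divFlux_eq_zero hx
    rw [divFlux] at this
    simp [this]
  · have : ζ x = 0 := image_eq_zero_of_notMem_tsupport fun hx' => hx (hζU hx')
    simp [this]

end IsLocalSolution

section RampTest

variable {d : ℕ} {B : Set (Euc d)} {w η : Euc d → ℝ} {ε : ℝ}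

theorem tsupport_ramp_mul_subset (hw : ContinuousOn w B) (hε : 0 < ε)
    (hηB : tsupport η ⊆ B) :
    tsupport (fun x => ramp ε (w x) * η x) ⊆ {x | x ∈ tsupport η ∧ ε ≤ w x} := by
  have hcl : IsClosed (tsupport η ∩ w ⁻¹' Ici ε) :=
    (hw.mono hηB).preimage_isClosed_of_isClosed (isClosed_tsupport η) isClosed_Ici
  refine closure_minimal (fun x hx => ⟨?_, ?_⟩) hcl
  · exact subset_tsupport η fun h0 => hx (by simp [h0])
  · by_contra h
    exact hx (by simp [ramp_eq_zero hε (not_le.1 h).le])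

theorem hasFDerivAt_ramp_mul (hB : IsOpen B) (hw : ContinuousOn w B)
    (hwd : ContDiffOn ℝ 1 w (B ∩ {x | 0 < w x})) (hε : 0 < ε) (hη : ContDiff ℝ 1 η)
    (hηB : tsupport η ⊆ B) (x : Euc d) :
    HasFDerivAt (fun x => ramp ε (w x) * η x)
      ((rampDeriv ε (w x) * η x) • fderiv ℝ w x + ramp ε (w x) • fderiv ℝ η x) x := by
  have hV : IsOpen (B ∩ {x | 0 < w x}) := hw.isOpen_inter_preimage hB isOpen_Ioi
  by_cases hx : x ∈ B ∩ {x | 0 < w x}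
  · have h1 := ((hwd.contDiffAt (hV.mem_nhds hx)).differentiableAt one_ne_zero).hasFDerivAt
    have h2 := (hasDerivAt_ramp ε (w x)).comp_hasFDerivAt x h1
    convert! h2.fun_mul (hη.differentiable one_ne_zero x).hasFDerivAt using 1
    ext y
    simp
    ring
  · have hx' : x ∉ tsupport fun x => ramp ε (w x) * η x := fun h => by
      have := tsupport_ramp_mul_subset hw hε hηB h
      exact hx ⟨hηB this.1, hε.trans_le this.2⟩
    have h0 := HasFDerivAt.of_notMem_tsupport (𝕜 := ℝ) hx'
    convert! h0 using 1
    by_cases hxη : x ∈ tsupport η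
    · have hwx : w x ≤ ε := by
        by_contra! h
        exact hx ⟨hηB hxη, hε.trans h⟩
      simp [rampDeriv_eq_zero hε hwx, ramp_eq_zero hε hwx]
    · simp [image_eq_zero_of_notMem_tsupport hxη, fderiv_of_notMem_tsupport ℝ hxη]

theorem contDiff_ramp_mul (hB : IsOpen B) (hw : ContinuousOn w B)
    (hwd : ContDiffOn ℝ 1 w (B ∩ {x | 0 < w x})) (hε : 0 < ε) (hη : ContDiff ℝ 1 η)
    (hηB : tsupport η ⊆ B) :
    ContDiff ℝ 1 (fun x => ramp ε (w x) * η x) := by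
  have hV : IsOpen (B ∩ {x | 0 < w x}) := hw.isOpen_inter_preimage hB isOpen_Ioi
  refine contDiff_iff_contDiffAt.2 fun x => ?_
  by_cases hx : x ∈ B ∩ {x | 0 < w x}
  · exact ((contDiff_ramp ε).contDiffAt.comp x (hwd.contDiffAt (hV.mem_nhds hx))).mul
      hη.contDiffAt
  · have hx' : x ∉ tsupport fun x => ramp ε (w x) * η x := fun h => by
      have := tsupport_ramp_mul_subset hw hε hηB h
      exact hx ⟨hηB this.1, hε.trans_le this.2⟩
    exact contDiffAt_const.congr_of_eventuallyEq (notMem_tsupport_iff_eventuallyEq.1 hx')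

end RampTest

namespace IsLocalSolution

variable {L : CompressibleLiquid} {d : ℕ} {R C δ K : ℝ} {v : Euc d → ℝ} {G : Euc d → Euc d}

theorem norm_grad_le (h : IsLocalSolution L R C δ K v G) {y : Euc d} (hy : y ∈ ball 0 R) :
    ‖G y‖ ≤ √(C * ‖y‖) := Real.le_sqrt_of_sq_le (h.norm_grad_sq_le hy)

theorem zero_mem_ball (h : IsLocalSolution L R C δ K v G) : (0 : Euc d) ∈ ball (0 : Euc d) R :=
  mem_ball_self h.radius_pos

theorem apply_zero (h : IsLocalSolution L R C δ K v G) : v 0 = 0 :=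
  h.eq_zero 0 h.zero_mem_ball (by simp [lastCoord])

theorem sub_le (h : IsLocalSolution L R C δ K v G) {r : ℝ} (hr : r ≤ R) {x y : Euc d}
    (hx : x ∈ ball 0 r) (hy : y ∈ ball 0 r) : v y - v x ≤ √(C * r) * ‖y - x‖ := by
  rcases le_or_gt (v y) (v x) with hle | hlt
  · have : 0 ≤ √(C * r) * ‖y - x‖ := by positivity
    linarith
  set γ : ℝ → Euc d := fun τ => x + τ • (y - x) with hγ
  have hγc : Continuous γ := by fun_prop
  have hγr : ∀ τ ∈ Icc (0 : ℝ) 1, γ τ ∈ ball 0 r := fun τ hτ =>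
    (convex_ball (0 : Euc d) r).add_smul_sub_mem hx hy hτ
  have hγm : ∀ τ ∈ Icc (0 : ℝ) 1, γ τ ∈ ball 0 R := fun τ hτ => ball_subset_ball hr (hγr τ hτ)
  have hfc : ContinuousOn (fun τ => v (γ τ)) (Icc 0 1) :=
    h.continuousOn.comp hγc.continuousOn hγm
  have hcomp : IsCompact (Icc (0 : ℝ) 1 ∩ (fun τ => v (γ τ)) ⁻¹' Iic (v x)) :=
    isCompact_Icc.of_isClosed_subset (hfc.preimage_isClosed_of_isClosed isClosed_Icc isClosed_Iic)
      inter_subset_left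
  obtain ⟨τ₀, hτ₀, hmax⟩ := hcomp.exists_isGreatest ⟨0, by simp [hγ]⟩
  have hτ1 : τ₀ < 1 := by
    refine lt_of_le_of_ne hτ₀.1.2 fun h1 => ?_
    have := hτ₀.2
    rw [h1] at this
    simp [hγ] at this
    linarith
  have hpos : ∀ τ ∈ Ioo τ₀ 1, γ τ ∈ posSet (ball 0 R) v := fun τ hτ => by
    have hτI : τ ∈ Icc (0 : ℝ) 1 := ⟨hτ₀.1.1.trans hτ.1.le, hτ.2.le⟩
    refine ⟨hγm τ hτI, ?_⟩
    by_contra! hle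
    have := hmax ⟨hτI, hle.trans (h.nonneg x (ball_subset_ball hr hx))⟩
    linarith [hτ.1]
  obtain ⟨c, hc, hslope⟩ := exists_hasDerivAt_eq_slope (fun τ => v (γ τ))
    (fun τ => inner ℝ (G (γ τ)) (y - x)) hτ1
    (hfc.mono (Icc_subset_Icc_left hτ₀.1.1)) fun τ hτ => by
      have h1 := (h.hasGradientAt _ (hpos τ hτ)).hasFDerivAt
      have h2 : HasDerivAt γ (y - x) τ := by
        have h3 := ((hasDerivAt_id τ).smul_const (y - x)).const_add x
        rw [one_smul] at h3
        exact h3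
      exact h1.comp_hasDerivAt τ h2
  have hcI : c ∈ Icc (0 : ℝ) 1 := ⟨hτ₀.1.1.trans hc.1.le, hc.2.le⟩
  have hGc : ‖G (γ c)‖ ≤ √(C * r) := (h.norm_grad_le (hγm c hcI)).trans
    (Real.sqrt_le_sqrt (mul_le_mul_of_nonneg_left (mem_ball_zero_iff.1 (hγr c hcI)).le
      h.growth_nonneg))
  have h3 : inner ℝ (G (γ c)) (y - x) ≤ √(C * r) * ‖y - x‖ :=
    (real_inner_le_norm _ _).trans (mul_le_mul_of_nonneg_right hGc (norm_nonneg _))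
  rw [eq_div_iff (by linarith)] at hslope
  have h4 : v (γ 1) = v y := by simp [hγ]
  have h5 : v (γ τ₀) ≤ v x := hτ₀.2
  have h6 : inner ℝ (G (γ c)) (y - x) * (1 - τ₀) ≤ √(C * r) * ‖y - x‖ * 1 :=
    mul_le_mul h3 (by linarith [hτ₀.1.1]) (by linarith) (by positivity)
  linarith

theorem abs_sub_le (h : IsLocalSolution L R C δ K v G) {r : ℝ} (hr : r ≤ R) {x y : Euc d}
    (hx : x ∈ ball 0 r) (hy : y ∈ ball 0 r) : |v x - v y| ≤ √(C * r) * ‖x - y‖ :=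
  abs_sub_le_iff.2 ⟨h.sub_le hr hy hx, by rw [norm_sub_rev]; exact h.sub_le hr hx hy⟩

theorem sq_le (h : IsLocalSolution L R C δ K v G) {y : Euc d} (hy : y ∈ ball 0 R) :
    v y ^ 2 ≤ C * ‖y‖ ^ 3 := by
  have hlim : v y ≤ √(C * ‖y‖) * ‖y‖ := by
    have hy' := mem_ball_zero_iff.1 hy
    have hcont : Tendsto (fun r => √(C * r) * ‖y‖) (𝓝[>] ‖y‖) (𝓝 (√(C * ‖y‖) * ‖y‖)) := by
      have : Continuous fun r => √(C * r) * ‖y‖ := by fun_prop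
      exact this.continuousWithinAt
    refine ge_of_tendsto hcont ?_
    filter_upwards [Ioo_mem_nhdsGT hy'] with r hr
    have h0 : (0 : Euc d) ∈ ball 0 r := mem_ball_self ((norm_nonneg y).trans_lt hr.1)
    have := h.sub_le hr.2.le h0 (mem_ball_zero_iff.2 hr.1)
    simpa [h.apply_zero] using this
  have h0 := h.nonneg y hy
  calc v y ^ 2 ≤ (√(C * ‖y‖) * ‖y‖) ^ 2 := by gcongr
    _ = C * ‖y‖ ^ 3 := by
        rw [mul_pow, Real.sq_sqrt (mul_nonneg h.growth_nonneg (norm_nonneg y))]; ring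

theorem inner_sq_le (h : IsLocalSolution L R C δ K v G) {y : Euc d} (hy : y ∈ ball 0 R) :
    inner ℝ (G y) y ^ 2 ≤ C * ‖y‖ ^ 3 := by
  have h1 : inner ℝ (G y) y ^ 2 ≤ (‖G y‖ * ‖y‖) ^ 2 := by
    rw [← sq_abs (inner ℝ (G y) y)]
    exact pow_le_pow_left₀ (abs_nonneg _) (abs_real_inner_le_norm _ _) 2
  have h2 := mul_le_mul_of_nonneg_right (h.norm_grad_sq_le hy) (sq_nonneg ‖y‖)
  calc _ ≤ _ := h1
    _ = ‖G y‖ ^ 2 * ‖y‖ ^ 2 := by ring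
    _ ≤ _ := h2
    _ = _ := by ring

theorem abs_mul_inner_le (h : IsLocalSolution L R C δ K v G) {y : Euc d} (hy : y ∈ ball 0 R) :
    |v y * inner ℝ (G y) y| ≤ C * ‖y‖ ^ 3 := by
  have h1 := h.sq_le hy
  have h2 := h.inner_sq_le hy
  rw [abs_le]
  constructor <;> nlinarith [sq_nonneg (v y - inner ℝ (G y) y), sq_nonneg (v y + inner ℝ (G y) y)]

/-- The square of a local solution is differentiable everywhere, also on the free boundary. -/
theorem hasFDerivAt_sq (h : IsLocalSolution L R C δ K v G) {y : Euc d} (hy : y ∈ ball 0 R) :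
    HasFDerivAt (fun y => v y ^ 2) ((2 * v y) • innerSL ℝ (G y)) y := by
  by_cases hyV : y ∈ posSet (ball 0 R) v
  · convert! (h.hasGradientAt y hyV).hasFDerivAt.pow 2 using 1
    ext w; simp
  · have h0 := h.eq_zero_of_notMem hy hyV
    rw [h0, mul_zero, zero_smul]
    refine Asymptotics.IsBigO.hasFDerivAt (n := 2) ?_ (by norm_num)
    refine Asymptotics.IsBigO.of_bound (C * R) ?_
    filter_upwards [isOpen_ball.mem_nhds hy] with z hz
    have h1 := h.abs_sub_le le_rfl hz hy
    rw [h0, sub_zero] at h1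
    rw [Real.norm_eq_abs, abs_pow, Real.norm_eq_abs, abs_of_nonneg (sq_nonneg ‖z - y‖)]
    calc |v z| ^ 2 ≤ (√(C * R) * ‖z - y‖) ^ 2 := by gcongr
      _ = _ := by rw [mul_pow, Real.sq_sqrt (mul_nonneg h.growth_nonneg h.radius_pos.le)]

theorem continuousOn_smul_grad (h : IsLocalSolution L R C δ K v G) :
    ContinuousOn (fun y => v y • G y) (ball 0 R) := by
  intro y hy
  by_cases hyV : y ∈ posSet (ball 0 R) v
  · have hm := h.isOpen_posSet.mem_nhds hyV
    exact (((h.continuousOn.continuousAt (isOpen_ball.mem_nhds hy))).smul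
      (h.contDiffOn_grad.continuousOn.continuousAt hm)).continuousWithinAt
  · have h0 := h.eq_zero_of_notMem hy hyV
    have hc : Tendsto (fun z => |v z| * √(C * R)) (𝓝[ball 0 R] y) (𝓝 0) := by
      have := ((h.continuousOn y hy).abs).mul_const (√(C * R))
      simpa [h0, ContinuousWithinAt] using this
    rw [ContinuousWithinAt, h0, zero_smul]
    refine squeeze_zero_norm' ?_ hc
    filter_upwards [self_mem_nhdsWithin] with z hz
    rw [norm_smul, Real.norm_eq_abs]
    refine mul_le_mul_of_nonneg_left ((h.norm_grad_le hz).trans (Real.sqrt_le_sqrt ?_))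
      (abs_nonneg _)
    exact mul_le_mul_of_nonneg_left (mem_ball_zero_iff.1 hz).le h.growth_nonneg

theorem integrableOn_of_continuousOn (h : IsLocalSolution L R C δ K v G) {f : Euc d → ℝ} {M : ℝ}
    (hf : ContinuousOn f (posSet (ball 0 R) v))
    (h0 : ∀ y ∈ ball (0 : Euc d) R, y ∉ posSet (ball 0 R) v → f y = 0)
    (hM : ∀ y ∈ ball (0 : Euc d) R, |f y| ≤ M) : IntegrableOn f (ball 0 R) := by
  have hV := h.isOpen_posSet.measurableSet
  have hm : AEStronglyMeasurable f (volume.restrict (ball 0 R)) := by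
    have h1 : AEStronglyMeasurable ((posSet (ball 0 R) v).indicator f) volume :=
      (aestronglyMeasurable_indicator_iff hV).2 (hf.aestronglyMeasurable hV)
    refine h1.restrict.congr ?_
    filter_upwards [ae_restrict_mem measurableSet_ball] with y hy
    by_cases hyV : y ∈ posSet (ball 0 R) v
    · rw [indicator_of_mem hyV]
    · rw [indicator_of_notMem hyV, h0 y hy hyV]
  have : IsFiniteMeasure (volume.restrict (ball (0 : Euc d) R)) :=
    ⟨by simpa using measure_ball_lt_top⟩
  refine Integrable.of_bound hm M ?_
  filter_upwards [ae_restrict_mem measurableSet_ball] with y hy using hM y hy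

theorem abs_coeff_sub_le (h : IsLocalSolution L R C δ K v G) {y : Euc d} (hy : y ∈ ball 0 R) :
    |coeff L G y - 1 / L.rho0| ≤ K * (C + 1) * ‖y‖ := by
  refine (h.regular.dF1_sub_le _ (h.arg_mem_ball hy)).trans ?_
  rw [mul_assoc]
  exact mul_le_mul_of_nonneg_left (h.norm_arg_le hy) h.regular.const_nonneg

theorem abs_F_sub_le (h : IsLocalSolution L R C δ K v G) {y : Euc d} (hy : y ∈ ball 0 R) :
    |L.F (‖G y‖ ^ 2) (lastCoord y) - ‖G y‖ ^ 2 * (1 / L.rho0)| ≤ K * (C + 1) * C * ‖y‖ ^ 2 := by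
  have hK := h.regular.const_nonneg
  have hC := h.growth_nonneg
  have ht0 : 0 ≤ ‖G y‖ ^ 2 := by positivity
  have := h.regular.F_sub_le _ (h.arg_mem_ball hy)
  simp only [abs_of_nonneg ht0] at this
  rw [mul_one_div]
  refine this.trans ?_
  calc _ ≤ K * ((C + 1) * ‖y‖) * (C * ‖y‖) :=
        mul_le_mul (mul_le_mul_of_nonneg_left (h.norm_arg_le hy) hK) (h.norm_grad_sq_le hy) ht0
          (by positivity)
    _ = _ := by ring

theorem abs_dF2_le (h : IsLocalSolution L R C δ K v G) {y : Euc d} (hy : y ∈ ball 0 R) :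
    |L.dF2 (‖G y‖ ^ 2) (lastCoord y)| ≤ K * C * ‖y‖ := by
  have ht0 : 0 ≤ ‖G y‖ ^ 2 := by positivity
  have := h.regular.dF2_le _ (h.arg_mem_ball hy)
  simp only [abs_of_nonneg ht0] at this
  rw [mul_assoc]
  exact this.trans (mul_le_mul_of_nonneg_left (h.norm_grad_sq_le hy) h.regular.const_nonneg)

theorem abs_lam_sub_le (h : IsLocalSolution L R C δ K v G) {y : Euc d} (hy : y ∈ ball 0 R) :
    |L.lam (lastCoord y) - lastCoord y * (1 / L.rho0)| ≤ K * ‖y‖ ^ 2 := by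
  have hK := h.regular.const_nonneg
  have hl := abs_lastCoord_le y
  rw [mul_one_div]
  refine (h.regular.lam_sub_le _ (h.lastCoord_mem_ball hy)).trans ?_
  calc _ ≤ K * ‖y‖ * ‖y‖ := mul_le_mul (mul_le_mul_of_nonneg_left hl hK) hl (abs_nonneg _)
        (by positivity)
    _ = _ := by ring

theorem abs_deriv_lam_sub_le (h : IsLocalSolution L R C δ K v G) {y : Euc d}
    (hy : y ∈ ball 0 R) : |deriv L.lam (lastCoord y) - 1 / L.rho0| ≤ K * ‖y‖ :=
  (h.regular.deriv_lam_sub_le _ (h.lastCoord_mem_ball hy)).trans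
    (mul_le_mul_of_nonneg_left (abs_lastCoord_le y) h.regular.const_nonneg)

theorem energy_of_notMem (h : IsLocalSolution L R C δ K v G) {y : Euc d} (hy : y ∈ ball 0 R)
    (hyV : y ∉ posSet (ball 0 R) v) : energy L v G y = 0 := by
  rw [energy, chiPos_of_eq_zero (h.eq_zero_of_notMem hy hyV), h.grad_eq_zero y hyV]
  simp [CompressibleLiquid.F]

theorem force_of_notMem (h : IsLocalSolution L R C δ K v G) {y : Euc d} (hy : y ∈ ball 0 R)
    (hyV : y ∉ posSet (ball 0 R) v) : force L v G y = 0 := by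
  rw [force, chiPos_of_eq_zero (h.eq_zero_of_notMem hy hyV), h.grad_eq_zero y hyV]
  simp [CompressibleLiquid.dF2, CompressibleLiquid.F]

theorem exists_abs_coeff_le (h : IsLocalSolution L R C δ K v G) :
    ∃ M, 0 ≤ M ∧ ∀ y ∈ ball (0 : Euc d) R, |coeff L G y| ≤ M := by
  have hK := h.regular.const_nonneg
  have hC := h.growth_nonneg
  have hR := h.radius_pos
  have hρ : 0 < 1 / L.rho0 := one_div_pos.2 L.rho0_pos
  refine ⟨K * (C + 1) * R + 1 / L.rho0, by positivity, fun y hy => ?_⟩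
  have h1 := abs_add_le (coeff L G y - 1 / L.rho0) (1 / L.rho0)
  rw [sub_add_cancel, abs_of_pos hρ] at h1
  have h2 := h.abs_coeff_sub_le hy
  have h3 : K * (C + 1) * ‖y‖ ≤ K * (C + 1) * R :=
    mul_le_mul_of_nonneg_left (mem_ball_zero_iff.1 hy).le (by positivity)
  linarith

theorem exists_abs_force_le (h : IsLocalSolution L R C δ K v G) :
    ∃ M, 0 ≤ M ∧ ∀ y ∈ ball (0 : Euc d) R, |force L v G y| ≤ M := by
  have hK := h.regular.const_nonneg
  have hC := h.growth_nonneg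
  have hR := h.radius_pos
  have hρ : 0 < 1 / L.rho0 := one_div_pos.2 L.rho0_pos
  refine ⟨K * R + 1 / L.rho0 + K * C * R, by positivity, fun y hy => ?_⟩
  by_cases hyV : y ∈ posSet (ball 0 R) v
  · rw [force, chiPos_of_pos hyV.2, mul_one]
    have hyR := (mem_ball_zero_iff.1 hy).le
    have h0 := abs_add_le (deriv L.lam (lastCoord y)) (L.dF2 (‖G y‖ ^ 2) (lastCoord y))
    have h1 := abs_add_le (deriv L.lam (lastCoord y) - 1 / L.rho0) (1 / L.rho0)
    rw [sub_add_cancel, abs_of_pos hρ] at h1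
    have h2 := h.abs_deriv_lam_sub_le hy
    have h3 := h.abs_dF2_le hy
    have h4 : K * ‖y‖ ≤ K * R := mul_le_mul_of_nonneg_left hyR hK
    have h5 : K * C * ‖y‖ ≤ K * C * R := mul_le_mul_of_nonneg_left hyR (by positivity)
    linarith
  · rw [h.force_of_notMem hy hyV, abs_zero]; positivity

theorem exists_abs_energy_le (h : IsLocalSolution L R C δ K v G) :
    ∃ M, 0 ≤ M ∧ ∀ y ∈ ball (0 : Euc d) R, |energy L v G y| ≤ M * ‖y‖ := by
  have hK := h.regular.const_nonneg
  have hC := h.growth_nonneg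
  have hR := h.radius_pos
  have hρ : 0 < 1 / L.rho0 := one_div_pos.2 L.rho0_pos
  set A := 1 / L.rho0
  refine ⟨K * (C + 1) * C * R + C * A + K * R + A, by positivity, fun y hy => ?_⟩
  by_cases hyV : y ∈ posSet (ball 0 R) v
  · rw [energy, chiPos_of_pos hyV.2, mul_one]
    have hyR := (mem_ball_zero_iff.1 hy).le
    have ht0 : 0 ≤ ‖G y‖ ^ 2 * A := by positivity
    have ht : ‖G y‖ ^ 2 * A ≤ C * ‖y‖ * A :=
      mul_le_mul_of_nonneg_right (h.norm_grad_sq_le hy) hρ.le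
    have h0 := abs_add_le (L.F (‖G y‖ ^ 2) (lastCoord y)) (L.lam (lastCoord y))
    have h1 := abs_add_le (L.F (‖G y‖ ^ 2) (lastCoord y) - ‖G y‖ ^ 2 * A) (‖G y‖ ^ 2 * A)
    rw [sub_add_cancel, abs_of_nonneg ht0] at h1
    have h2 := abs_add_le (L.lam (lastCoord y) - lastCoord y * A) (lastCoord y * A)
    rw [sub_add_cancel, abs_mul, abs_of_pos hρ] at h2
    have h3 : |lastCoord y| * A ≤ ‖y‖ * A :=
      mul_le_mul_of_nonneg_right (abs_lastCoord_le y) hρ.le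
    have h4 := h.abs_F_sub_le hy
    have h5 := h.abs_lam_sub_le hy
    have hYY : ‖y‖ ^ 2 ≤ R * ‖y‖ := by
      rw [sq]; exact mul_le_mul_of_nonneg_right hyR (norm_nonneg y)
    have h6 : K * (C + 1) * C * ‖y‖ ^ 2 ≤ K * (C + 1) * C * (R * ‖y‖) :=
      mul_le_mul_of_nonneg_left hYY (by positivity)
    have h7 : K * ‖y‖ ^ 2 ≤ K * (R * ‖y‖) := mul_le_mul_of_nonneg_left hYY hK
    calc _ ≤ K * (C + 1) * C * (R * ‖y‖) + C * ‖y‖ * A + K * (R * ‖y‖) + ‖y‖ * A := by linarith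
      _ = _ := by ring
  · rw [h.energy_of_notMem hy hyV, abs_zero]; positivity

/-- The combination of constitutive functions that cancels in the incompressible case. -/
def defect (L : CompressibleLiquid) (v : Euc d → ℝ) (G : Euc d → Euc d) (y : Euc d) : ℝ :=
  -energy L v G y + coeff L G y * ‖G y‖ ^ 2 + force L v G y * lastCoord y

theorem exists_abs_defect_le (h : IsLocalSolution L R C δ K v G) :
    ∃ M, 0 ≤ M ∧ ∀ y ∈ ball (0 : Euc d) R, |defect L v G y| ≤ M * ‖y‖ ^ 2 := by
  have hK := h.regular.const_nonneg
  have hC := h.growth_nonneg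
  refine ⟨2 * (K * (C + 1) * C) + 2 * K + K * C, by positivity, fun y hy => ?_⟩
  by_cases hyV : y ∈ posSet (ball 0 R) v
  · rw [defect, energy, force, chiPos_of_pos hyV.2, mul_one, mul_one]
    have ht0 : 0 ≤ ‖G y‖ ^ 2 := by positivity
    have b1 := h.abs_coeff_sub_le hy
    have b2 := h.abs_F_sub_le hy
    have b3 := h.abs_dF2_le hy
    have b4 := h.abs_lam_sub_le hy
    have b5 := h.abs_deriv_lam_sub_le hy
    have ht := h.norm_grad_sq_le hy
    have hl := abs_lastCoord_le y
    have f1 : |(coeff L G y - 1 / L.rho0) * ‖G y‖ ^ 2| ≤ K * (C + 1) * C * ‖y‖ ^ 2 := by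
      rw [abs_mul, abs_of_nonneg ht0]
      calc _ ≤ K * (C + 1) * ‖y‖ * (C * ‖y‖) := mul_le_mul b1 ht ht0 (by positivity)
        _ = _ := by ring
    have f2 : |(deriv L.lam (lastCoord y) - 1 / L.rho0) * lastCoord y| ≤ K * ‖y‖ ^ 2 := by
      rw [abs_mul]
      calc _ ≤ K * ‖y‖ * ‖y‖ := mul_le_mul b5 hl (abs_nonneg _) (by positivity)
        _ = _ := by ring
    have f3 : |L.dF2 (‖G y‖ ^ 2) (lastCoord y) * lastCoord y| ≤ K * C * ‖y‖ ^ 2 := by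
      rw [abs_mul]
      calc _ ≤ K * C * ‖y‖ * ‖y‖ := mul_le_mul b3 hl (abs_nonneg _) (by positivity)
        _ = _ := by ring
    generalize L.F (‖G y‖ ^ 2) (lastCoord y) = F at *
    generalize L.dF2 (‖G y‖ ^ 2) (lastCoord y) = F2 at *
    generalize deriv L.lam (lastCoord y) = l' at *
    generalize L.lam (lastCoord y) = l at *
    generalize coeff L G y = a at *
    generalize 1 / L.rho0 = A at *
    rw [abs_le] at *
    constructor <;> linarith
  · rw [defect, h.energy_of_notMem hy hyV, h.force_of_notMem hy hyV, h.grad_eq_zero y hyV]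
    simp
    positivity

end IsLocalSolution

theorem integrableOn_ball_mul_continuous {d : ℕ} {R : ℝ} {f g : Euc d → ℝ}
    (hf : IntegrableOn f (ball 0 R)) (hg : Continuous g) :
    IntegrableOn (fun y => f y * g y) (ball 0 R) := by
  obtain ⟨M, hM⟩ := (isCompact_closedBall (0 : Euc d) R).exists_bound_of_continuousOn
    hg.continuousOn
  refine Integrable.mul_bdd (c := M) hf hg.aestronglyMeasurable ?_
  filter_upwards [ae_restrict_mem measurableSet_ball] with y hy using
    hM y (ball_subset_closedBall hy)

namespace IsLocalSolution

variable {L : CompressibleLiquid} {d : ℕ} {R C δ K : ℝ} {v : Euc d → ℝ} {G : Euc d → Euc d}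

theorem ne_zero_of_mem (h : IsLocalSolution L R C δ K v G) {y : Euc d}
    (hy : y ∈ posSet (ball 0 R) v) : y ≠ 0 := by
  rintro rfl
  exact hy.2.ne' h.apply_zero

theorem norm_grad_le_const (h : IsLocalSolution L R C δ K v G) {y : Euc d} (hy : y ∈ ball 0 R) :
    ‖G y‖ ≤ √(C * R) := (h.norm_grad_le hy).trans (Real.sqrt_le_sqrt
      (mul_le_mul_of_nonneg_left (mem_ball_zero_iff.1 hy).le h.growth_nonneg))

theorem le_const (h : IsLocalSolution L R C δ K v G) {y : Euc d} (hy : y ∈ ball 0 R) :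
    v y ≤ √(C * R) * R := by
  have := h.sub_le le_rfl h.zero_mem_ball hy
  rw [h.apply_zero, sub_zero, sub_zero] at this
  exact this.trans (mul_le_mul_of_nonneg_left (mem_ball_zero_iff.1 hy).le (Real.sqrt_nonneg _))

theorem continuousOn_posSet (h : IsLocalSolution L R C δ K v G) :
    ContinuousOn v (posSet (ball 0 R) v) := h.continuousOn.mono fun _ hy => hy.1

theorem continuousOn_normSq (h : IsLocalSolution L R C δ K v G) :
    ContinuousOn (fun y => ‖G y‖ ^ 2) (posSet (ball 0 R) v) :=
  h.contDiffOn_grad.continuousOn.norm.pow 2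

theorem continuousOn_inner (h : IsLocalSolution L R C δ K v G) :
    ContinuousOn (fun y => inner ℝ (G y) y) (posSet (ball 0 R) v) :=
  h.contDiffOn_grad.continuousOn.inner continuousOn_id

theorem integrableOn_energy (h : IsLocalSolution L R C δ K v G) :
    IntegrableOn (energy L v G) (ball 0 R) := by
  obtain ⟨M, hM0, hM⟩ := h.exists_abs_energy_le
  exact h.integrableOn_of_continuousOn (M := M * R) h.contDiffOn_energy.continuousOn
    (fun y hy hyV => h.energy_of_notMem hy hyV) fun y hy => (hM y hy).trans
      (mul_le_mul_of_nonneg_left (mem_ball_zero_iff.1 hy).le hM0)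

theorem integrableOn_force (h : IsLocalSolution L R C δ K v G) :
    IntegrableOn (force L v G) (ball 0 R) := by
  obtain ⟨M, hM0, hM⟩ := h.exists_abs_force_le
  exact h.integrableOn_of_continuousOn h.continuousOn_force
    (fun y hy hyV => h.force_of_notMem hy hyV) hM

theorem integrableOn_coeff_mul (h : IsLocalSolution L R C δ K v G) {f : Euc d → ℝ} {M : ℝ}
    (hf : ContinuousOn f (posSet (ball 0 R) v))
    (h0 : ∀ y ∈ ball (0 : Euc d) R, y ∉ posSet (ball 0 R) v → f y = 0)
    (hM : ∀ y ∈ ball (0 : Euc d) R, |f y| ≤ M) :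
    IntegrableOn (fun y => coeff L G y * f y) (ball 0 R) := by
  obtain ⟨A, hA0, hA⟩ := h.exists_abs_coeff_le
  refine h.integrableOn_of_continuousOn (M := A * M) (h.contDiffOn_coeff.continuousOn.mul hf)
    (fun y hy hyV => by rw [h0 y hy hyV, mul_zero]) fun y hy => ?_
  rw [abs_mul]
  exact mul_le_mul (hA y hy) (hM y hy) (abs_nonneg _) hA0

theorem integrableOn_coeff_mul_normSq (h : IsLocalSolution L R C δ K v G) :
    IntegrableOn (fun y => coeff L G y * ‖G y‖ ^ 2) (ball 0 R) := by
  refine h.integrableOn_coeff_mul (M := C * R) h.continuousOn_normSq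
    (fun y _ hyV => by simp [h.grad_eq_zero y hyV]) fun y hy => ?_
  rw [abs_of_nonneg (by positivity)]
  exact (h.norm_grad_sq_le hy).trans
    (mul_le_mul_of_nonneg_left (mem_ball_zero_iff.1 hy).le h.growth_nonneg)

theorem integrableOn_coeff_mul_inner_sq (h : IsLocalSolution L R C δ K v G) :
    IntegrableOn (fun y => coeff L G y * (inner ℝ (G y) y ^ 2 / ‖y‖)) (ball 0 R) := by
  refine h.integrableOn_coeff_mul (M := C * R ^ 2) ?_
    (fun y _ hyV => by simp [h.grad_eq_zero y hyV]) fun y hy => ?_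
  · exact (h.continuousOn_inner.pow 2).div continuousOn_id.norm
      fun y hy => norm_ne_zero_iff.2 (h.ne_zero_of_mem hy)
  · rcases eq_or_ne y 0 with rfl | hy0
    · simp; have := h.growth_nonneg; have := h.radius_pos; positivity
    · have hyp : 0 < ‖y‖ := norm_pos_iff.2 hy0
      rw [abs_of_nonneg (by positivity), div_le_iff₀ hyp]
      refine (h.inner_sq_le hy).trans ?_
      have h1 : ‖y‖ ^ 2 ≤ R ^ 2 := pow_le_pow_left₀ hyp.le (mem_ball_zero_iff.1 hy).le 2
      calc C * ‖y‖ ^ 3 = C * ‖y‖ ^ 2 * ‖y‖ := by ring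
        _ ≤ C * R ^ 2 * ‖y‖ := by have := h.growth_nonneg; gcongr

theorem integrableOn_coeff_mul_mul_inner (h : IsLocalSolution L R C δ K v G) :
    IntegrableOn (fun y => coeff L G y * (v y * inner ℝ (G y) y / ‖y‖)) (ball 0 R) := by
  refine h.integrableOn_coeff_mul (M := C * R ^ 2) ?_
    (fun y _ hyV => by simp [h.grad_eq_zero y hyV]) fun y hy => ?_
  · exact (h.continuousOn_posSet.mul h.continuousOn_inner).div continuousOn_id.norm
      fun y hy => norm_ne_zero_iff.2 (h.ne_zero_of_mem hy)
  · rcases eq_or_ne y 0 with rfl | hy0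
    · simp; have := h.growth_nonneg; have := h.radius_pos; positivity
    · have hyp : 0 < ‖y‖ := norm_pos_iff.2 hy0
      rw [abs_div, abs_of_pos hyp, div_le_iff₀ hyp]
      refine (h.abs_mul_inner_le hy).trans ?_
      have h1 : ‖y‖ ^ 2 ≤ R ^ 2 := pow_le_pow_left₀ hyp.le (mem_ball_zero_iff.1 hy).le 2
      calc C * ‖y‖ ^ 3 = C * ‖y‖ ^ 2 * ‖y‖ := by ring
        _ ≤ C * R ^ 2 * ‖y‖ := by have := h.growth_nonneg; gcongr

/-- The energy identity: the equation tested with `v η`. -/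
theorem integral_energy_identity (h : IsLocalSolution L R C δ K v G) {η : Euc d → ℝ}
    (hη : ContDiff ℝ 1 η) (hηc : HasCompactSupport η) (hηB : tsupport η ⊆ ball 0 R) :
    ∫ y in ball (0 : Euc d) R, coeff L G y * (η y * ‖G y‖ ^ 2 + v y * fderiv ℝ η y (G y)) = 0 := by
  have hvd : ContDiffOn ℝ 1 v (ball 0 R ∩ {x | 0 < v x}) :=
    h.contDiffOn.of_le (by norm_num)
  obtain ⟨A, hA0, hA⟩ := h.exists_abs_coeff_le
  obtain ⟨Mη, hMη⟩ := hηc.exists_bound_of_continuous hη.continuous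
  obtain ⟨Mη', hMη'⟩ := (hηc.fderiv (𝕜 := ℝ)).exists_bound_of_continuous
    (hη.continuous_fderiv one_ne_zero)
  have hMη0 : 0 ≤ Mη := (norm_nonneg _).trans (hMη 0)
  have hMη'0 : 0 ≤ Mη' := (norm_nonneg _).trans (hMη' 0)
  set ε : ℕ → ℝ := fun k => 1 / (k + 1 : ℝ) with hε
  have hε0 : ∀ k, 0 < ε k := fun k => by positivity
  have hεlim : Tendsto ε atTop (𝓝 0) := tendsto_one_div_add_atTop_nhds_zero_nat
  set ψ : ℕ → Euc d → ℝ := fun k y => coeff L G y *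
    (rampDeriv (ε k) (v y) * η y * ‖G y‖ ^ 2 + ramp (ε k) (v y) * fderiv ℝ η y (G y)) with hψ
  have hψ0 : ∀ k y, y ∉ posSet (ball 0 R) v → ψ k y = 0 := fun k y hy => by
    simp [hψ, h.grad_eq_zero y hy]
  have hψe : ∀ k y, ψ k y = coeff L G y * fderiv ℝ (fun y => ramp (ε k) (v y) * η y) y (G y) :=
    fun k y => by
      rw [(hasFDerivAt_ramp_mul isOpen_ball h.continuousOn hvd (hε0 k) hη hηB y).fderiv]
      by_cases hy : y ∈ posSet (ball 0 R) v
      · simp [hψ, h.fderiv_eq hy]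
      · simp [hψ, h.grad_eq_zero y hy]
  have hzero : ∀ k, ∫ y in ball (0 : Euc d) R, ψ k y = 0 := fun k => by
    rw [setIntegral_eq_integral_of_forall_compl_eq_zero fun y hy =>
      hψ0 k y fun hyV => hy hyV.1]
    simp_rw [hψe]
    have hts := tsupport_ramp_mul_subset (η := η) h.continuousOn (hε0 k) hηB
    refine h.integral_coeff_mul_fderiv_grad_eq_zero
      (contDiff_ramp_mul isOpen_ball h.continuousOn hvd (hε0 k) hη hηB) ?_ ?_
    · exact hηc.mul_left
    · exact fun x hx => ⟨hηB (hts hx).1, (hε0 k).trans_le (hts hx).2⟩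
  have hfηc : ContinuousOn (fun y => fderiv ℝ η y (G y)) (posSet (ball 0 R) v) :=
    (hη.continuous_fderiv one_ne_zero).continuousOn.clm_apply h.contDiffOn_grad.continuousOn
  have hbound : ∀ k, ∀ y ∈ ball (0 : Euc d) R,
      |ψ k y| ≤ A * (Mη * √(C * R) ^ 2 + √(C * R) * R * (Mη' * √(C * R))) := fun k y hy => by
    have hv := h.nonneg y hy
    have hG := h.norm_grad_le_const hy
    rw [hψ, abs_mul]
    refine mul_le_mul (hA y hy) ((abs_add_le _ _).trans (add_le_add ?_ ?_)) (abs_nonneg _) hA0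
    · rw [abs_mul, abs_mul, abs_of_nonneg (rampDeriv_nonneg _ _),
        abs_of_nonneg (show 0 ≤ ‖G y‖ ^ 2 by positivity)]
      have h1 : rampDeriv (ε k) (v y) * |η y| ≤ Mη :=
        (mul_le_of_le_one_left (abs_nonneg _) (rampDeriv_le_one _ _)).trans (hMη y)
      exact mul_le_mul h1 (pow_le_pow_left₀ (norm_nonneg _) hG 2) (by positivity) hMη0
    · rw [abs_mul, abs_of_nonneg (ramp_nonneg hv)]
      refine mul_le_mul ((ramp_le hv).trans (h.le_const hy)) ?_ (abs_nonneg _)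
        (mul_nonneg (Real.sqrt_nonneg _) h.radius_pos.le)
      exact ((fderiv ℝ η y).le_opNorm _).trans (mul_le_mul (hMη' y) hG (norm_nonneg _) hMη'0)
  have hψc : ∀ k, ContinuousOn (ψ k) (posSet (ball 0 R) v) := fun k =>
    h.contDiffOn_coeff.continuousOn.mul
      (((((continuous_rampDeriv _).comp_continuousOn h.continuousOn_posSet).mul
        hη.continuous.continuousOn).mul h.continuousOn_normSq).add
      (((contDiff_ramp _).continuous.comp_continuousOn h.continuousOn_posSet).mul hfηc))
  have : IsFiniteMeasure (volume.restrict (ball (0 : Euc d) R)) :=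
    ⟨by simpa using measure_ball_lt_top⟩
  refine tendsto_nhds_unique (tendsto_integral_of_dominated_convergence (F := ψ)
    (fun _ => A * (Mη * √(C * R) ^ 2 + √(C * R) * R * (Mη' * √(C * R)))) (fun k => ?_)
    (integrable_const _) (fun k => ?_) ?_) (tendsto_const_nhds.congr fun k => (hzero k).symm)
  · exact (h.integrableOn_of_continuousOn (hψc k) (fun y _ hyV => hψ0 k y hyV)
      (hbound k)).aestronglyMeasurable
  · filter_upwards [ae_restrict_mem measurableSet_ball] with y hy using hbound k y hy
  · refine Eventually.of_forall fun y => ?_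
    by_cases hy : y ∈ posSet (ball 0 R) v
    · have h1 := tendsto_rampDeriv hε0 hεlim hy.2
      have h2 := tendsto_ramp hε0 hεlim hy.2.le
      have := (((h1.mul_const (η y)).mul_const (‖G y‖ ^ 2)).add
        (h2.mul_const (fderiv ℝ η y (G y)))).const_mul (coeff L G y)
      simpa [hψ] using this
    · simp [hψ, h.grad_eq_zero y hy]

/-- The radial identity obtained from the domain variation formula with `φ(y) = g(|y|) y`,
`g' = -θ`, and the energy identity. -/
theorem integral_radial_identity (h : IsLocalSolution L R C δ K v G) {θ : ℝ → ℝ} {ρ σ : ℝ}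
    (hρ : 0 < ρ) (hσ : σ < R) (hθ : Continuous θ) (h0 : ∀ s, s ≤ ρ → θ s = 0)
    (h1 : ∀ s, σ ≤ s → θ s = 0) :
    ∫ y in ball (0 : Euc d) R,
      (((d + 2) * energy L v G y + defect L v G y) * radialProfile θ R ‖y‖ +
        (-(energy L v G y * ‖y‖) + coeff L G y * (2 * (inner ℝ (G y) y ^ 2 / ‖y‖)
          - 3 * (v y * inner ℝ (G y) y / ‖y‖))) * θ ‖y‖) = 0 := by
  set η : Euc d → ℝ := radialCutoff d θ R with hη_def
  have hη : ContDiff ℝ 1 η := contDiff_radialCutoff hθ hρ h0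
  have hηc : HasCompactSupport η := hasCompactSupport_radialCutoff hσ.le h1
  have hηB : tsupport η ⊆ ball 0 R :=
    (tsupport_radialCutoff_subset hσ.le h1).trans (closedBall_subset_ball hσ)
  have hfd : ∀ y w, fderiv ℝ η y w = -(θ ‖y‖ / ‖y‖) * inner ℝ y w := fun y w => by
    rw [(hasFDerivAt_radialCutoff hθ hρ h0 y).fderiv]; simp
  have hfdy : ∀ y, fderiv ℝ η y y = -(θ ‖y‖ * ‖y‖) := fun y => by
    rw [hfd, real_inner_self_eq_norm_sq]
    rcases eq_or_ne ‖y‖ 0 with hy | hy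
    · rw [hy]; simp
    · field_simp
  have hoff : ∀ y ∉ ball (0 : Euc d) R, η y = 0 ∧ θ ‖y‖ = 0 := fun y hy => by
    have : R ≤ ‖y‖ := by simpa using hy
    exact ⟨radialCutoff_eq_zero hσ.le h1 (hσ.le.trans this), h1 _ (hσ.le.trans this)⟩
  have hEN := h.integral_energy_identity hη hηc hηB
  have hDV := h.domain_variation (fun y => η y • y) (hη.smul contDiff_id) hηc.smul_right
    ((tsupport_smul_subset_left η _).trans hηB)
  have e1 : ∀ y, divergence (fun y => η y • y) y = (d + 1) * η y - θ ‖y‖ * ‖y‖ := fun y => by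
    rw [divergence_smul_id hη, hfdy]; ring
  have e2 : ∀ y, inner ℝ (G y) (fderiv ℝ (fun y => η y • y) y (G y)) =
      η y * ‖G y‖ ^ 2 - θ ‖y‖ * (inner ℝ (G y) y ^ 2 / ‖y‖) := fun y => by
    rw [fderiv_smul_id_apply hη, inner_add_right, inner_smul_right, inner_smul_right,
      real_inner_self_eq_norm_sq, hfd, real_inner_comm]
    ring
  have e3 : ∀ y : Euc d, lastCoord (η y • y) = η y * lastCoord y := fun y => by simp [lastCoord]
  simp only [e1, e2, e3] at hDV
  have hDV' : (∫ y in ball (0 : Euc d) R, energy L v G y * ((d + 1) * η y - θ ‖y‖ * ‖y‖))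
      - 2 * (∫ y in ball (0 : Euc d) R, coeff L G y *
        (η y * ‖G y‖ ^ 2 - θ ‖y‖ * (inner ℝ (G y) y ^ 2 / ‖y‖)))
      + (∫ y in ball (0 : Euc d) R, force L v G y * (η y * lastCoord y)) = 0 := by
    rw [setIntegral_eq_integral_of_forall_compl_eq_zero,
      setIntegral_eq_integral_of_forall_compl_eq_zero,
      setIntegral_eq_integral_of_forall_compl_eq_zero]
    · exact hDV
    · exact fun y hy => by rw [(hoff y hy).1]; ring
    · exact fun y hy => by rw [(hoff y hy).1, (hoff y hy).2]; ring
    · exact fun y hy => by rw [(hoff y hy).1, (hoff y hy).2]; ring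
  have hηcont : Continuous η := hη.continuous
  have hθn : Continuous fun y : Euc d => θ ‖y‖ := hθ.comp continuous_norm
  have i1 : IntegrableOn (fun y => energy L v G y * ((d + 1) * η y - θ ‖y‖ * ‖y‖)) (ball 0 R) :=
    integrableOn_ball_mul_continuous h.integrableOn_energy (by fun_prop)
  have i2 : IntegrableOn (fun y => coeff L G y *
      (η y * ‖G y‖ ^ 2 - θ ‖y‖ * (inner ℝ (G y) y ^ 2 / ‖y‖))) (ball 0 R) := by
    refine ((integrableOn_ball_mul_continuous h.integrableOn_coeff_mul_normSq hηcont).sub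
      (integrableOn_ball_mul_continuous h.integrableOn_coeff_mul_inner_sq hθn)).congr
      (Eventually.of_forall fun y => ?_)
    simp only [Pi.sub_apply]; ring
  have i3 : IntegrableOn (fun y => force L v G y * (η y * lastCoord y)) (ball 0 R) :=
    integrableOn_ball_mul_continuous h.integrableOn_force (hηcont.mul continuous_lastCoord)
  have i4 : IntegrableOn (fun y => coeff L G y * (η y * ‖G y‖ ^ 2 + v y * fderiv ℝ η y (G y)))
      (ball 0 R) := by
    refine ((integrableOn_ball_mul_continuous h.integrableOn_coeff_mul_normSq hηcont).sub
      (integrableOn_ball_mul_continuous h.integrableOn_coeff_mul_mul_inner hθn)).congr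
      (Eventually.of_forall fun y => ?_)
    simp only [Pi.sub_apply]; rw [hfd, real_inner_comm]; ring
  have key : ∫ y in ball (0 : Euc d) R,
      (energy L v G y * ((d + 1) * η y - θ ‖y‖ * ‖y‖)
        - 2 * (coeff L G y * (η y * ‖G y‖ ^ 2 - θ ‖y‖ * (inner ℝ (G y) y ^ 2 / ‖y‖)))
        + force L v G y * (η y * lastCoord y)
        + 3 * (coeff L G y * (η y * ‖G y‖ ^ 2 + v y * fderiv ℝ η y (G y)))) = 0 := by
    have j2 := i2.const_mul 2
    have j4 := i4.const_mul 3
    have k1 := integral_add ((i1.sub j2).add i3) j4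
    have k2 := integral_add (i1.sub j2) i3
    simp only [Pi.add_apply, Pi.sub_apply] at k1 k2
    rw [k1, k2, integral_sub i1 j2, integral_const_mul, integral_const_mul, hEN, mul_zero,
      add_zero]
    exact hDV'
  rw [← key]
  refine integral_congr_ae (Eventually.of_forall fun y => ?_)
  simp only [hfd, defect, real_inner_comm y (G y)]
  change _ * η y + _ = _
  ring

end IsLocalSolution

section RadialWeights

variable {d : ℕ} {ρ σ R : ℝ}

theorem integral_inv_pow_eq {a : ℝ} (ha : 0 < a) (haσ : a ≤ σ) (hρa : ρ ≤ a) :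
    (d + 2) * ∫ s in a..σ, ((max s ρ) ^ (d + 3))⁻¹ = (a ^ (d + 2))⁻¹ - (σ ^ (d + 2))⁻¹ := by
  have hpos : ∀ s ∈ uIcc a σ, 0 < s ∧ ρ ≤ s := fun s hs => by
    rw [uIcc_of_le haσ] at hs; exact ⟨ha.trans_le hs.1, hρa.trans hs.1⟩
  have hd : ∀ s ∈ uIcc a σ, HasDerivAt (fun s : ℝ => -((s ^ (d + 2))⁻¹ / (d + 2)))
      ((max s ρ) ^ (d + 3))⁻¹ s := fun s hs => by
    have hs0 := (hpos s hs).1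
    have h1 := (((hasDerivAt_pow (d + 2) s).inv (by positivity)).div_const ((d : ℝ) + 2)).neg
    convert! h1 using 1
    rw [max_eq_left (hpos s hs).2]
    push_cast
    field_simp
    ring
  have hc : ContinuousOn (fun s : ℝ => ((max s ρ) ^ (d + 3))⁻¹) (uIcc a σ) := by
    refine ContinuousOn.inv₀ (by fun_prop) fun s hs => ?_
    have := (hpos s hs).1
    exact pow_ne_zero _ (this.trans_le (le_max_left _ _)).ne'
  rw [intervalIntegral.integral_eq_sub_of_hasDerivAt hd hc.intervalIntegrable]
  field_simp
  ring

/-- The weight `s ↦ s ^ (-n-2)` on the interval `(ρ, σ)`. -/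
def shellWeight (d : ℕ) (ρ σ : ℝ) : ℝ → ℝ :=
  (Ioo ρ σ).indicator fun s => ((max s ρ) ^ (d + 3))⁻¹

theorem radialProfile_shellWeight (hσ : σ < R) {r : ℝ} (hr : r ≤ R) :
    radialProfile (shellWeight d ρ σ) R r =
      ∫ s in Ioo (max r ρ) σ, ((max s ρ) ^ (d + 3))⁻¹ := by
  rw [radialProfile, intervalIntegral.integral_of_le hr, shellWeight,
    setIntegral_indicator measurableSet_Ioo]
  congr 2
  ext s
  simp only [mem_inter_iff, mem_Ioc, mem_Ioo, max_lt_iff]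
  constructor
  · rintro ⟨⟨h1, -⟩, h2, h3⟩; exact ⟨⟨h1, h2⟩, h3⟩
  · rintro ⟨⟨h1, h2⟩, h3⟩; exact ⟨⟨h1, h3.le.trans hσ.le⟩, h2, h3⟩

theorem radialProfile_shellWeight_of_le (hρ : 0 < ρ) (hρσ : ρ < σ) (hσ : σ < R) {r : ℝ}
    (hr : r ≤ σ) : (d + 2) * radialProfile (shellWeight d ρ σ) R r =
      ((max r ρ) ^ (d + 2))⁻¹ - (σ ^ (d + 2))⁻¹ := by
  have hm : max r ρ ≤ σ := max_le hr hρσ.le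
  rw [radialProfile_shellWeight hσ (hr.trans hσ.le), ← integral_Ioc_eq_integral_Ioo,
    ← intervalIntegral.integral_of_le hm, integral_inv_pow_eq (lt_max_of_lt_right hρ) hm
      (le_max_right _ _)]

theorem radialProfile_shellWeight_of_ge (hσ : σ < R) {r : ℝ} (hr : σ ≤ r) (hrR : r ≤ R) :
    radialProfile (shellWeight d ρ σ) R r = 0 := by
  rw [radialProfile_shellWeight hσ hrR, Ioo_eq_empty (not_lt.2 (hr.trans (le_max_left _ _)))]
  simp

theorem shellWeight_of_mem {s : ℝ} (hs : s ∈ Ioo ρ σ) :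
    shellWeight d ρ σ s = (s ^ (d + 3))⁻¹ := by
  rw [shellWeight, indicator_of_mem hs, max_eq_left hs.1.le]

theorem shellWeight_of_notMem {s : ℝ} (hs : s ∉ Ioo ρ σ) : shellWeight d ρ σ s = 0 :=
  indicator_of_notMem hs _

theorem abs_radialProfile_shellWeight_le (hρ : 0 < ρ) (hρσ : ρ < σ) (hσ : σ < R) {r : ℝ}
    (hr0 : 0 < r) (hr : r ≤ σ) :
    |radialProfile (shellWeight d ρ σ) R r| ≤ (r ^ (d + 2))⁻¹ := by
  have h1 := radialProfile_shellWeight_of_le (d := d) hρ hρσ hσ hr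
  have hσ0 : 0 < σ := hρ.trans hρσ
  have hm : 0 < max r ρ := lt_max_of_lt_left hr0
  have h2 : ((max r ρ) ^ (d + 2))⁻¹ ≤ (r ^ (d + 2))⁻¹ :=
    inv_anti₀ (by positivity) (pow_le_pow_left₀ hr0.le (le_max_left _ _) _)
  have h3 : (σ ^ (d + 2))⁻¹ ≤ ((max r ρ) ^ (d + 2))⁻¹ :=
    inv_anti₀ (by positivity) (pow_le_pow_left₀ hm.le (max_le hr hρσ.le) _)
  have h4 : 0 < (σ ^ (d + 2))⁻¹ := by positivity
  have hd : (0 : ℝ) ≤ d := d.cast_nonneg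
  set g := radialProfile (shellWeight d ρ σ) R r
  have hg : 0 ≤ g := by
    by_contra! hneg
    have : ((d : ℝ) + 2) * g < 0 := mul_neg_of_pos_of_neg (by linarith) hneg
    linarith
  rw [abs_of_nonneg hg]
  nlinarith

theorem integrableOn_norm_pow_inv (σ : ℝ) :
    IntegrableOn (fun y : Euc d => (‖y‖ ^ d)⁻¹) (ball 0 σ) := by
  rw [integrableOn_fun_norm_addHaar volume (f := fun r : ℝ => (r ^ d)⁻¹)]
  have hdim : Module.finrank ℝ (Euc d) - 1 = d := by simp
  rw [hdim]
  have : IntegrableOn (fun _ : ℝ => (1 : ℝ)) (Ioo 0 σ) := integrableOn_const (by simp)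
  refine this.congr_fun (fun r hr => ?_) measurableSet_Ioo
  have : r ^ d ≠ 0 := pow_ne_zero _ hr.1.ne'
  simp [this]

theorem integral_norm_pow_inv (hσ : 0 ≤ σ) :
    ∫ y in ball (0 : Euc d) σ, (‖y‖ ^ d)⁻¹ =
      (d + 1) * volume.real (ball (0 : Euc d) 1) * σ := by
  have hdim : Module.finrank ℝ (Euc d) = d + 1 := by simp
  rw [← integral_indicator measurableSet_ball]
  have e : (ball (0 : Euc d) σ).indicator (fun y => (‖y‖ ^ d)⁻¹) =
      fun y => (Iio σ).indicator (fun r : ℝ => (r ^ d)⁻¹) ‖y‖ := by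
    funext y
    by_cases hy : ‖y‖ < σ <;> simp [indicator, hy]
  rw [e, integral_fun_norm_addHaar volume ((Iio σ).indicator (fun r : ℝ => (r ^ d)⁻¹)), hdim]
  have e2 : ∀ r ∈ Ioi (0 : ℝ), r ^ (d + 1 - 1) • (Iio σ).indicator (fun r : ℝ => (r ^ d)⁻¹) r =
      (Iio σ).indicator (fun _ => 1) r := fun r hr => by
    have : r ^ d ≠ 0 := pow_ne_zero _ (ne_of_gt hr)
    by_cases hrσ : r ∈ Iio σ
    · rw [indicator_of_mem hrσ, indicator_of_mem hrσ]; simp [this]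
    · rw [indicator_of_notMem hrσ, indicator_of_notMem hrσ]; simp
  rw [setIntegral_congr_fun measurableSet_Ioi e2, setIntegral_indicator measurableSet_Iio,
    Ioi_inter_Iio]
  simp [hσ]
  ring

end RadialWeights

namespace IsLocalSolution

variable {L : CompressibleLiquid} {d : ℕ} {R C δ K : ℝ} {v : Euc d → ℝ} {G : Euc d → Euc d}

/-- The integral measuring the deviation from homogeneity of degree `3 / 2`. -/
def homogeneityDefect (v : Euc d → ℝ) (G : Euc d → Euc d) (ρ σ : ℝ) : ℝ :=
  ∫ y in shell d ρ σ, (‖y‖ ^ (d + 4))⁻¹ * (inner ℝ (G y) y - 3 / 2 * v y) ^ 2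

theorem homogeneityDefect_nonneg (v : Euc d → ℝ) (G : Euc d → Euc d) (ρ σ : ℝ) :
    0 ≤ homogeneityDefect v G ρ σ :=
  integral_nonneg fun y => by positivity

theorem hasDerivAt_radial (h : IsLocalSolution L R C δ K v G) {z : Euc d} (hz : ‖z‖ = 1)
    {r : ℝ} (hr : r ∈ Ioo 0 R) :
    HasDerivAt (fun r => v (r • z) ^ 2 / r ^ 3)
      (r ^ d * ((‖r • z‖ ^ (d + 4))⁻¹ *
        (2 * v (r • z) * inner ℝ (G (r • z)) (r • z) - 3 * v (r • z) ^ 2))) r := by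
  have hr0 := hr.1
  have hn : ‖r • z‖ = r := by rw [norm_smul, hz, mul_one, Real.norm_of_nonneg hr0.le]
  have hmem : r • z ∈ ball (0 : Euc d) R := by rw [mem_ball_zero_iff, hn]; exact hr.2
  have h1 : HasDerivAt (fun r : ℝ => r • z) z r := by
    have := (hasDerivAt_id r).smul_const z
    rwa [one_smul] at this
  have h2 := (h.hasFDerivAt_sq hmem).comp_hasDerivAt r h1
  have h3 := h2.div (hasDerivAt_pow 3 r) (by positivity)
  convert! h3 using 1
  rw [hn]
  simp [inner_smul_right]
  field_simp
  ring

theorem continuousOn_radial (h : IsLocalSolution L R C δ K v G) :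
    ContinuousOn (fun y => (‖y‖ ^ (d + 4))⁻¹ * (2 * v y * inner ℝ (G y) y - 3 * v y ^ 2))
      (ball 0 R \ {0}) := by
  have h1 : ContinuousOn (fun y => inner ℝ (v y • G y) y) (ball 0 R) :=
    h.continuousOn_smul_grad.inner continuousOn_id
  have h2 : ContinuousOn (fun y => 2 * v y * inner ℝ (G y) y - 3 * v y ^ 2) (ball 0 R) := by
    refine ((h1.const_mul 2).sub ((h.continuousOn.pow 2).const_mul 3)).congr fun y _ => ?_
    simp only [inner_smul_left]; simp; ring
  refine ContinuousOn.mul (ContinuousOn.inv₀ (by fun_prop) fun y hy => ?_)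
    (h2.mono sdiff_subset)
  exact pow_ne_zero _ (norm_ne_zero_iff.2 hy.2)

theorem smul_sphere_mem {ρ : ℝ} (hρ : 0 < ρ) (z : sphere (0 : Euc d) 1) {r : ℝ}
    (hr : ρ ≤ r) (hrR : r < R) : r • (z : Euc d) ∈ ball (0 : Euc d) R \ {0} := by
  have hn : ‖r • (z : Euc d)‖ = r := by
    rw [norm_smul, norm_eq_of_mem_sphere z, mul_one, Real.norm_of_nonneg (hρ.le.trans hr)]
  refine ⟨by rwa [mem_ball_zero_iff, hn], fun h0 => ?_⟩
  rw [mem_singleton_iff.1 h0, norm_zero] at hn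
  linarith

theorem integral_radial_eq (h : IsLocalSolution L R C δ K v G) {ρ σ : ℝ} (hρ : 0 < ρ)
    (hρσ : ρ ≤ σ) (hσ : σ < R) (z : sphere (0 : Euc d) 1) :
    ∫ r in Ioo ρ σ, r ^ d * ((‖r • (z : Euc d)‖ ^ (d + 4))⁻¹ *
        (2 * v (r • (z : Euc d)) * inner ℝ (G (r • (z : Euc d))) (r • (z : Euc d))
          - 3 * v (r • (z : Euc d)) ^ 2)) =
      v (σ • (z : Euc d)) ^ 2 / σ ^ 3 - v (ρ • (z : Euc d)) ^ 2 / ρ ^ 3 := by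
  have hz := norm_eq_of_mem_sphere z
  rw [← integral_Ioc_eq_integral_Ioo, ← intervalIntegral.integral_of_le hρσ]
  refine intervalIntegral.integral_eq_sub_of_hasDerivAt (f := fun r =>
    v (r • (z : Euc d)) ^ 2 / r ^ 3) (fun r hr => ?_) ?_
  · rw [uIcc_of_le hρσ] at hr
    exact h.hasDerivAt_radial hz ⟨hρ.trans_le hr.1, hr.2.trans_lt hσ⟩
  · refine ContinuousOn.intervalIntegrable ?_
    rw [uIcc_of_le hρσ]
    have hc : ContinuousOn (fun r : ℝ => r • (z : Euc d)) (Icc ρ σ) := by fun_prop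
    exact (continuous_pow d).continuousOn.mul (h.continuousOn_radial.comp hc
      fun r hr => smul_sphere_mem hρ z hr.1 (hr.2.trans_lt hσ))

theorem integrableOn_shell_radial (h : IsLocalSolution L R C δ K v G) {ρ σ : ℝ} (hρ : 0 < ρ)
    (hσ : σ < R) : IntegrableOn
      (fun y => (‖y‖ ^ (d + 4))⁻¹ * (2 * v y * inner ℝ (G y) y - 3 * v y ^ 2)) (shell d ρ σ) := by
  have hK : IsCompact (closedBall (0 : Euc d) σ \ ball 0 ρ) :=
    (isCompact_closedBall _ _).diff isOpen_ball
  refine ((h.continuousOn_radial.mono fun y hy => ⟨closedBall_subset_ball hσ hy.1, fun h0 => ?_⟩)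
    |>.integrableOn_compact hK).mono_set fun y hy => ⟨?_, ?_⟩
  · rw [mem_singleton_iff.1 h0] at hy
    exact hy.2 (mem_ball_self hρ)
  · exact mem_closedBall_zero_iff.2 hy.2.le
  · simpa using hy.1.le

theorem integral_shell_radial (h : IsLocalSolution L R C δ K v G) {ρ σ : ℝ} (hρ : 0 < ρ)
    (hρσ : ρ ≤ σ) (hσ : σ < R) :
    ∫ y in shell d ρ σ, (‖y‖ ^ (d + 4))⁻¹ * (2 * v y * inner ℝ (G y) y - 3 * v y ^ 2) =
      L.rho0 * (weissW L v 0 σ - weissW L v 0 ρ) := by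
  rw [setIntegral_shell hρ.le (h.integrableOn_shell_radial hρ hσ)]
  simp_rw [h.integral_radial_eq hρ hρσ hσ]
  have hW : ∀ r, 0 < r → L.rho0 * weissW L v 0 r =
      ∫ z : sphere (0 : Euc d) 1, v (r • (z : Euc d)) ^ 2 / r ^ 3
        ∂((volume : Measure (Euc d)).toSphere) := fun r hr => by
    rw [weissW, sphereIntegral, ← mul_assoc, ← integral_const_mul, ← integral_const_mul]
    refine integral_congr_ae (Eventually.of_forall fun z => ?_)
    have := L.rho0_pos
    simp only [zero_add]
    field_simp
    ring
  have hi : ∀ r, 0 < r → r < R → Integrable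
      (fun z : sphere (0 : Euc d) 1 => v (r • (z : Euc d)) ^ 2 / r ^ 3)
      ((volume : Measure (Euc d)).toSphere) := fun r hr hrR => by
    have hc : Continuous fun z : sphere (0 : Euc d) 1 => v (r • (z : Euc d)) ^ 2 / r ^ 3 := by
      refine ((h.continuousOn.comp_continuous (by fun_prop) fun z => ?_).pow 2).div_const _
      exact (smul_sphere_mem hr z le_rfl hrR).1
    exact hc.integrable_of_hasCompactSupport (HasCompactSupport.of_compactSpace _)
  rw [integral_sub (hi σ (hρ.trans_le hρσ) hσ) (hi ρ hρ (hρσ.trans_lt hσ)), mul_sub,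
    hW σ (hρ.trans_le hρσ), hW ρ hρ]

end IsLocalSolution

namespace IsLocalSolution

variable {L : CompressibleLiquid} {d : ℕ} {R C δ K : ℝ} {v : Euc d → ℝ} {G : Euc d → Euc d}

theorem integral_energy_weight (h : IsLocalSolution L R C δ K v G) {ρ σ : ℝ} (hρ : 0 < ρ)
    (hρσ : ρ < σ) (hσ : σ < R) :
    ∫ y in ball (0 : Euc d) R, energy L v G y *
      ((d + 2) * radialProfile (shellWeight d ρ σ) R ‖y‖ - shellWeight d ρ σ ‖y‖ * ‖y‖) =
      weissU L v G 0 ρ - weissU L v G 0 σ := by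
  have e : ∀ y ∈ ball (0 : Euc d) R, energy L v G y *
      ((d + 2) * radialProfile (shellWeight d ρ σ) R ‖y‖ - shellWeight d ρ σ ‖y‖ * ‖y‖) =
      (closedBall (0 : Euc d) ρ).indicator (fun y => energy L v G y * (ρ ^ (d + 2))⁻¹) y -
      (ball (0 : Euc d) σ).indicator (fun y => energy L v G y * (σ ^ (d + 2))⁻¹) y := by
    intro y hy
    have hyR := (mem_ball_zero_iff.1 hy).le
    rcases le_or_gt σ ‖y‖ with h1 | h1
    · have n1 : y ∉ ball (0 : Euc d) σ := by simpa using h1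
      have n2 : y ∉ closedBall (0 : Euc d) ρ := by simpa using hρσ.trans_le h1
      rw [indicator_of_notMem n1, indicator_of_notMem n2,
        radialProfile_shellWeight_of_ge hσ h1 hyR, shellWeight_of_notMem fun h => by
          linarith [h.2]]
      ring
    · have n1 : y ∈ ball (0 : Euc d) σ := by simpa using h1
      rw [indicator_of_mem n1, radialProfile_shellWeight_of_le hρ hρσ hσ h1.le]
      rcases le_or_gt ‖y‖ ρ with h2 | h2
      · have n2 : y ∈ closedBall (0 : Euc d) ρ := by simpa using h2
        rw [indicator_of_mem n2, shellWeight_of_notMem fun h => by linarith [h.1],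
          max_eq_right h2]
        ring
      · have n2 : y ∉ closedBall (0 : Euc d) ρ := by simpa using h2
        rw [indicator_of_notMem n2, shellWeight_of_mem ⟨h2, h1⟩, max_eq_left h2.le]
        have : 0 < ‖y‖ := hρ.trans h2
        have e3 : (‖y‖ ^ (d + 3))⁻¹ * ‖y‖ = (‖y‖ ^ (d + 2))⁻¹ := by
          rw [pow_succ ‖y‖ (d + 2)]; field_simp
        rw [e3]; ring
  have s1 : closedBall (0 : Euc d) ρ ⊆ ball 0 R := closedBall_subset_ball (hρσ.trans hσ)
  have s2 : ball (0 : Euc d) σ ⊆ ball 0 R := ball_subset_ball hσ.le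
  have i1 : IntegrableOn (fun y => energy L v G y * (ρ ^ (d + 2))⁻¹) (ball 0 R) :=
    h.integrableOn_energy.mul_const _
  have i2 : IntegrableOn (fun y => energy L v G y * (σ ^ (d + 2))⁻¹) (ball 0 R) :=
    h.integrableOn_energy.mul_const _
  rw [setIntegral_congr_fun measurableSet_ball e,
    integral_sub (i1.indicator measurableSet_closedBall) (i2.indicator measurableSet_ball),
    setIntegral_indicator measurableSet_closedBall, setIntegral_indicator measurableSet_ball,
    inter_eq_self_of_subset_right s1, inter_eq_self_of_subset_right s2, integral_mul_const,
    integral_mul_const, weissU, weissU]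
  have hae : ball (0 : Euc d) ρ =ᵐ[volume] closedBall 0 ρ := by
    refine (ae_eq_set.2 ⟨by rw [sdiff_eq_empty.2 ball_subset_closedBall]; simp, ?_⟩)
    rw [closedBall_sdiff_ball]
    exact Measure.addHaar_sphere_of_ne_zero _ _ hρ.ne'
  rw [setIntegral_congr_set hae]
  simp only [energy]
  ring

theorem integrableOn_shell_mul (h : IsLocalSolution L R C δ K v G) {ρ σ : ℝ} (hρ : 0 < ρ)
    (hσ : σ < R) {f : Euc d → ℝ} {M : ℝ} (hf : ContinuousOn f (posSet (ball 0 R) v))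
    (h0 : ∀ y ∈ ball (0 : Euc d) R, y ∉ posSet (ball 0 R) v → f y = 0)
    (hM : ∀ y ∈ ball (0 : Euc d) R, |f y| ≤ M) :
    IntegrableOn (fun y => (‖y‖ ^ (d + 4))⁻¹ * f y) (shell d ρ σ) := by
  have hfi := (h.integrableOn_of_continuousOn hf h0 hM).mono_set
    (shell_subset_ball (ρ := ρ) hσ.le)
  refine Integrable.bdd_mul (c := (ρ ^ (d + 4))⁻¹) hfi ?_ ?_
  · exact ((measurable_norm.pow_const _).inv).aestronglyMeasurable
  · filter_upwards [ae_restrict_mem (measurableSet_shell ρ σ)] with y hy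
    rw [Real.norm_of_nonneg (by positivity)]
    exact inv_anti₀ (by positivity) (pow_le_pow_left₀ hρ.le hy.1.le _)

theorem integrableOn_shell_defect (h : IsLocalSolution L R C δ K v G) {ρ σ : ℝ} (hρ : 0 < ρ)
    (hσ : σ < R) : IntegrableOn
      (fun y => (‖y‖ ^ (d + 4))⁻¹ * (inner ℝ (G y) y - 3 / 2 * v y) ^ 2) (shell d ρ σ) := by
  have hC := h.growth_nonneg
  refine h.integrableOn_shell_mul hρ hσ (M := 13 / 2 * (C * R ^ 3))
    ((h.continuousOn_inner.sub (h.continuousOn_posSet.const_mul _)).pow 2)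
    (fun y hy hyV => ?_) fun y hy => ?_
  · simp [h.grad_eq_zero y hyV, h.eq_zero_of_notMem hy hyV]
  · have b2 := h.inner_sq_le hy
    have b3 := h.sq_le hy
    have b4 : C * ‖y‖ ^ 3 ≤ C * R ^ 3 := mul_le_mul_of_nonneg_left
      (pow_le_pow_left₀ (norm_nonneg _) (mem_ball_zero_iff.1 hy).le 3) hC
    rw [abs_of_nonneg (sq_nonneg _)]
    nlinarith [sq_nonneg (inner ℝ (G y) y + 3 / 2 * v y)]

/-- The error in the monotonicity formula. -/
theorem exists_monotonicity (h : IsLocalSolution L R C δ K v G) :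
    ∃ M, 0 ≤ M ∧ ∀ ρ σ, 0 < ρ → ρ < σ → σ < R →
      |weissPhi L v G 0 σ - weissPhi L v G 0 ρ - 2 / L.rho0 * homogeneityDefect v G ρ σ| ≤
        M * σ := by
  obtain ⟨M₁, hM₁0, hM₁⟩ := h.exists_abs_defect_le
  have hC := h.growth_nonneg
  have hK := h.regular.const_nonneg
  set M₂ := K * (C + 1) * (5 * C) with hM₂
  have hM₂0 : 0 ≤ M₂ := by positivity
  refine ⟨(M₁ + M₂) * ((d + 1) * volume.real (ball (0 : Euc d) 1)), by positivity, ?_⟩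
  intro ρ σ hρ hρσ hσ
  have hσ0 : 0 < σ := hρ.trans hρσ
  set θ := shellWeight d ρ σ with hθ
  set i : Euc d → ℝ := fun y => inner ℝ (G y) y with hi
  set q : Euc d → ℝ := fun y => (‖y‖ ^ (d + 4))⁻¹ with hq
  have hP : IntegrableOn (fun y => (d + 2) * energy L v G y + defect L v G y) (ball 0 R) :=
    (h.integrableOn_energy.const_mul _).add
      ((h.integrableOn_energy.neg.add h.integrableOn_coeff_mul_normSq).add
        (integrableOn_ball_mul_continuous h.integrableOn_force continuous_lastCoord))
  have hdef : IntegrableOn (defect L v G) (ball 0 R) :=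
    (h.integrableOn_energy.neg.add h.integrableOn_coeff_mul_normSq).add
        (integrableOn_ball_mul_continuous h.integrableOn_force continuous_lastCoord)
  have hT : IntegrableOn (fun y => coeff L G y * (2 * (i y ^ 2 / ‖y‖) - 3 * (v y * i y / ‖y‖)))
      (ball 0 R) := by
    refine ((h.integrableOn_coeff_mul_inner_sq.const_mul 2).sub
      (h.integrableOn_coeff_mul_mul_inner.const_mul 3)).congr (Eventually.of_forall fun y => ?_)
    simp only [Pi.sub_apply, hi]; ring
  have hQ : IntegrableOn (fun y => -(energy L v G y * ‖y‖) +
      coeff L G y * (2 * (i y ^ 2 / ‖y‖) - 3 * (v y * i y / ‖y‖))) (ball 0 R) :=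
    (integrableOn_ball_mul_continuous h.integrableOn_energy continuous_norm).neg.add hT
  have hfc : Continuous fun s : ℝ => ((max s ρ) ^ (d + 3))⁻¹ := by
    refine Continuous.inv₀ (by fun_prop) fun s => ?_
    exact pow_ne_zero _ (hρ.trans_le (le_max_right _ _)).ne'
  have hid := integral_radial_indicator_eq_zero (ρ := ρ) (σ := σ) hP hQ hfc
    fun θ h1 h2 h3 => h.integral_radial_identity hρ hσ h1 h2 h3
  change ∫ y in ball (0 : Euc d) R, (((d + 2) * energy L v G y + defect L v G y) *
    radialProfile θ R ‖y‖ + (-(energy L v G y * ‖y‖) + coeff L G y *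
      (2 * (i y ^ 2 / ‖y‖) - 3 * (v y * i y / ‖y‖))) * θ ‖y‖) = 0 at hid
  -- measurability and bounds of the weights
  have hθm : Measurable θ := hfc.measurable.indicator measurableSet_Ioo
  have hgb : ∀ y : Euc d, y ∈ ball (0 : Euc d) R →
      |radialProfile θ R ‖y‖| ≤ (ρ ^ (d + 2))⁻¹ := by
    intro y hy
    rcases le_or_gt σ ‖y‖ with h1 | h1
    · rw [hθ, radialProfile_shellWeight_of_ge hσ h1 (mem_ball_zero_iff.1 hy).le, abs_zero]
      positivity
    · have e1 := radialProfile_shellWeight_of_le (d := d) hρ hρσ hσ h1.le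
      rcases le_or_gt ‖y‖ ρ with h2 | h2
      · have e2 := radialProfile_shellWeight_of_le (d := d) hρ hρσ hσ hρσ.le
        have e3 := abs_radialProfile_shellWeight_le (d := d) hρ hρσ hσ hρ hρσ.le
        rw [max_eq_right h2] at e1
        rw [max_self] at e2
        have : radialProfile θ R ‖y‖ = radialProfile θ R ρ := by
          have hd : ((d : ℝ) + 2) ≠ 0 := by positivity
          exact mul_left_cancel₀ hd (e1.trans e2.symm)
        rw [this]; exact e3
      · exact (abs_radialProfile_shellWeight_le hρ hρσ hσ (hρ.trans h2) h1.le).trans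
          (inv_anti₀ (by positivity) (pow_le_pow_left₀ hρ.le h2.le _))
  have hgm : AEStronglyMeasurable (fun y : Euc d => radialProfile θ R ‖y‖)
      (volume.restrict (ball 0 R)) := by
    have hii : ∀ a b, IntervalIntegrable θ volume a b := fun a b =>
      ⟨(hfc.integrableOn_Ioc.indicator measurableSet_Ioo),
        (hfc.integrableOn_Ioc.indicator measurableSet_Ioo)⟩
    have hcont : Continuous (radialProfile θ R) := by
      have e : radialProfile θ R = fun r => -∫ s in R..r, θ s := by
        funext r; rw [radialProfile, intervalIntegral.integral_symm]
      rw [e]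
      exact (intervalIntegral.continuous_primitive hii R).neg
    exact (hcont.comp continuous_norm).aestronglyMeasurable
  have hθb : ∀ s, |θ s| ≤ (ρ ^ (d + 3))⁻¹ := fun s => by
    by_cases hs : s ∈ Ioo ρ σ
    · have hs0 : 0 < s := hρ.trans hs.1
      rw [hθ, shellWeight_of_mem hs, abs_of_pos (by positivity)]
      exact inv_anti₀ (by positivity) (pow_le_pow_left₀ hρ.le hs.1.le _)
    · rw [hθ, shellWeight_of_notMem hs, abs_zero]; positivity
  have hθn : AEStronglyMeasurable (fun y : Euc d => θ ‖y‖) (volume.restrict (ball 0 R)) :=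
    (hθm.comp measurable_norm).aestronglyMeasurable
  have I1 : IntegrableOn (fun y => energy L v G y *
      ((d + 2) * radialProfile θ R ‖y‖ - θ ‖y‖ * ‖y‖)) (ball 0 R) := by
    refine Integrable.mul_bdd (c := (d + 2) * (ρ ^ (d + 2))⁻¹ + (ρ ^ (d + 3))⁻¹ * R)
      h.integrableOn_energy ((hgm.const_mul _).sub
        (hθn.mul continuous_norm.aestronglyMeasurable)) ?_
    filter_upwards [ae_restrict_mem measurableSet_ball] with y hy
    refine (norm_sub_le _ _).trans (add_le_add ?_ ?_)
    · rw [norm_mul, Real.norm_of_nonneg (by positivity)]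
      exact mul_le_mul_of_nonneg_left (hgb y hy) (by positivity)
    · rw [norm_mul, norm_norm]
      exact mul_le_mul (hθb _) (mem_ball_zero_iff.1 hy).le (norm_nonneg _) (by positivity)
  have I2 : IntegrableOn (fun y => defect L v G y * radialProfile θ R ‖y‖) (ball 0 R) := by
    refine Integrable.mul_bdd (c := (ρ ^ (d + 2))⁻¹) hdef hgm ?_
    filter_upwards [ae_restrict_mem measurableSet_ball] with y hy using hgb y hy
  have I3 : IntegrableOn (fun y => coeff L G y *
      (2 * (i y ^ 2 / ‖y‖) - 3 * (v y * i y / ‖y‖)) * θ ‖y‖) (ball 0 R) :=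
    Integrable.mul_bdd (c := (ρ ^ (d + 3))⁻¹) hT hθn (Eventually.of_forall fun y => hθb _)
  have hsplit : (weissU L v G 0 ρ - weissU L v G 0 σ) +
      (∫ y in ball (0 : Euc d) R, defect L v G y * radialProfile θ R ‖y‖) +
      (∫ y in ball (0 : Euc d) R, coeff L G y *
        (2 * (i y ^ 2 / ‖y‖) - 3 * (v y * i y / ‖y‖)) * θ ‖y‖) = 0 := by
    rw [← h.integral_energy_weight hρ hρσ hσ]
    have k1 := integral_add (I1.add I2) I3
    have k2 := integral_add I1 I2
    simp only [Pi.add_apply] at k1 k2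
    rw [← k2, ← k1, ← hid]
    refine integral_congr_ae (Eventually.of_forall fun y => ?_)
    simp only [hθ]
    ring
  have hsub : shell d ρ σ ⊆ ball 0 R := shell_subset_ball hσ.le
  have hpos : ∀ y ∈ shell d ρ σ, 0 < ‖y‖ := fun y hy => hρ.trans hy.1
  have hind : ∀ y ∈ ball (0 : Euc d) R, coeff L G y *
      (2 * (i y ^ 2 / ‖y‖) - 3 * (v y * i y / ‖y‖)) * θ ‖y‖ = (shell d ρ σ).indicator
        (fun y => coeff L G y * (q y * (2 * i y ^ 2 - 3 * (v y * i y)))) y := by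
    intro y _
    by_cases hy : y ∈ shell d ρ σ
    · have hy0 := hpos y hy
      rw [indicator_of_mem hy, hθ, shellWeight_of_mem hy, hq]
      simp only
      rw [pow_succ ‖y‖ (d + 3)]
      field_simp
    · rw [indicator_of_notMem hy, hθ, shellWeight_of_notMem hy, mul_zero]
  have hJ0 : IntegrableOn (fun y => coeff L G y * (q y * (2 * i y ^ 2 - 3 * (v y * i y))))
      (shell d ρ σ) := by
    have := (I3.congr_fun hind measurableSet_ball)
    rw [IntegrableOn, integrable_indicator_iff (measurableSet_shell ρ σ), IntegrableOn,
      Measure.restrict_restrict (measurableSet_shell ρ σ),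
      inter_eq_self_of_subset_left hsub] at this
    exact this
  rw [setIntegral_congr_fun measurableSet_ball hind,
    setIntegral_indicator (measurableSet_shell ρ σ), inter_eq_self_of_subset_right hsub] at hsplit
  -- separate the main terms from the error
  have hbd1 : ∀ y ∈ shell d ρ σ, |(coeff L G y - 1 / L.rho0) *
      (q y * (2 * i y ^ 2 - 3 * (v y * i y)))| ≤ M₂ * (‖y‖ ^ d)⁻¹ := by
    intro y hy
    have hyB := hsub hy
    have hy0 := hpos y hy
    have b1 := h.abs_coeff_sub_le hyB
    have b2 := h.inner_sq_le hyB
    have b3 := abs_le.1 (h.abs_mul_inner_le hyB)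
    have b4 : |2 * i y ^ 2 - 3 * (v y * i y)| ≤ 5 * C * ‖y‖ ^ 3 := by
      have : 0 ≤ i y ^ 2 := sq_nonneg _
      have b5 : i y ^ 2 ≤ C * ‖y‖ ^ 3 := b2
      have b6 : -(C * ‖y‖ ^ 3) ≤ v y * i y ∧ v y * i y ≤ C * ‖y‖ ^ 3 := b3
      rw [abs_le]
      constructor <;> linarith [b6.1, b6.2]
    have hq0 : 0 ≤ q y := by simp only [hq]; positivity
    rw [abs_mul, abs_mul, abs_of_nonneg hq0]
    calc _ ≤ K * (C + 1) * ‖y‖ * (q y * (5 * C * ‖y‖ ^ 3)) :=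
          mul_le_mul b1 (mul_le_mul_of_nonneg_left b4 hq0) (by positivity) (by positivity)
      _ = M₂ * (‖y‖ ^ d)⁻¹ := by
          rw [hM₂, hq]
          simp only
          rw [pow_add ‖y‖ d 4]
          field_simp
  have hbd2 : ∀ y ∈ ball (0 : Euc d) R, |defect L v G y * radialProfile θ R ‖y‖| ≤
      (ball (0 : Euc d) σ).indicator (fun y => M₁ * (‖y‖ ^ d)⁻¹) y := by
    intro y hy
    rcases le_or_gt σ ‖y‖ with h1 | h1
    · have n1 : y ∉ ball (0 : Euc d) σ := by simpa using h1
      rw [indicator_of_notMem n1, hθ,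
        radialProfile_shellWeight_of_ge hσ h1 (mem_ball_zero_iff.1 hy).le, mul_zero, abs_zero]
    · have n1 : y ∈ ball (0 : Euc d) σ := by simpa using h1
      rw [indicator_of_mem n1, abs_mul]
      have b1 := hM₁ y hy
      rcases eq_or_ne y 0 with rfl | hy0
      · have : |defect L v G 0| = 0 := le_antisymm (by simpa using b1) (abs_nonneg _)
        rw [this, zero_mul]; positivity
      · have hyp : 0 < ‖y‖ := norm_pos_iff.2 hy0
        have b2 := abs_radialProfile_shellWeight_le (d := d) hρ hρσ hσ hyp h1.le
        calc _ ≤ M₁ * ‖y‖ ^ 2 * (‖y‖ ^ (d + 2))⁻¹ :=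
              mul_le_mul b1 b2 (abs_nonneg _) (by positivity)
          _ = _ := by rw [pow_add ‖y‖ d 2]; field_simp
  have hN := integrableOn_norm_pow_inv (d := d) σ
  have hNs : IntegrableOn (fun y : Euc d => (‖y‖ ^ d)⁻¹) (shell d ρ σ) :=
    hN.mono_set (shell_subset_ball le_rfl)
  have herr2 : |∫ y in ball (0 : Euc d) R, defect L v G y * radialProfile θ R ‖y‖| ≤
      M₁ * ((d + 1) * volume.real (ball (0 : Euc d) 1)) * σ := by
    have hI : IntegrableOn ((ball (0 : Euc d) σ).indicator fun y => M₁ * (‖y‖ ^ d)⁻¹)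
        (ball 0 R) :=
      ((integrable_indicator_iff measurableSet_ball).2 (hN.const_mul M₁)).integrableOn
    rw [← Real.norm_eq_abs]
    refine (norm_integral_le_of_norm_le hI ?_).trans_eq ?_
    · filter_upwards [ae_restrict_mem measurableSet_ball] with y hy using hbd2 y hy
    · rw [setIntegral_indicator measurableSet_ball,
        inter_eq_self_of_subset_right (ball_subset_ball hσ.le), integral_const_mul,
        integral_norm_pow_inv hσ0.le]
      ring
  have herr1 : |∫ y in shell d ρ σ, (coeff L G y - 1 / L.rho0) *
      (q y * (2 * i y ^ 2 - 3 * (v y * i y)))| ≤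
      M₂ * ((d + 1) * volume.real (ball (0 : Euc d) 1)) * σ := by
    rw [← Real.norm_eq_abs]
    refine (norm_integral_le_of_norm_le (hNs.const_mul M₂) ?_).trans ?_
    · filter_upwards [ae_restrict_mem (measurableSet_shell ρ σ)] with y hy using hbd1 y hy
    · rw [integral_const_mul, mul_assoc M₂]
      refine mul_le_mul_of_nonneg_left ?_ hM₂0
      rw [← integral_norm_pow_inv hσ0.le]
      exact setIntegral_mono_set hN (Eventually.of_forall fun y => by positivity)
        (shell_subset_ball le_rfl).eventuallyLE
  have hR := h.radius_pos
  have hY3 : ∀ y ∈ ball (0 : Euc d) R, C * ‖y‖ ^ 3 ≤ C * R ^ 3 := fun y hy =>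
    mul_le_mul_of_nonneg_left
      (pow_le_pow_left₀ (norm_nonneg _) (mem_ball_zero_iff.1 hy).le 3) hC
  have hJ1 := h.integrableOn_shell_defect hρ hσ
  have hJ2 := h.integrableOn_shell_radial hρ hσ
  have hJ3 : IntegrableOn (fun y => (coeff L G y - 1 / L.rho0) *
      (q y * (2 * i y ^ 2 - 3 * (v y * i y)))) (shell d ρ σ) := by
    have : IntegrableOn (fun y => q y * (2 * i y ^ 2 - 3 * (v y * i y))) (shell d ρ σ) := by
      refine h.integrableOn_shell_mul hρ hσ (M := 5 * (C * R ^ 3)) (((h.continuousOn_inner.pow 2).const_mul _).sub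
        ((h.continuousOn_posSet.mul h.continuousOn_inner).const_mul _))
        (fun y hy hyV => ?_) fun y hy => ?_
      · simp [hi, h.grad_eq_zero y hyV]
      · have b2 : i y ^ 2 ≤ _ := h.inner_sq_le hy
        have b3 := abs_le.1 (h.abs_mul_inner_le hy)
        have b4 := hY3 y hy
        have b5 : -(C * ‖y‖ ^ 3) ≤ v y * i y ∧ v y * i y ≤ C * ‖y‖ ^ 3 := b3
        have b6 : 0 ≤ i y ^ 2 := sq_nonneg _
        rw [abs_le]
        constructor <;> linarith [b5.1, b5.2]
    refine (hJ0.sub (this.const_mul (1 / L.rho0))).congr (Eventually.of_forall fun y => ?_)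
    simp only [Pi.sub_apply]; ring
  have hmain : ∫ y in shell d ρ σ, coeff L G y * (q y * (2 * i y ^ 2 - 3 * (v y * i y))) =
      2 / L.rho0 * homogeneityDefect v G ρ σ + 3 / 2 * (weissW L v 0 σ - weissW L v 0 ρ) +
      ∫ y in shell d ρ σ, (coeff L G y - 1 / L.rho0) * (q y * (2 * i y ^ 2 - 3 * (v y * i y))) := by
    have e1 : 3 / 2 * (weissW L v 0 σ - weissW L v 0 ρ) = 3 / (2 * L.rho0) *
        (∫ y in shell d ρ σ, (‖y‖ ^ (d + 4))⁻¹ * (2 * v y * inner ℝ (G y) y - 3 * v y ^ 2)) := by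
      rw [h.integral_shell_radial hρ hρσ.le hσ]
      have := L.rho0_pos
      field_simp
    have k1 := integral_add ((hJ1.const_mul (2 / L.rho0)).add (hJ2.const_mul (3 / (2 * L.rho0)))) hJ3
    have k2 := integral_add (hJ1.const_mul (2 / L.rho0)) (hJ2.const_mul (3 / (2 * L.rho0)))
    simp only [Pi.add_apply] at k1 k2
    rw [e1, homogeneityDefect, ← integral_const_mul, ← integral_const_mul, ← k2, ← k1]
    refine integral_congr_ae (Eventually.of_forall fun y => ?_)
    have := L.rho0_pos
    simp only [hi, hq]
    field_simp
    ring
  rw [hmain] at hsplit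
  have hfin : weissPhi L v G 0 σ - weissPhi L v G 0 ρ - 2 / L.rho0 * homogeneityDefect v G ρ σ =
      (∫ y in ball (0 : Euc d) R, defect L v G y * radialProfile θ R ‖y‖) +
      ∫ y in shell d ρ σ, (coeff L G y - 1 / L.rho0) * (q y * (2 * i y ^ 2 - 3 * (v y * i y))) := by
    simp only [weissPhi]
    linarith
  rw [hfin]
  refine (abs_add_le _ _).trans ?_
  calc _ ≤ _ := add_le_add herr2 herr1
    _ = _ := by ring

end IsLocalSolution

namespace IsLocalSolution

variable {L : CompressibleLiquid} {d : ℕ} {R C δ K : ℝ} {v : Euc d → ℝ} {G : Euc d → Euc d}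

theorem weissW_eq (L : CompressibleLiquid) (v : Euc d → ℝ) {r : ℝ} (hr : 0 < r) :
    weissW L v 0 r = ∫ z : sphere (0 : Euc d) 1, v (r • (z : Euc d)) ^ 2 / r ^ 3 / L.rho0
      ∂((volume : Measure (Euc d)).toSphere) := by
  rw [weissW, sphereIntegral, ← mul_assoc, ← integral_const_mul]
  refine integral_congr_ae (Eventually.of_forall fun z => ?_)
  simp only [zero_add]
  field_simp
  ring

theorem sq_div_le (h : IsLocalSolution L R C δ K v G) {r : ℝ} (hr : 0 < r) (hrR : r < R)
    (z : sphere (0 : Euc d) 1) : v (r • (z : Euc d)) ^ 2 / r ^ 3 ≤ C := by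
  have hn : ‖r • (z : Euc d)‖ = r := by
    rw [norm_smul, norm_eq_of_mem_sphere z, mul_one, Real.norm_of_nonneg hr.le]
  have := h.sq_le (smul_sphere_mem hr z le_rfl hrR).1
  rw [hn] at this
  rwa [div_le_iff₀ (by positivity)]

theorem exists_weissPhi_ge (h : IsLocalSolution L R C δ K v G) :
    ∃ B, ∀ r, 0 < r → r < R → -B ≤ weissPhi L v G 0 r := by
  obtain ⟨M, hM0, hM⟩ := h.exists_abs_energy_le
  have hρ := L.rho0_pos
  set S : Measure (sphere (0 : Euc d) 1) := (volume : Measure (Euc d)).toSphere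
  refine ⟨M * volume.real (ball (0 : Euc d) 1) + 3 / 2 * (S.real univ * (C / L.rho0)),
    fun r hr hrR => ?_⟩
  have hU : |weissU L v G 0 r| ≤ M * volume.real (ball (0 : Euc d) 1) := by
    have h1 : |∫ y in ball (0 : Euc d) r, energy L v G y| ≤
        M * r * volume.real (ball (0 : Euc d) r) := by
      rw [← Real.norm_eq_abs]
      exact norm_setIntegral_le_of_norm_le_const measure_ball_lt_top fun y hy =>
        (hM y (ball_subset_ball hrR.le hy)).trans
          (mul_le_mul_of_nonneg_left (mem_ball_zero_iff.1 hy).le hM0)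
    have h2 : volume.real (ball (0 : Euc d) r) = r ^ (d + 1) * volume.real (ball (0 : Euc d) 1) := by
      rw [Measure.real, Measure.addHaar_ball_of_pos volume 0 hr, ENNReal.toReal_mul,
        ENNReal.toReal_ofReal (by positivity)]
      simp [Measure.real]
    rw [h2] at h1
    change |(r ^ (d + 2))⁻¹ * ∫ y in ball (0 : Euc d) r, energy L v G y| ≤ _
    rw [abs_mul, abs_of_pos (by positivity)]
    calc _ ≤ (r ^ (d + 2))⁻¹ * (M * r * (r ^ (d + 1) * volume.real (ball (0 : Euc d) 1))) :=
          mul_le_mul_of_nonneg_left h1 (by positivity)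
      _ = _ := by
          rw [pow_succ r (d + 1)]
          field_simp
  have hW : weissW L v 0 r ≤ S.real univ * (C / L.rho0) := by
    rw [weissW_eq L v hr]
    have : ∀ z : sphere (0 : Euc d) 1, ‖v (r • (z : Euc d)) ^ 2 / r ^ 3 / L.rho0‖ ≤ C / L.rho0 :=
      fun z => by
        rw [Real.norm_of_nonneg (by positivity)]
        exact div_le_div_of_nonneg_right (h.sq_div_le hr hrR z) hρ.le
    have h1 := norm_integral_le_of_norm_le_const (μ := S) (Eventually.of_forall this)
    rw [mul_comm]
    exact (le_abs_self _).trans h1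
  rw [weissPhi]
  linarith [(abs_le.1 hU).1]

theorem tendsto_weissPhi (h : IsLocalSolution L R C δ K v G) :
    ∃ ℓ, Tendsto (fun r => weissPhi L v G 0 r) (𝓝[>] 0) (𝓝 ℓ) := by
  obtain ⟨M, hM0, hM⟩ := h.exists_monotonicity
  obtain ⟨B, hB⟩ := h.exists_weissPhi_ge
  have hR := h.radius_pos
  have hmono : ∀ ρ σ, 0 < ρ → ρ < σ → σ < R →
      weissPhi L v G 0 ρ ≤ weissPhi L v G 0 σ + M * σ := fun ρ σ h1 h2 h3 => by
    have := (abs_le.1 (hM ρ σ h1 h2 h3)).1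
    have hD : 0 ≤ 2 / L.rho0 * homogeneityDefect v G ρ σ :=
      mul_nonneg (by have := L.rho0_pos; positivity) (homogeneityDefect_nonneg v G ρ σ)
    linarith
  set S : Set ℝ := (fun σ => weissPhi L v G 0 σ + M * σ) '' Ioo 0 R
  have hbdd : BddBelow S := ⟨-B, by
    rintro _ ⟨σ, hσ, rfl⟩
    have := hB σ hσ.1 hσ.2
    have := mul_nonneg hM0 hσ.1.le
    simp only; linarith⟩
  have hne : S.Nonempty := ⟨_, R / 2, ⟨by linarith, by linarith⟩, rfl⟩
  refine ⟨sInf S, ?_⟩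
  rw [Metric.tendsto_nhds]
  intro ε hε
  obtain ⟨_, ⟨σ, hσ, rfl⟩, hlt⟩ := exists_lt_of_csInf_lt hne (show sInf S < sInf S + ε by linarith)
  have hpos : 0 < min σ (ε / (M + 1)) := lt_min hσ.1 (by positivity)
  filter_upwards [Ioo_mem_nhdsGT hpos] with ρ hρ
  have h1 : ρ < σ := hρ.2.trans_le (min_le_left _ _)
  have h2 : ρ < ε / (M + 1) := hρ.2.trans_le (min_le_right _ _)
  rw [lt_div_iff₀ (by linarith)] at h2
  have h3 := hmono ρ σ hρ.1 h1 hσ.2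
  have h4 : sInf S ≤ weissPhi L v G 0 ρ + M * ρ :=
    csInf_le hbdd ⟨ρ, ⟨hρ.1, h1.trans hσ.2⟩, rfl⟩
  simp only at hlt
  rw [Real.dist_eq, abs_lt]
  constructor <;> nlinarith [hρ.1]

theorem tendsto_homogeneityDefect (h : IsLocalSolution L R C δ K v G) {r : ℕ → ℝ}
    (hr : ∀ m, 0 < r m) (hr0 : Tendsto r atTop (𝓝 0)) {a b : ℝ} (ha : 0 < a) (hab : a < b) :
    Tendsto (fun m => homogeneityDefect v G (r m * a) (r m * b)) atTop (𝓝 0) := by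
  obtain ⟨M, hM0, hM⟩ := h.exists_monotonicity
  obtain ⟨ℓ, hℓ⟩ := h.tendsto_weissPhi
  have hρ := L.rho0_pos
  have hb : 0 < b := ha.trans hab
  have hlim : ∀ c, 0 < c → Tendsto (fun m => weissPhi L v G 0 (r m * c)) atTop (𝓝 ℓ) :=
    fun c hc => by
      refine hℓ.comp (tendsto_nhdsWithin_iff.2 ⟨?_, Eventually.of_forall fun m => mul_pos (hr m) hc⟩)
      simpa using hr0.mul_const c
  have hup : Tendsto (fun m => L.rho0 / 2 * (weissPhi L v G 0 (r m * b) -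
      weissPhi L v G 0 (r m * a) + M * (r m * b))) atTop (𝓝 0) := by
    have := (((hlim b hb).sub (hlim a ha)).add ((hr0.mul_const b).const_mul M)).const_mul
      (L.rho0 / 2)
    simpa using this
  refine tendsto_of_tendsto_of_tendsto_of_le_of_le' tendsto_const_nhds hup
    (Eventually.of_forall fun m => homogeneityDefect_nonneg _ _ _ _) ?_
  have hrb : Tendsto (fun m => r m * b) atTop (𝓝 0) := by simpa using hr0.mul_const b
  filter_upwards [hrb.eventually_lt_const h.radius_pos] with m hm
  have h1 := (abs_le.1 (hM (r m * a) (r m * b) (mul_pos (hr m) ha)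
    (mul_lt_mul_of_pos_left hab (hr m)) hm)).1
  have h2 : 2 / L.rho0 * homogeneityDefect v G (r m * a) (r m * b) ≤
      weissPhi L v G 0 (r m * b) - weissPhi L v G 0 (r m * a) + M * (r m * b) := by linarith
  calc homogeneityDefect v G (r m * a) (r m * b) =
      L.rho0 / 2 * (2 / L.rho0 * homogeneityDefect v G (r m * a) (r m * b)) := by field_simp
    _ ≤ _ := mul_le_mul_of_nonneg_left h2 (by positivity)

theorem integral_sphere_sub_le (h : IsLocalSolution L R C δ K v G) {ρ σ τ : ℝ} (hρ : 0 < ρ)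
    (hρσ : ρ < σ) (hσ : σ < R) (hτ : 0 < τ) :
    ∫ z : sphere (0 : Euc d) 1,
      |v (σ • (z : Euc d)) ^ 2 / σ ^ 3 - v (ρ • (z : Euc d)) ^ 2 / ρ ^ 3|
        ∂((volume : Measure (Euc d)).toSphere) ≤
      τ * (C * (σ / ρ) ^ (d + 1) * volume.real (ball (0 : Euc d) 1)) +
        τ⁻¹ * homogeneityDefect v G ρ σ := by
  have hC := h.growth_nonneg
  have hσ0 : 0 < σ := hρ.trans hρσ
  set f : Euc d → ℝ := fun y => (‖y‖ ^ (d + 4))⁻¹ * (2 * v y * inner ℝ (G y) y - 3 * v y ^ 2)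
    with hf
  have hfi : IntegrableOn f (shell d ρ σ) := h.integrableOn_shell_radial hρ hσ
  have hsub : shell d ρ σ ⊆ ball 0 R := shell_subset_ball hσ.le
  have hcv : ∀ r, 0 < r → r < R → Continuous fun z : sphere (0 : Euc d) 1 =>
      v (r • (z : Euc d)) ^ 2 / r ^ 3 := fun r hr hrR =>
    ((h.continuousOn.comp_continuous (by fun_prop) fun z =>
      (smul_sphere_mem hr z le_rfl hrR).1).pow 2).div_const _
  have hradial : ∫ z : sphere (0 : Euc d) 1,
      |v (σ • (z : Euc d)) ^ 2 / σ ^ 3 - v (ρ • (z : Euc d)) ^ 2 / ρ ^ 3|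
        ∂((volume : Measure (Euc d)).toSphere) ≤ ∫ y in shell d ρ σ, |f y| := by
    rw [setIntegral_shell hρ.le hfi.abs]
    have hbd : ∀ z : sphere (0 : Euc d) 1,
        |v (σ • (z : Euc d)) ^ 2 / σ ^ 3 - v (ρ • (z : Euc d)) ^ 2 / ρ ^ 3| ≤
        ∫ r in Ioo ρ σ, r ^ d * |f (r • (z : Euc d))| := fun z => by
      rw [← h.integral_radial_eq hρ hρσ.le hσ z]
      refine (abs_integral_le_integral_abs).trans_eq ?_
      refine setIntegral_congr_fun measurableSet_Ioo fun r hr => ?_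
      have hr0 : 0 < r := hρ.trans hr.1
      simp only [abs_mul, abs_of_pos (pow_pos hr0 d), hf]
    have hci : Continuous fun z : sphere (0 : Euc d) 1 =>
        ∫ r in Ioo ρ σ, r ^ d * |f (r • (z : Euc d))| := by
      have e : (fun z : sphere (0 : Euc d) 1 => ∫ r in Ioo ρ σ, r ^ d * |f (r • (z : Euc d))|) =
          fun z : sphere (0 : Euc d) 1 => ∫ r in Icc ρ σ, (max ρ (min r σ)) ^ d *
            |f ((max ρ (min r σ)) • (z : Euc d))| := by
        funext z
        rw [integral_Icc_eq_integral_Ioo]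
        refine setIntegral_congr_fun measurableSet_Ioo fun r hr => ?_
        rw [min_eq_left hr.2.le, max_eq_right hr.1.le]
      rw [e]
      refine continuous_parametric_integral_of_continuous ?_ isCompact_Icc
      have hg : Continuous fun p : sphere (0 : Euc d) 1 × ℝ =>
          (max ρ (min p.2 σ)) • (p.1 : Euc d) := by fun_prop
      have hfc : ContinuousOn f (ball 0 R \ {0}) := h.continuousOn_radial
      have hfg := hfc.comp_continuous hg fun p =>
        smul_sphere_mem hρ p.1 (le_max_left _ _) ((max_le hρσ.le (min_le_right _ _)).trans_lt hσ)
      exact Continuous.mul (by fun_prop) hfg.abs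
    refine integral_mono ?_ ?_ hbd
    · exact ((hcv σ hσ0 hσ).sub (hcv ρ hρ (hρσ.trans hσ))).abs.integrable_of_hasCompactSupport
        (HasCompactSupport.of_compactSpace _)
    · exact hci.integrable_of_hasCompactSupport (HasCompactSupport.of_compactSpace _)
  have hq : ∀ y ∈ shell d ρ σ, |f y| ≤ τ * (C * (ρ ^ (d + 1))⁻¹) +
      τ⁻¹ * ((‖y‖ ^ (d + 4))⁻¹ * (inner ℝ (G y) y - 3 / 2 * v y) ^ 2) := fun y hy => by
    have hy0 : 0 < ‖y‖ := hρ.trans hy.1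
    have hvy := h.sq_le (hsub hy)
    set e := inner ℝ (G y) y - 3 / 2 * v y with he
    have e1 : 2 * v y * inner ℝ (G y) y - 3 * v y ^ 2 = 2 * v y * e := by rw [he]; ring
    have e2 : |2 * v y * e| ≤ τ * v y ^ 2 + τ⁻¹ * e ^ 2 := by
      have h1 : 0 ≤ τ⁻¹ * (τ * v y - e) ^ 2 := by positivity
      have h2 : 0 ≤ τ⁻¹ * (τ * v y + e) ^ 2 := by positivity
      have e3 : τ⁻¹ * (τ * v y - e) ^ 2 = τ * v y ^ 2 + τ⁻¹ * e ^ 2 - 2 * v y * e := by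
        field_simp; ring
      have e4 : τ⁻¹ * (τ * v y + e) ^ 2 = τ * v y ^ 2 + τ⁻¹ * e ^ 2 + 2 * v y * e := by
        field_simp; ring
      rw [abs_le]; constructor <;> linarith
    have e5 : (‖y‖ ^ (d + 4))⁻¹ * v y ^ 2 ≤ C * (ρ ^ (d + 1))⁻¹ := by
      calc _ ≤ (‖y‖ ^ (d + 4))⁻¹ * (C * ‖y‖ ^ 3) :=
            mul_le_mul_of_nonneg_left hvy (by positivity)
        _ = C * (‖y‖ ^ (d + 1))⁻¹ := by
            rw [show d + 4 = d + 1 + 3 by ring, pow_add ‖y‖ (d + 1) 3]; field_simp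
        _ ≤ _ := mul_le_mul_of_nonneg_left (inv_anti₀ (by positivity)
            (pow_le_pow_left₀ hρ.le hy.1.le _)) hC
    simp only [hf]
    rw [e1, abs_mul, abs_of_pos (by positivity)]
    calc _ ≤ (‖y‖ ^ (d + 4))⁻¹ * (τ * v y ^ 2 + τ⁻¹ * e ^ 2) :=
          mul_le_mul_of_nonneg_left e2 (by positivity)
      _ = τ * ((‖y‖ ^ (d + 4))⁻¹ * v y ^ 2) + τ⁻¹ * ((‖y‖ ^ (d + 4))⁻¹ * e ^ 2) := by ring
      _ ≤ _ := by gcongr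
  have hfin : volume (shell d ρ σ) < ⊤ :=
    (measure_mono (shell_subset_ball le_rfl)).trans_lt measure_ball_lt_top
  have hi1 : IntegrableOn (fun _ : Euc d => τ * (C * (ρ ^ (d + 1))⁻¹)) (shell d ρ σ) :=
    integrableOn_const hfin.ne
  have hi2 := (h.integrableOn_shell_defect hρ hσ).const_mul τ⁻¹
  have hvol : volume.real (shell d ρ σ) ≤ σ ^ (d + 1) * volume.real (ball (0 : Euc d) 1) := by
    have e1 : volume.real (ball (0 : Euc d) σ) =
        σ ^ (d + 1) * volume.real (ball (0 : Euc d) 1) := by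
      rw [Measure.real, Measure.addHaar_ball_of_pos volume 0 hσ0, ENNReal.toReal_mul,
        ENNReal.toReal_ofReal (by positivity)]
      simp [Measure.real]
    rw [← e1]
    exact measureReal_mono (shell_subset_ball le_rfl) measure_ball_lt_top.ne
  refine hradial.trans ((setIntegral_mono_on hfi.abs (hi1.add hi2) (measurableSet_shell ρ σ)
    hq).trans ?_)
  rw [integral_add' hi1 hi2, integral_const_mul τ⁻¹, setIntegral_const, smul_eq_mul]
  refine add_le_add ?_ le_rfl
  calc _ ≤ σ ^ (d + 1) * volume.real (ball (0 : Euc d) 1) * (τ * (C * (ρ ^ (d + 1))⁻¹)) :=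
        mul_le_mul_of_nonneg_right hvol (by positivity)
    _ = _ := by rw [div_pow]; field_simp

end IsLocalSolution

theorem rpow_three_halves_sq {r : ℝ} (hr : 0 ≤ r) : (r ^ (3 / 2 : ℝ)) ^ 2 = r ^ 3 := by
  rw [← Real.rpow_natCast, ← Real.rpow_mul hr]
  norm_num

namespace IsLocalSolution

variable {L : CompressibleLiquid} {d : ℕ} {R C δ K : ℝ} {v : Euc d → ℝ} {G : Euc d → Euc d}

theorem blowUp_sq_div {r : ℝ} (hr : 0 < r) (c : ℝ) (x : Euc d) :
    v ((r * c) • x) ^ 2 / (r * c) ^ 3 = blowUp v 0 r (c • x) ^ 2 / c ^ 3 := by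
  rw [blowUp, zero_add, smul_smul, div_pow, rpow_three_halves_sq hr.le, mul_pow, div_div]

theorem blowUp_limit_sq_div_eq (h : IsLocalSolution L R C δ K v G) {r : ℕ → ℝ}
    (hr : ∀ m, 0 < r m) (hr0 : Tendsto r atTop (𝓝 0)) {w : Euc d → ℝ} (hw : Continuous w)
    (hlim : ∀ x, Tendsto (fun m => blowUp v 0 (r m) x) atTop (𝓝 (w x))) {a b : ℝ} (ha : 0 < a)
    (hab : a < b) (z : sphere (0 : Euc d) 1) :
    w (b • (z : Euc d)) ^ 2 / b ^ 3 = w (a • (z : Euc d)) ^ 2 / a ^ 3 := by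
  have hb : 0 < b := ha.trans hab
  have hC := h.growth_nonneg
  set S : Measure (sphere (0 : Euc d) 1) := (volume : Measure (Euc d)).toSphere with hS
  set f : sphere (0 : Euc d) 1 → ℝ := fun z =>
    |w (b • (z : Euc d)) ^ 2 / b ^ 3 - w (a • (z : Euc d)) ^ 2 / a ^ 3| with hf
  have hfc : Continuous f := by fun_prop
  set φ : ℕ → sphere (0 : Euc d) 1 → ℝ := fun m z =>
    |v ((r m * b) • (z : Euc d)) ^ 2 / (r m * b) ^ 3 -
      v ((r m * a) • (z : Euc d)) ^ 2 / (r m * a) ^ 3| with hφ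
  have hrb : Tendsto (fun m => r m * b) atTop (𝓝 0) := by simpa using hr0.mul_const b
  have hev : ∀ᶠ m in atTop, r m * b < R := hrb.eventually_lt_const h.radius_pos
  have hcv : ∀ s, 0 < s → s < R → Continuous fun z : sphere (0 : Euc d) 1 =>
      v (s • (z : Euc d)) ^ 2 / s ^ 3 := fun s hs hsR =>
    ((h.continuousOn.comp_continuous (by fun_prop) fun z =>
      (smul_sphere_mem hs z le_rfl hsR).1).pow 2).div_const _
  have hint : Tendsto (fun m => ∫ z, φ m z ∂S) atTop (𝓝 (∫ z, f z ∂S)) := by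
    refine tendsto_integral_filter_of_dominated_convergence (fun _ => C) ?_ ?_
      (integrable_const _) ?_
    · filter_upwards [hev] with m hm
      have hm' : r m * a < R := (mul_lt_mul_of_pos_left hab (hr m)).trans hm
      exact ((hcv _ (mul_pos (hr m) hb) hm).sub
        (hcv _ (mul_pos (hr m) ha) hm')).abs.aestronglyMeasurable
    · filter_upwards [hev] with m hm
      refine Eventually.of_forall fun z => ?_
      have hm' : r m * a < R := (mul_lt_mul_of_pos_left hab (hr m)).trans hm
      have pa := mul_pos (hr m) ha
      have pb := mul_pos (hr m) hb
      have h1 := h.sq_div_le pb hm z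
      have h2 := h.sq_div_le pa hm' z
      have h3 : 0 ≤ v ((r m * b) • (z : Euc d)) ^ 2 / (r m * b) ^ 3 := by positivity
      have h4 : 0 ≤ v ((r m * a) • (z : Euc d)) ^ 2 / (r m * a) ^ 3 := by positivity
      rw [Real.norm_eq_abs, abs_abs, abs_le]
      constructor <;> linarith
    · refine Eventually.of_forall fun z => ?_
      simp only [hφ, blowUp_sq_div (hr _)]
      exact ((((hlim _).pow 2).div_const _).sub (((hlim _).pow 2).div_const _)).abs
  set A := C * (b / a) ^ (d + 1) * volume.real (ball (0 : Euc d) 1) with hA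
  have hA0 : 0 ≤ A := by positivity
  have hD := h.tendsto_homogeneityDefect hr hr0 ha hab
  have hle : ∀ τ, 0 < τ → ∫ z, f z ∂S ≤ τ * A := fun τ hτ => by
    have hup : Tendsto (fun m => τ * A + τ⁻¹ * homogeneityDefect v G (r m * a) (r m * b)) atTop
        (𝓝 (τ * A)) := by simpa using (hD.const_mul τ⁻¹).const_add (τ * A)
    refine le_of_tendsto_of_tendsto hint hup ?_
    filter_upwards [hev] with m hm
    have := h.integral_sphere_sub_le (mul_pos (hr m) ha) (mul_lt_mul_of_pos_left hab (hr m)) hm hτ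
    rwa [mul_div_mul_left _ _ (hr m).ne'] at this
  have hzero : ∫ z, f z ∂S = 0 := by
    refine le_antisymm ?_ (integral_nonneg fun z => abs_nonneg _)
    refine le_of_forall_pos_le_add fun ε hε => ?_
    refine (hle (ε / (A + 1)) (by positivity)).trans ?_
    rw [zero_add, div_mul_eq_mul_div, div_le_iff₀ (by positivity)]
    nlinarith
  have hae := (integral_eq_zero_iff_of_nonneg (fun z => abs_nonneg _)
    (hfc.integrable_of_hasCompactSupport (HasCompactSupport.of_compactSpace _))).1 hzero
  have heq : f = 0 := Continuous.ae_eq_iff_eq S hfc continuous_zero |>.1 hae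
  exact sub_eq_zero.1 (abs_eq_zero.1 (congrFun heq z))

theorem blowUp_limit_homogeneous (h : IsLocalSolution L R C δ K v G) {r : ℕ → ℝ}
    (hr : ∀ m, 0 < r m) (hr0 : Tendsto r atTop (𝓝 0)) {w : Euc d → ℝ} (hw : Continuous w)
    (hlim : ∀ x, Tendsto (fun m => blowUp v 0 (r m) x) atTop (𝓝 (w x))) {c : ℝ} (hc : 0 < c)
    (x : Euc d) : w (c • x) = c ^ (3 / 2 : ℝ) * w x := by
  have hw0 : ∀ x, 0 ≤ w x := fun x => by
    refine ge_of_tendsto (hlim x) ?_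
    have hlim0 : Tendsto (fun m => 0 + r m • x) atTop (𝓝 0) := by
      simpa using hr0.smul_const x
    filter_upwards [hlim0 (ball_mem_nhds _ h.radius_pos)] with m hm
    exact div_nonneg (h.nonneg _ hm) (Real.rpow_nonneg (hr m).le _)
  have hsq : ∀ {c : ℝ}, 1 < c → ∀ {x : Euc d}, x ≠ 0 → w (c • x) ^ 2 = c ^ 3 * w x ^ 2 := by
    intro c hc x hx
    have hn : 0 < ‖x‖ := norm_pos_iff.2 hx
    have hz : ‖x‖⁻¹ • x ∈ sphere (0 : Euc d) 1 := by
      rw [mem_sphere_zero_iff_norm, norm_smul, norm_inv, norm_norm, inv_mul_cancel₀ hn.ne']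
    have := h.blowUp_limit_sq_div_eq hr hr0 hw hlim hn (lt_mul_left hn hc) ⟨_, hz⟩
    simp only [smul_smul, mul_assoc, mul_inv_cancel₀ hn.ne', mul_one, one_smul] at this
    rw [mul_pow] at this
    field_simp at this
    linarith
  have hfin : ∀ {c : ℝ}, 0 < c → ∀ {x : Euc d}, w (c • x) ^ 2 = c ^ 3 * w x ^ 2 →
      w (c • x) = c ^ (3 / 2 : ℝ) * w x := fun {c} hc {x} he => by
    have hcp := Real.rpow_nonneg hc.le (3 / 2)
    rw [← rpow_three_halves_sq hc.le, ← mul_pow] at he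
    exact (pow_left_inj₀ (hw0 _) (mul_nonneg hcp (hw0 _)) two_ne_zero).1 he
  apply hfin hc
  rcases eq_or_ne x 0 with rfl | hx
  · have : w 0 = 0 := by
      refine tendsto_nhds_unique (hlim 0) ?_
      simp [blowUp, h.apply_zero]
    simp [this]
  · rcases lt_trichotomy c 1 with h1 | rfl | h1
    · have := hsq ((one_lt_inv₀ hc).2 h1) (smul_ne_zero hc.ne' hx)
      rw [inv_smul_smul₀ hc.ne'] at this
      rw [this]
      field_simp
    · simp
    · exact hsq h1 hx

end IsLocalSolution

section LipschitzCompactness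

variable {d : ℕ} {v : ℕ → Euc d → ℝ} {u₀ : Euc d → ℝ} {Λ : ℝ → ℝ}

theorem continuousOn_of_abs_sub_le {f : Euc d → ℝ} {s : Set (Euc d)} {M : ℝ}
    (h : ∀ x ∈ s, ∀ y ∈ s, |f x - f y| ≤ M * ‖x - y‖) : ContinuousOn f s := by
  have : LipschitzOnWith M.toNNReal f s := LipschitzOnWith.of_dist_le_mul fun x hx y hy => by
    rw [Real.dist_eq, dist_eq_norm]
    exact (h x hx y hy).trans (mul_le_mul_of_nonneg_right (Real.le_coe_toNNReal M) (norm_nonneg _))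
  exact this.continuousOn

theorem memLp_two_of_bound {E : Type*} [NormedAddCommGroup E] {s : Set (Euc d)} (hs : volume s ≠ ⊤)
    {f : Euc d → E} (hf : AEStronglyMeasurable f (volume.restrict s)) {M : ℝ}
    (hM : ∀ᵐ x ∂(volume.restrict s), ‖f x‖ ≤ M) : MemLp f 2 (volume.restrict s) := by
  have : IsFiniteMeasure (volume.restrict s) := ⟨by simpa using hs.lt_top⟩
  exact MemLp.of_bound hf M hM

theorem abs_le_of_abs_sub_le {N : ℝ} (hN : 0 < N) {f : Euc d → ℝ} {M : ℝ} (hM : 0 ≤ M)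
    (h0 : f 0 = 0) (h : ∀ x ∈ ball (0 : Euc d) N, ∀ y ∈ ball (0 : Euc d) N,
      |f x - f y| ≤ M * ‖x - y‖) {x : Euc d} (hx : x ∈ ball 0 N) : |f x| ≤ M * N := by
  have := h x hx 0 (mem_ball_self hN)
  rw [h0, sub_zero, sub_zero] at this
  exact this.trans (mul_le_mul_of_nonneg_left (mem_ball_zero_iff.1 hx).le hM)

theorem cauchySeq_of_tendsto_integral (hΛ : ∀ N, 0 ≤ Λ N) (h0 : ∀ m, v m 0 = 0)
    (hLip : ∀ N, 0 < N → ∀ᶠ m in atTop, ∀ x ∈ ball (0 : Euc d) N, ∀ y ∈ ball (0 : Euc d) N,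
      |v m x - v m y| ≤ Λ N * ‖x - y‖)
    (hweak : ∀ N, 0 < N → ∀ f : Euc d → ℝ, MemLp f 2 (volume.restrict (ball 0 N)) →
      Tendsto (fun m => ∫ x in ball 0 N, v m x * f x) atTop (𝓝 (∫ x in ball 0 N, u₀ x * f x)))
    (x : Euc d) : CauchySeq fun m => v m x := by
  rw [Metric.cauchySeq_iff']
  intro ε hε
  set N := ‖x‖ + 1 with hN
  have hN0 : 0 < N := by positivity
  set s := min 1 (ε / (8 * (Λ N + 1))) with hs
  have hΛN := hΛ N
  have hs0 : 0 < s := lt_min one_pos (by positivity)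
  have hsε : Λ N * s ≤ ε / 8 := by
    have : s ≤ ε / (8 * (Λ N + 1)) := min_le_right _ _
    rw [le_div_iff₀ (by positivity)] at this
    nlinarith
  have hsub : ball x s ⊆ ball 0 N := fun y hy => by
    rw [mem_ball_zero_iff]
    have h1 : ‖y - x‖ < s := by rwa [mem_ball_iff_norm] at hy
    have h2 : ‖y‖ ≤ ‖x‖ + ‖y - x‖ := by simpa using norm_add_le x (y - x)
    have : s ≤ 1 := min_le_left _ _
    rw [hN]; linarith
  have hB0 : 0 < volume.real (ball x s) := ENNReal.toReal_pos (measure_ball_pos _ _ hs0).ne' measure_ball_lt_top.ne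
  have hmem : MemLp ((ball x s).indicator fun _ => (volume.real (ball x s))⁻¹) 2
      (volume.restrict (ball 0 N)) :=
    memLp_two_of_bound measure_ball_lt_top.ne
      ((measurable_const.indicator measurableSet_ball).aestronglyMeasurable)
      (M := (volume.real (ball x s))⁻¹) (Eventually.of_forall fun y => by
        rw [Real.norm_eq_abs]
        by_cases hy : y ∈ ball x s
        · rw [indicator_of_mem hy, abs_of_pos (by positivity)]
        · rw [indicator_of_notMem hy, abs_zero]; positivity)
  have hc := (hweak N hN0 _ hmem).cauchySeq
  rw [Metric.cauchySeq_iff'] at hc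
  obtain ⟨M₁, hM₁⟩ := hc (ε / 4) (by positivity)
  obtain ⟨M₂, hM₂⟩ := eventually_atTop.1 (hLip N hN0)
  have hav : ∀ m, M₂ ≤ m → |(∫ y in ball 0 N, v m y * (ball x s).indicator
      (fun _ => (volume.real (ball x s))⁻¹) y) - v m x| ≤ ε / 8 := fun m hm => by
    have hl := hM₂ m hm
    have hco := continuousOn_of_abs_sub_le hl
    have hi : IntegrableOn (v m) (ball x s) := by
      refine IntegrableOn.of_bound measure_ball_lt_top
        ((hco.mono hsub).aestronglyMeasurable measurableSet_ball) (Λ N * N) ?_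
      filter_upwards [ae_restrict_mem measurableSet_ball] with y hy
      exact abs_le_of_abs_sub_le hN0 hΛN (h0 m) hl (hsub hy)
    have e : ∀ y, v m y * (ball x s).indicator (fun _ => (volume.real (ball x s))⁻¹) y =
        (ball x s).indicator (fun y => v m y * (volume.real (ball x s))⁻¹) y := fun y => by
      by_cases hy : y ∈ ball x s <;> simp [hy]
    simp_rw [e]
    rw [setIntegral_indicator measurableSet_ball, inter_eq_self_of_subset_right hsub,
      integral_mul_const]
    have e2 : v m x = (∫ y in ball x s, v m x) * (volume.real (ball x s))⁻¹ := by
      rw [setIntegral_const, smul_eq_mul]; field_simp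
    conv_lhs => rw [e2]
    rw [← sub_mul, ← integral_sub hi (integrableOn_const measure_ball_lt_top.ne), abs_mul,
      abs_of_pos (inv_pos.2 hB0), ← Real.norm_eq_abs, ← div_eq_mul_inv, div_le_iff₀ hB0]
    refine norm_setIntegral_le_of_norm_le_const measure_ball_lt_top fun y hy => ?_
    refine (hl y (hsub hy) x (hsub (mem_ball_self hs0))).trans (le_trans ?_ hsε)
    rw [mem_ball_iff_norm] at hy
    exact mul_le_mul_of_nonneg_left hy.le hΛN
  refine ⟨max M₁ M₂, fun m hm => ?_⟩
  have a1 := abs_le.1 (hav m ((le_max_right _ _).trans hm))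
  have a2 := abs_le.1 (hav _ (le_max_right M₁ M₂))
  have a3 := hM₁ m ((le_max_left _ _).trans hm)
  have a4 := hM₁ _ (le_max_left M₁ M₂)
  rw [Real.dist_eq, abs_lt] at *
  constructor <;> linarith [a1.1, a1.2, a2.1, a2.2, a3.1, a3.2, a4.1, a4.2]

theorem exists_continuous_limit (hΛ : ∀ N, 0 ≤ Λ N) (h0 : ∀ m, v m 0 = 0)
    (hLip : ∀ N, 0 < N → ∀ᶠ m in atTop, ∀ x ∈ ball (0 : Euc d) N, ∀ y ∈ ball (0 : Euc d) N,
      |v m x - v m y| ≤ Λ N * ‖x - y‖)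
    (hweak : ∀ N, 0 < N → ∀ f : Euc d → ℝ, MemLp f 2 (volume.restrict (ball 0 N)) →
      Tendsto (fun m => ∫ x in ball 0 N, v m x * f x) atTop (𝓝 (∫ x in ball 0 N, u₀ x * f x)))
    (hu₀ : ∀ A : Set (Euc d), IsCompact A → MemLp u₀ 2 (volume.restrict A)) :
    ∃ w : Euc d → ℝ, Continuous w ∧ u₀ =ᵐ[volume] w ∧
      (∀ x, Tendsto (fun m => v m x) atTop (𝓝 (w x))) ∧
      (∀ N, 0 < N → ∀ x ∈ ball (0 : Euc d) N, ∀ y ∈ ball (0 : Euc d) N,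
        |w x - w y| ≤ Λ N * ‖x - y‖) ∧
      ∀ N, TendstoUniformlyOn v w atTop (closedBall 0 N) := by
  choose w hw using fun x =>
    cauchySeq_tendsto_of_complete (cauchySeq_of_tendsto_integral hΛ h0 hLip hweak x)
  have hwL : ∀ N, 0 < N → ∀ x ∈ ball (0 : Euc d) N, ∀ y ∈ ball (0 : Euc d) N,
      |w x - w y| ≤ Λ N * ‖x - y‖ := fun N hN x hx y hy => by
    refine le_of_tendsto ((hw x).sub (hw y)).abs ?_
    filter_upwards [hLip N hN] with m hm using hm x hx y hy
  have hwc : Continuous w := continuous_iff_continuousAt.2 fun x =>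
    (continuousOn_of_abs_sub_le (hwL (‖x‖ + 1) (by positivity))).continuousAt
      (isOpen_ball.mem_nhds (by simp))
  refine ⟨w, hwc, ?_, hw, hwL, fun N => ?_⟩
  · refine ae_eq_of_integral_contDiff_smul_eq ?_ hwc.locallyIntegrable fun g hg hgc => ?_
    · rw [locallyIntegrable_iff]
      intro A hA
      have : IsFiniteMeasure (volume.restrict A) := ⟨by simpa using hA.measure_lt_top⟩
      exact (hu₀ A hA).integrable one_le_two
    · obtain ⟨N, hN0, hN⟩ : ∃ N, 0 < N ∧ tsupport g ⊆ ball (0 : Euc d) N := by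
        obtain ⟨N, hN⟩ := hgc.isCompact.isBounded.subset_ball 0
        exact ⟨max N 1, by positivity, hN.trans (ball_subset_ball (le_max_left _ _))⟩
      have hres : ∀ f : Euc d → ℝ, ∫ x, g x • f x = ∫ x in ball (0 : Euc d) N, f x * g x := by
        intro f
        rw [← integral_indicator measurableSet_ball]
        refine integral_congr_ae (Eventually.of_forall fun x => ?_)
        by_cases hx : x ∈ ball (0 : Euc d) N
        · simp only [indicator_of_mem hx, smul_eq_mul, mul_comm]
        · simp only [indicator_of_notMem hx]
          rw [image_eq_zero_of_notMem_tsupport fun h => hx (hN h), zero_smul]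
      rw [hres, hres]
      obtain ⟨M, hM⟩ := hg.continuous.bounded_above_of_compact_support hgc
      refine tendsto_nhds_unique (hweak N hN0 g (memLp_two_of_bound measure_ball_lt_top.ne
        hg.continuous.aestronglyMeasurable (Eventually.of_forall hM))) ?_
      refine tendsto_integral_filter_of_dominated_convergence (fun _ => Λ N * N * M) ?_ ?_
        (integrableOn_const measure_ball_lt_top.ne) (Eventually.of_forall fun x =>
          (hw x).mul_const _)
      · filter_upwards [hLip N hN0] with m hm
        exact ((continuousOn_of_abs_sub_le hm).mul hg.continuous.continuousOn).aestronglyMeasurable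
          measurableSet_ball
      · filter_upwards [hLip N hN0] with m hm
        filter_upwards [ae_restrict_mem measurableSet_ball] with x hx
        rw [norm_mul]
        exact mul_le_mul (abs_le_of_abs_sub_le hN0 (hΛ N) (h0 m) hm hx) (hM x) (norm_nonneg _)
          (mul_nonneg (hΛ N) hN0.le)
  · refine (tendstoLocallyUniformlyOn_iff_tendstoUniformlyOn_of_compact
      (isCompact_closedBall _ _)).1 ?_
    rw [Metric.tendstoLocallyUniformlyOn_iff]
    intro ε hε x hx
    set N' := ‖x‖ + 1
    have hN' : 0 < N' := by positivity
    have hΛN := hΛ N'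
    set s := min 1 (ε / (4 * (Λ N' + 1))) with hs
    have hs0 : 0 < s := lt_min one_pos (by positivity)
    have hsε : Λ N' * s ≤ ε / 4 := by
      have : s ≤ ε / (4 * (Λ N' + 1)) := min_le_right _ _
      rw [le_div_iff₀ (by positivity)] at this
      nlinarith
    refine ⟨ball x s, mem_nhdsWithin_of_mem_nhds (ball_mem_nhds _ hs0), ?_⟩
    have hxN : x ∈ ball (0 : Euc d) N' := by simp [N']
    filter_upwards [hLip N' hN', Metric.tendsto_nhds.1 (hw x) (ε / 4) (by positivity)]
      with m hm hmx y hy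
    have hys : ‖y - x‖ < s := by rwa [mem_ball_iff_norm] at hy
    have hyN : y ∈ ball (0 : Euc d) N' := by
      rw [mem_ball_zero_iff]
      have h2 : ‖y‖ ≤ ‖x‖ + ‖y - x‖ := by simpa using norm_add_le x (y - x)
      have : s ≤ 1 := min_le_left _ _
      simp only [N']; linarith
    have b : Λ N' * ‖y - x‖ ≤ ε / 4 := (mul_le_mul_of_nonneg_left hys.le hΛN).trans hsε
    have a1 := abs_le.1 ((hm y hyN x hxN).trans b)
    have a2 := abs_le.1 ((hwL N' hN' y hyN x hxN).trans b)
    rw [Real.dist_eq] at *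
    have a3 := abs_lt.1 hmx
    rw [abs_lt]
    constructor <;> linarith [a1.1, a1.2, a2.1, a2.2, a3.1, a3.2]

end LipschitzCompactness

section WeakStrong

variable {E : Type*} [NormedAddCommGroup E] [InnerProductSpace ℝ E] {α : Type*}
  [MeasurableSpace α] {μ : Measure α} {G f : ℕ → α → E} {D f₀ : α → E} {g : α → ℝ} {Λ : ℝ}

theorem integrable_inner_of_norm_le {u f : α → E} (hu : AEStronglyMeasurable u μ)
    (hΛ : ∀ᵐ x ∂μ, ‖u x‖ ≤ Λ) (hf : AEStronglyMeasurable f μ) (hg : Integrable g μ)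
    (hb : ∀ᵐ x ∂μ, ‖f x‖ ≤ g x) : Integrable (fun x => inner ℝ (u x) (f x)) μ := by
  refine Integrable.mono' (hg.const_mul Λ) (hu.inner hf) ?_
  filter_upwards [hΛ, hb] with x h1 h2
  exact (norm_inner_le_norm _ _).trans
    (mul_le_mul h1 h2 (norm_nonneg _) ((norm_nonneg _).trans h1))

theorem integrable_inner_of_memLp {u f : α → E} (hu : MemLp u 2 μ) (hf : MemLp f 2 μ) :
    Integrable (fun x => inner ℝ (u x) (f x)) μ := by
  refine Integrable.mono' (hu.norm.integrable_mul hf.norm)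
    (hu.aestronglyMeasurable.inner hf.aestronglyMeasurable) (Eventually.of_forall fun x => ?_)
  exact norm_inner_le_norm _ _

/-- The pairing of a bounded weakly convergent sequence with a dominated pointwise convergent
sequence converges. -/
theorem tendsto_integral_inner (hGm : ∀ᶠ m in atTop, AEStronglyMeasurable (G m) μ)
    (hGΛ : ∀ᶠ m in atTop, ∀ᵐ x ∂μ, ‖G m x‖ ≤ Λ)
    (hweak : Tendsto (fun m => ∫ x, inner ℝ (G m x) (f₀ x) ∂μ) atTop
      (𝓝 (∫ x, inner ℝ (D x) (f₀ x) ∂μ)))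
    (hfm : ∀ᶠ m in atTop, AEStronglyMeasurable (f m) μ) (hf₀ : AEStronglyMeasurable f₀ μ)
    (hg : Integrable g μ) (hb : ∀ᶠ m in atTop, ∀ᵐ x ∂μ, ‖f m x‖ ≤ g x)
    (hb₀ : ∀ᵐ x ∂μ, ‖f₀ x‖ ≤ g x)
    (hlim : ∀ᵐ x ∂μ, Tendsto (fun m => f m x) atTop (𝓝 (f₀ x))) :
    Tendsto (fun m => ∫ x, inner ℝ (G m x) (f m x) ∂μ) atTop
      (𝓝 (∫ x, inner ℝ (D x) (f₀ x) ∂μ)) := by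
  have h1 : Tendsto (fun m => ∫ x, Λ * ‖f m x - f₀ x‖ ∂μ) atTop (𝓝 (∫ _, 0 ∂μ)) := by
    refine tendsto_integral_filter_of_dominated_convergence (fun x => |Λ| * (g x + g x)) ?_ ?_
      ((hg.add hg).const_mul _) ?_
    · filter_upwards [hfm] with m hm using (hm.sub hf₀).norm.const_mul _
    · filter_upwards [hb] with m hm
      filter_upwards [hm, hb₀] with x h1 h2
      rw [norm_mul, norm_norm, Real.norm_eq_abs]
      exact mul_le_mul_of_nonneg_left ((norm_sub_le _ _).trans (add_le_add h1 h2)) (abs_nonneg _)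
    · filter_upwards [hlim] with x hx
      have := (hx.sub_const (f₀ x)).norm.const_mul Λ
      simpa using this
  rw [integral_zero] at h1
  have h2 : Tendsto (fun m => (∫ x, inner ℝ (G m x) (f m x) ∂μ) -
      ∫ x, inner ℝ (G m x) (f₀ x) ∂μ) atTop (𝓝 0) := by
    refine squeeze_zero_norm' ?_ h1
    filter_upwards [hGm, hGΛ, hfm, hb] with m h3 h4 h5 h6
    rw [← integral_sub (integrable_inner_of_norm_le h3 h4 h5 hg h6)
      (integrable_inner_of_norm_le h3 h4 hf₀ hg hb₀)]
    refine norm_integral_le_of_norm_le (Integrable.const_mul (Integrable.mono' (hg.add hg)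
      (h5.sub hf₀).norm ?_) _) ?_
    · filter_upwards [h6, hb₀] with x h7 h8
      rw [norm_norm]
      exact (norm_sub_le _ _).trans (add_le_add h7 h8)
    · filter_upwards [h4] with x h7
      rw [← inner_sub_right]
      exact (norm_inner_le_norm _ _).trans (mul_le_mul_of_nonneg_right h7 (norm_nonneg _))
  simpa using h2.add hweak

theorem tendsto_integral_inner_of_norm_sub_le {B : ℕ → α → E} {ε : ℕ → ℝ}
    (hε : Tendsto ε atTop (𝓝 0)) (hGm : ∀ᶠ m in atTop, AEStronglyMeasurable (G m) μ)
    (hGΛ : ∀ᶠ m in atTop, ∀ᵐ x ∂μ, ‖G m x‖ ≤ Λ)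
    (hBm : ∀ᶠ m in atTop, AEStronglyMeasurable (B m) μ)
    (hBG : ∀ᶠ m in atTop, ∀ᵐ x ∂μ, ‖B m x - G m x‖ ≤ ε m)
    (hfm : ∀ᶠ m in atTop, AEStronglyMeasurable (f m) μ)
    (hg : Integrable g μ) (hb : ∀ᶠ m in atTop, ∀ᵐ x ∂μ, ‖f m x‖ ≤ g x) :
    Tendsto (fun m => (∫ x, inner ℝ (B m x) (f m x) ∂μ) - ∫ x, inner ℝ (G m x) (f m x) ∂μ)
      atTop (𝓝 0) := by
  have h1 : Tendsto (fun m => ε m * ∫ x, g x ∂μ) atTop (𝓝 0) := by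
    simpa using hε.mul_const (∫ x, g x ∂μ)
  refine squeeze_zero_norm' ?_ h1
  filter_upwards [hGm, hGΛ, hBm, hBG, hfm, hb] with m h2 h3 h4 h5 h6 h7
  have h8 : ∀ᵐ x ∂μ, ‖B m x‖ ≤ ε m + Λ := by
    filter_upwards [h3, h5] with x h9 h10
    have := norm_add_le (B m x - G m x) (G m x)
    rw [sub_add_cancel] at this
    linarith
  rw [← integral_sub (integrable_inner_of_norm_le h4 h8 h6 hg h7)
    (integrable_inner_of_norm_le h2 h3 h6 hg h7), ← integral_const_mul]
  refine norm_integral_le_of_norm_le (hg.const_mul _) ?_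
  filter_upwards [h5, h7] with x h9 h10
  rw [← inner_sub_left]
  exact (norm_inner_le_norm _ _).trans
    (mul_le_mul h9 h10 (norm_nonneg _) ((norm_nonneg _).trans h9))

end WeakStrong

/-- An approximate solution in the ball of radius `N`: `B` is a flux which differs from the
gradient `G` of `v` by at most `ε` and is divergence free in `{v > 0}`. -/
structure IsApproxSolution {d : ℕ} (N Λ ε : ℝ) (v : Euc d → ℝ) (G B : Euc d → Euc d) : Prop where
  apply_zero : v 0 = 0
  nonneg : ∀ x ∈ ball (0 : Euc d) N, 0 ≤ v x
  abs_sub_le : ∀ x ∈ ball (0 : Euc d) N, ∀ y ∈ ball (0 : Euc d) N, |v x - v y| ≤ Λ * ‖x - y‖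
  contDiffOn : ContDiffOn ℝ 1 v (ball 0 N ∩ {x | 0 < v x})
  fderiv_eq : ∀ x ∈ ball (0 : Euc d) N, 0 < v x → ∀ y, fderiv ℝ v x y = inner ℝ (G x) y
  norm_le : ∀ x ∈ ball (0 : Euc d) N, ‖G x‖ ≤ Λ
  norm_sub_le : ∀ x ∈ ball (0 : Euc d) N, ‖B x - G x‖ ≤ ε
  aestronglyMeasurable_grad : AEStronglyMeasurable G (volume.restrict (ball 0 N))
  aestronglyMeasurable_flux : AEStronglyMeasurable B (volume.restrict (ball 0 N))
  weak : ∀ ζ : Euc d → ℝ, ContDiff ℝ 1 ζ → HasCompactSupport ζ →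
    tsupport ζ ⊆ ball 0 N ∩ {x | 0 < v x} → ∫ x in ball 0 N, fderiv ℝ ζ x (B x) = 0
  energy : ∀ η : Euc d → ℝ, ContDiff ℝ 1 η → HasCompactSupport η → tsupport η ⊆ ball 0 N →
    ∫ x in ball 0 N, (η x * inner ℝ (B x) (G x) + v x * fderiv ℝ η x (B x)) = 0

section StrongConvergence

variable {d : ℕ} {N Λ : ℝ} {ε : ℕ → ℝ} {v : ℕ → Euc d → ℝ} {G B : ℕ → Euc d → Euc d}
  {w : Euc d → ℝ} {D : Euc d → Euc d}

theorem IsApproxSolution.abs_le {ε : ℝ} {v : Euc d → ℝ} {G B : Euc d → Euc d}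
    (h : IsApproxSolution N Λ ε v G B) (hN : 0 < N) (hΛ : 0 ≤ Λ) {x : Euc d} (hx : x ∈ ball 0 N) :
    |v x| ≤ Λ * N :=
  abs_le_of_abs_sub_le hN hΛ h.apply_zero h.abs_sub_le hx

theorem IsApproxSolution.continuousOn {ε : ℝ} {v : Euc d → ℝ} {G B : Euc d → Euc d}
    (h : IsApproxSolution N Λ ε v G B) : ContinuousOn v (ball 0 N) :=
  continuousOn_of_abs_sub_le h.abs_sub_le

theorem inner_gradient (η : Euc d → ℝ) (x y : Euc d) :
    inner ℝ y (gradient η x) = fderiv ℝ η x y := by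
  rw [real_inner_comm]
  exact InnerProductSpace.toDual_symm_apply

theorem continuous_gradient {η : Euc d → ℝ} (hη : ContDiff ℝ 1 η) : Continuous (gradient η) :=
  (InnerProductSpace.toDual ℝ (Euc d)).symm.continuous.comp (hη.continuous_fderiv one_ne_zero)

theorem exists_norm_gradient_le {η : Euc d → ℝ} (hη : ContDiff ℝ 1 η)
    (hηc : HasCompactSupport η) : ∃ M, ∀ x, ‖gradient η x‖ ≤ M := by
  obtain ⟨M, hM⟩ := (hηc.fderiv (𝕜 := ℝ)).exists_bound_of_continuous
    (hη.continuous_fderiv one_ne_zero)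
  exact ⟨M, fun x => ((InnerProductSpace.toDual ℝ (Euc d)).symm.norm_map _).trans_le (hM x)⟩

theorem IsApproxSolution.fderiv_ramp_mul {ε τ : ℝ} {v η : Euc d → ℝ} {G B : Euc d → Euc d}
    (h : IsApproxSolution N Λ ε v G B) (hτ : 0 < τ) (hη : ContDiff ℝ 1 η)
    (hηN : tsupport η ⊆ ball 0 N) {x : Euc d} (hx : x ∈ ball 0 N) (y : Euc d) :
    fderiv ℝ (fun x => ramp τ (v x) * η x) x y =
      inner ℝ y ((rampDeriv τ (v x) * η x) • G x + ramp τ (v x) • gradient η x) := by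
  rw [(hasFDerivAt_ramp_mul isOpen_ball h.continuousOn h.contDiffOn hτ hη hηN x).fderiv,
    inner_add_right, inner_smul_right, inner_smul_right, inner_gradient]
  rcases le_or_gt (v x) τ with h1 | h1
  · simp [rampDeriv_eq_zero hτ h1]
  · simp [h.fderiv_eq x hx (hτ.trans h1), real_inner_comm]

/-- A sequence of approximate solutions converging weakly to `w`, with gradient `D`. -/
structure IsApproxSequence {d : ℕ} (N Λ : ℝ) (ε : ℕ → ℝ) (v : ℕ → Euc d → ℝ)
    (G B : ℕ → Euc d → Euc d) (w : Euc d → ℝ) (D : Euc d → Euc d) : Prop where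
  radius_pos : 0 < N
  bound_nonneg : 0 ≤ Λ
  tendsto_zero : Tendsto ε atTop (𝓝 0)
  approx : ∀ᶠ m in atTop, IsApproxSolution N Λ (ε m) (v m) (G m) (B m)
  memLp : MemLp D 2 (volume.restrict (ball 0 N))
  weak_grad : ∀ f : Euc d → Euc d, MemLp f 2 (volume.restrict (ball 0 N)) →
    Tendsto (fun m => ∫ x in ball 0 N, inner ℝ (G m x) (f x)) atTop
      (𝓝 (∫ x in ball 0 N, inner ℝ (D x) (f x)))
  uniform : TendstoUniformlyOn v w atTop (ball 0 N)

namespace IsApproxSequence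

theorem isFiniteMeasure_restrict_ball (N : ℝ) :
    IsFiniteMeasure (volume.restrict (ball (0 : Euc d) N)) :=
  ⟨by simpa using measure_ball_lt_top⟩

theorem meas_grad (h : IsApproxSequence N Λ ε v G B w D) :
    ∀ᶠ m in atTop, AEStronglyMeasurable (G m) (volume.restrict (ball 0 N)) :=
  h.approx.mono fun _ hm => hm.aestronglyMeasurable_grad

theorem meas_flux (h : IsApproxSequence N Λ ε v G B w D) :
    ∀ᶠ m in atTop, AEStronglyMeasurable (B m) (volume.restrict (ball 0 N)) :=
  h.approx.mono fun _ hm => hm.aestronglyMeasurable_flux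

theorem norm_grad_le (h : IsApproxSequence N Λ ε v G B w D) :
    ∀ᶠ m in atTop, ∀ᵐ x ∂(volume.restrict (ball (0 : Euc d) N)), ‖G m x‖ ≤ Λ :=
  h.approx.mono fun _ hm => (ae_restrict_mem measurableSet_ball).mono hm.norm_le

theorem norm_sub_le (h : IsApproxSequence N Λ ε v G B w D) :
    ∀ᶠ m in atTop, ∀ᵐ x ∂(volume.restrict (ball (0 : Euc d) N)), ‖B m x - G m x‖ ≤ ε m :=
  h.approx.mono fun _ hm => (ae_restrict_mem measurableSet_ball).mono hm.norm_sub_le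

theorem norm_flux_le (h : IsApproxSequence N Λ ε v G B w D) :
    ∀ᶠ m in atTop, ∀ᵐ x ∂(volume.restrict (ball (0 : Euc d) N)), ‖B m x‖ ≤ Λ + 1 := by
  filter_upwards [h.norm_grad_le, h.norm_sub_le, h.tendsto_zero.eventually_le_const one_pos]
    with m h1 h2 h3
  filter_upwards [h1, h2] with x h4 h5
  have := norm_add_le (B m x - G m x) (G m x)
  rw [sub_add_cancel] at this
  linarith

theorem integrable_norm_limit (h : IsApproxSequence N Λ ε v G B w D) :
    Integrable (fun x => ‖D x‖) (volume.restrict (ball (0 : Euc d) N)) :=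
  have := isFiniteMeasure_restrict_ball (d := d) N
  (h.memLp.integrable one_le_two).norm

theorem tendsto_flux (h : IsApproxSequence N Λ ε v G B w D) (f : Euc d → Euc d)
    (hf : MemLp f 2 (volume.restrict (ball 0 N))) :
    Tendsto (fun m => ∫ x in ball 0 N, inner ℝ (B m x) (f x)) atTop
      (𝓝 (∫ x in ball 0 N, inner ℝ (D x) (f x))) := by
  have := isFiniteMeasure_restrict_ball (d := d) N
  have h1 := tendsto_integral_inner_of_norm_sub_le (f := fun _ => f) (g := fun x => ‖f x‖)
    h.tendsto_zero h.meas_grad h.norm_grad_le h.meas_flux h.norm_sub_le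
    (Eventually.of_forall fun _ => hf.aestronglyMeasurable) (hf.integrable one_le_two).norm
    (Eventually.of_forall fun _ => Eventually.of_forall fun _ => le_rfl)
  simpa using h1.add (h.weak_grad f hf)

theorem tendsto_apply (h : IsApproxSequence N Λ ε v G B w D) {x : Euc d} (hx : x ∈ ball 0 N) :
    Tendsto (fun m => v m x) atTop (𝓝 (w x)) :=
  h.uniform.tendsto_at hx

theorem limit_nonneg (h : IsApproxSequence N Λ ε v G B w D) {x : Euc d} (hx : x ∈ ball 0 N) :
    0 ≤ w x :=
  ge_of_tendsto (h.tendsto_apply hx) (h.approx.mono fun _ hm => hm.nonneg x hx)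

theorem limit_abs_le (h : IsApproxSequence N Λ ε v G B w D) {x : Euc d} (hx : x ∈ ball 0 N) :
    |w x| ≤ Λ * N :=
  le_of_tendsto (h.tendsto_apply hx).abs
    (h.approx.mono fun _ hm => hm.abs_le h.radius_pos h.bound_nonneg hx)

theorem limit_continuousOn (h : IsApproxSequence N Λ ε v G B w D) :
    ContinuousOn w (ball 0 N) :=
  h.uniform.continuousOn (h.approx.mono fun _ hm => hm.continuousOn).frequently

/-- Convergence of the weighted Dirichlet integrals. -/
theorem tendsto_dirichlet (h : IsApproxSequence N Λ ε v G B w D) {η : Euc d → ℝ}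
    (hη : ContDiff ℝ 1 η) (hηc : HasCompactSupport η) (hηN : tsupport η ⊆ ball 0 N) :
    Tendsto (fun m => ∫ x in ball 0 N, inner ℝ (G m x) (η x • G m x)) atTop
      (𝓝 (-∫ x in ball 0 N, inner ℝ (D x) (w x • gradient η x))) := by
  have := isFiniteMeasure_restrict_ball (d := d) N
  have hN := h.radius_pos
  have hΛ := h.bound_nonneg
  obtain ⟨M, hM⟩ := hηc.exists_bound_of_continuous hη.continuous
  obtain ⟨M', hM'⟩ := exists_norm_gradient_le hη hηc
  have hM0 : 0 ≤ M := (norm_nonneg _).trans (hM 0)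
  have hgc := continuous_gradient hη
  have hmG : ∀ᶠ m in atTop, AEStronglyMeasurable (fun x => η x • G m x)
      (volume.restrict (ball 0 N)) := by
    filter_upwards [h.meas_grad] with m hm using hη.continuous.aestronglyMeasurable.smul hm
  have hbG : ∀ᶠ m in atTop, ∀ᵐ x ∂(volume.restrict (ball (0 : Euc d) N)),
      ‖η x • G m x‖ ≤ M * Λ := by
    filter_upwards [h.norm_grad_le] with m hm
    filter_upwards [hm] with x hx
    rw [norm_smul]
    exact mul_le_mul (hM x) hx (norm_nonneg _) hM0
  have hmv : ∀ᶠ m in atTop, AEStronglyMeasurable (fun x => v m x • gradient η x)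
      (volume.restrict (ball 0 N)) := by
    filter_upwards [h.approx] with m hm
    exact (hm.continuousOn.smul hgc.continuousOn).aestronglyMeasurable measurableSet_ball
  have hbv : ∀ᶠ m in atTop, ∀ᵐ x ∂(volume.restrict (ball (0 : Euc d) N)),
      ‖v m x • gradient η x‖ ≤ Λ * N * M' := by
    filter_upwards [h.approx] with m hm
    filter_upwards [ae_restrict_mem measurableSet_ball] with x hx
    rw [norm_smul]
    exact mul_le_mul (hm.abs_le hN hΛ hx) (hM' x) (norm_nonneg _) (by positivity)
  have hmw : AEStronglyMeasurable (fun x => w x • gradient η x) (volume.restrict (ball 0 N)) :=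
    (h.limit_continuousOn.smul hgc.continuousOn).aestronglyMeasurable measurableSet_ball
  have hbw : ∀ᵐ x ∂(volume.restrict (ball (0 : Euc d) N)), ‖w x • gradient η x‖ ≤ Λ * N * M' := by
    filter_upwards [ae_restrict_mem measurableSet_ball] with x hx
    rw [norm_smul]
    exact mul_le_mul (h.limit_abs_le hx) (hM' x) (norm_nonneg _) (by positivity)
  have h1 := tendsto_integral_inner_of_norm_sub_le (g := fun _ => M * Λ)
    h.tendsto_zero h.meas_grad h.norm_grad_le h.meas_flux h.norm_sub_le hmG
    (integrable_const _) hbG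
  have h2 := tendsto_integral_inner (g := fun _ => Λ * N * M') h.meas_flux h.norm_flux_le
    (h.tendsto_flux _ (MemLp.of_bound hmw _ hbw)) hmv hmw (integrable_const _) hbv hbw
    ((ae_restrict_mem measurableSet_ball).mono fun x hx => (h.tendsto_apply hx).smul_const _)
  have h3 := (h2.neg).sub h1
  rw [sub_zero] at h3
  refine h3.congr' ?_
  filter_upwards [h.approx, hmG, hbG, hmv, hbv, h.meas_flux, h.norm_flux_le]
    with m hm k1 k2 k3 k4 k5 k6
  have h4 := hm.energy η hη hηc hηN
  have h5 := integral_add (integrable_inner_of_norm_le k5 k6 k1 (integrable_const _) k2)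
    (integrable_inner_of_norm_le k5 k6 k3 (integrable_const _) k4)
  have h6 : ∫ x in ball 0 N, (inner ℝ (B m x) (η x • G m x) +
      inner ℝ (B m x) (v m x • gradient η x)) = 0 := by
    rw [← h4]
    refine integral_congr_ae (Eventually.of_forall fun x => ?_)
    simp only [inner_smul_right, inner_gradient]
  rw [h6] at h5
  linarith

theorem integral_rampDeriv_eq_zero (h : IsApproxSequence N Λ ε v G B w D) {η : Euc d → ℝ}
    (hη : ContDiff ℝ 1 η) (hηc : HasCompactSupport η) (hηN : tsupport η ⊆ ball 0 N) {τ : ℝ}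
    (hτ : 0 < τ) :
    ∫ x in ball 0 N, inner ℝ (D x) ((rampDeriv τ (w x) * η x) • D x +
      ramp τ (w x) • gradient η x) = 0 := by
  have := isFiniteMeasure_restrict_ball (d := d) N
  have hN := h.radius_pos
  have hΛ := h.bound_nonneg
  obtain ⟨M, hM⟩ := hηc.exists_bound_of_continuous hη.continuous
  obtain ⟨M', hM'⟩ := exists_norm_gradient_le hη hηc
  have hM0 : 0 ≤ M := (norm_nonneg _).trans (hM 0)
  have hM0' : 0 ≤ M' := (norm_nonneg _).trans (hM' 0)
  have hgc := continuous_gradient hη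
  have hmD := h.memLp.aestronglyMeasurable
  have hrη : ∀ (t : ℝ) (x : Euc d), ‖rampDeriv τ t * η x‖ ≤ M := fun t x => by
    rw [norm_mul, Real.norm_of_nonneg (rampDeriv_nonneg _ _)]
    calc _ ≤ 1 * M := mul_le_mul (rampDeriv_le_one _ _) (hM x) (norm_nonneg _) zero_le_one
      _ = M := one_mul M
  have hrg : ∀ (t : ℝ) (x : Euc d), 0 ≤ t → |t| ≤ Λ * N → ‖ramp τ t • gradient η x‖ ≤
      Λ * N * M' := fun t x ht htN => by
    rw [norm_smul, Real.norm_of_nonneg (ramp_nonneg ht)]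
    exact mul_le_mul ((ramp_le ht).trans ((le_abs_self _).trans htN)) (hM' x) (norm_nonneg _)
      (by positivity)
  have hrc : Continuous (ramp τ) := (contDiff_ramp τ).continuous
  -- the equation for the limiting flux, with a test function built from an approximate solution
  have hflux : ∀ᶠ m in atTop, ∫ x in ball 0 N, inner ℝ (D x) ((rampDeriv τ (v m x) * η x) • G m x +
      ramp τ (v m x) • gradient η x) = 0 := by
    have hclose := Metric.tendstoUniformlyOn_iff.1 h.uniform (τ / 4) (by positivity)
    filter_upwards [h.approx, hclose] with m hm hmc
    set f : Euc d → Euc d := fun x => (rampDeriv τ (v m x) * η x) • G m x +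
      ramp τ (v m x) • gradient η x with hf
    have hf2 : MemLp f 2 (volume.restrict (ball 0 N)) := by
      refine MemLp.of_bound (((((continuous_rampDeriv τ).comp_continuousOn hm.continuousOn).mul
        hη.continuous.continuousOn).aestronglyMeasurable measurableSet_ball).smul
        hm.aestronglyMeasurable_grad |>.add (((hrc.comp_continuousOn hm.continuousOn).smul
        hgc.continuousOn).aestronglyMeasurable measurableSet_ball)) (M * Λ + Λ * N * M') ?_
      filter_upwards [ae_restrict_mem measurableSet_ball] with x hx
      refine (norm_add_le _ _).trans (add_le_add ?_ (hrg _ x (hm.nonneg x hx)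
        (hm.abs_le hN hΛ hx)))
      rw [norm_smul]
      exact mul_le_mul (hrη _ x) (hm.norm_le x hx) (norm_nonneg _) hM0
    refine tendsto_nhds_unique (h.tendsto_flux f hf2) ?_
    refine tendsto_const_nhds.congr' ?_
    filter_upwards [h.approx, hclose] with k hk hkc
    have hts := tsupport_ramp_mul_subset hm.continuousOn hτ hηN
    rw [← hk.weak (fun x => ramp τ (v m x) * η x)
      (contDiff_ramp_mul isOpen_ball hm.continuousOn hm.contDiffOn hτ hη hηN)
      (hηc.mul_left) fun x hx => ?_]
    · exact setIntegral_congr_fun measurableSet_ball fun x hx =>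
        hm.fderiv_ramp_mul hτ hη hηN hx (B k x)
    · have h1 := hts hx
      have h2 := hηN h1.1
      have h3 := abs_lt.1 (hmc x h2)
      have h4 := abs_lt.1 (hkc x h2)
      have h5 : τ ≤ v m x := h1.2
      refine ⟨h2, ?_⟩
      rw [mem_ofPred_eq]
      linarith [h3.1, h4.2]
  have hDm : ∀ m x, inner ℝ (D x) ((rampDeriv τ (v m x) * η x) • G m x +
      ramp τ (v m x) • gradient η x) = inner ℝ (G m x) ((rampDeriv τ (v m x) * η x) • D x) +
      inner ℝ (D x) (ramp τ (v m x) • gradient η x) := fun m x => by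
    rw [inner_add_right, inner_smul_right, inner_smul_right (G m x), real_inner_comm]
  have hmf : ∀ {t : Euc d → ℝ}, ContinuousOn t (ball 0 N) → AEStronglyMeasurable
      (fun x => (rampDeriv τ (t x) * η x) • D x) (volume.restrict (ball 0 N)) := fun ht =>
    ((((continuous_rampDeriv τ).comp_continuousOn ht).mul
      hη.continuous.continuousOn).aestronglyMeasurable measurableSet_ball).smul hmD
  have hbf : ∀ (t : Euc d → ℝ) x, ‖(rampDeriv τ (t x) * η x) • D x‖ ≤ M * ‖D x‖ := fun t x => by
    rw [norm_smul]; exact mul_le_mul_of_nonneg_right (hrη _ x) (norm_nonneg _)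
  have hgf := h.integrable_norm_limit.const_mul M
  have h2f : MemLp (fun x => (rampDeriv τ (w x) * η x) • D x) 2 (volume.restrict (ball 0 N)) :=
    (h.memLp.const_smul M).mono (hmf h.limit_continuousOn) (Eventually.of_forall fun x => by
      refine (hbf w x).trans_eq ?_
      rw [Pi.smul_apply, norm_smul, Real.norm_of_nonneg hM0])
  have hlimf : ∀ᵐ x ∂(volume.restrict (ball (0 : Euc d) N)),
      Tendsto (fun m => (rampDeriv τ (v m x) * η x) • D x) atTop
        (𝓝 ((rampDeriv τ (w x) * η x) • D x)) := by
    filter_upwards [ae_restrict_mem measurableSet_ball] with x hx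
    exact ((((continuous_rampDeriv τ).tendsto _).comp (h.tendsto_apply hx)).mul_const _).smul_const _
  have T1 := tendsto_integral_inner h.meas_grad h.norm_grad_le (h.weak_grad _ h2f)
    (h.approx.mono fun m hm => hmf hm.continuousOn) h2f.aestronglyMeasurable hgf
    (Eventually.of_forall fun m => Eventually.of_forall fun x => hbf (v m) x)
    (Eventually.of_forall fun x => hbf w x) hlimf
  have hmr : ∀ {t : Euc d → ℝ}, ContinuousOn t (ball 0 N) → AEStronglyMeasurable
      (fun x => inner ℝ (D x) (ramp τ (t x) • gradient η x)) (volume.restrict (ball 0 N)) :=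
    fun ht => hmD.inner
      (((hrc.comp_continuousOn ht).smul hgc.continuousOn).aestronglyMeasurable measurableSet_ball)
  have hbr : ∀ {t : ℝ} (x : Euc d), 0 ≤ t → |t| ≤ Λ * N →
      ‖(inner ℝ (D x) (ramp τ t • gradient η x) : ℝ)‖ ≤ ‖D x‖ * (Λ * N * M') := fun x h1 h2 =>
    (norm_inner_le_norm _ _).trans (mul_le_mul_of_nonneg_left (hrg _ x h1 h2) (norm_nonneg _))
  have hgr := h.integrable_norm_limit.mul_const (Λ * N * M')
  have T2 : Tendsto (fun m => ∫ x in ball 0 N, inner ℝ (D x) (ramp τ (v m x) • gradient η x)) atTop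
      (𝓝 (∫ x in ball 0 N, inner ℝ (D x) (ramp τ (w x) • gradient η x))) := by
    refine tendsto_integral_filter_of_dominated_convergence _
      (h.approx.mono fun m hm => hmr hm.continuousOn) ?_ hgr ?_
    · filter_upwards [h.approx] with m hm
      filter_upwards [ae_restrict_mem measurableSet_ball] with x hx
      exact hbr x (hm.nonneg x hx) (hm.abs_le hN hΛ hx)
    · filter_upwards [ae_restrict_mem measurableSet_ball] with x hx
      exact tendsto_const_nhds.inner
        (((hrc.tendsto _).comp (h.tendsto_apply hx)).smul_const (gradient η x))
  have T3 := T1.add T2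
  have e : ∫ x in ball 0 N, inner ℝ (D x) ((rampDeriv τ (w x) * η x) • D x +
      ramp τ (w x) • gradient η x) = (∫ x in ball 0 N, inner ℝ (D x)
        ((rampDeriv τ (w x) * η x) • D x)) +
      ∫ x in ball 0 N, inner ℝ (D x) (ramp τ (w x) • gradient η x) := by
    simp_rw [inner_add_right]
    refine integral_add (integrable_inner_of_memLp h.memLp h2f) ?_
    refine Integrable.mono' hgr (hmr h.limit_continuousOn) ?_
    filter_upwards [ae_restrict_mem measurableSet_ball] with x hx
    exact hbr x (h.limit_nonneg hx) (h.limit_abs_le hx)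
  rw [e]
  refine tendsto_nhds_unique T3 (tendsto_const_nhds.congr' ?_)
  filter_upwards [h.approx, hflux, h.meas_grad, h.norm_grad_le] with m hm k1 k2 k3
  rw [← k1]
  simp_rw [hDm]
  refine integral_add (integrable_inner_of_norm_le k2 k3 (hmf hm.continuousOn) hgf
    (Eventually.of_forall fun x => hbf (v m) x)) ?_
  refine Integrable.mono' hgr (hmr hm.continuousOn) ?_
  filter_upwards [ae_restrict_mem measurableSet_ball] with x hx
  exact hbr x (hm.nonneg x hx) (hm.abs_le hN hΛ hx)

end IsApproxSequence

end StrongConvergence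

namespace IsApproxSequence

variable {d : ℕ} {N Λ : ℝ} {ε : ℕ → ℝ} {v : ℕ → Euc d → ℝ} {G B : ℕ → Euc d → Euc d}
  {w : Euc d → ℝ} {D : Euc d → Euc d}

/-- The limit is a subsolution in the sense of the energy identity. -/
theorem neg_integral_le (h : IsApproxSequence N Λ ε v G B w D) {η : Euc d → ℝ}
    (hη : ContDiff ℝ 1 η) (hηc : HasCompactSupport η) (hηN : tsupport η ⊆ ball 0 N)
    (hη0 : ∀ x, 0 ≤ η x) :
    -∫ x in ball 0 N, inner ℝ (D x) (w x • gradient η x) ≤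
      ∫ x in ball 0 N, inner ℝ (D x) (η x • D x) := by
  have hN := h.radius_pos
  have hΛ := h.bound_nonneg
  obtain ⟨M, hM⟩ := hηc.exists_bound_of_continuous hη.continuous
  obtain ⟨M', hM'⟩ := exists_norm_gradient_le hη hηc
  have hM0 : 0 ≤ M := (norm_nonneg _).trans (hM 0)
  have hM0' : 0 ≤ M' := (norm_nonneg _).trans (hM' 0)
  have hgc := continuous_gradient hη
  have hmD := h.memLp.aestronglyMeasurable
  set τ : ℕ → ℝ := fun k => 1 / (k + 1 : ℝ)
  have hτ0 : ∀ k, 0 < τ k := fun k => by positivity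
  have hτ : Tendsto τ atTop (𝓝 0) := tendsto_one_div_add_atTop_nhds_zero_nat
  have hgr := h.integrable_norm_limit.mul_const (Λ * N * M')
  have hmr : ∀ k, AEStronglyMeasurable (fun x => inner ℝ (D x) (ramp (τ k) (w x) • gradient η x))
      (volume.restrict (ball 0 N)) := fun k =>
    hmD.inner ((((contDiff_ramp (τ k)).continuous.comp_continuousOn h.limit_continuousOn).smul
      hgc.continuousOn).aestronglyMeasurable measurableSet_ball)
  have hbr : ∀ k, ∀ᵐ x ∂(volume.restrict (ball (0 : Euc d) N)),
      ‖(inner ℝ (D x) (ramp (τ k) (w x) • gradient η x) : ℝ)‖ ≤ ‖D x‖ * (Λ * N * M') := fun k => by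
    filter_upwards [ae_restrict_mem measurableSet_ball] with x hx
    refine (norm_inner_le_norm _ _).trans (mul_le_mul_of_nonneg_left ?_ (norm_nonneg _))
    rw [norm_smul, Real.norm_of_nonneg (ramp_nonneg (h.limit_nonneg hx))]
    exact mul_le_mul ((ramp_le (h.limit_nonneg hx)).trans ((le_abs_self _).trans
      (h.limit_abs_le hx))) (hM' x) (norm_nonneg _) (by positivity)
  have hlim : Tendsto (fun k => ∫ x in ball 0 N, inner ℝ (D x) (ramp (τ k) (w x) • gradient η x))
      atTop (𝓝 (∫ x in ball 0 N, inner ℝ (D x) (w x • gradient η x))) := by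
    refine tendsto_integral_of_dominated_convergence _ hmr hgr hbr ?_
    filter_upwards [ae_restrict_mem measurableSet_ball] with x hx
    exact tendsto_const_nhds.inner ((tendsto_ramp hτ0 hτ (h.limit_nonneg hx)).smul_const _)
  refine le_of_tendsto hlim.neg (Eventually.of_forall fun k => ?_)
  have hη2 : ∀ {t : Euc d → ℝ}, AEStronglyMeasurable t (volume.restrict (ball 0 N)) →
      (∀ x, ‖t x‖ ≤ M) → MemLp (fun x => t x • D x) 2 (volume.restrict (ball 0 N)) :=
    fun {t} ht hb => (h.memLp.const_smul M).mono (ht.smul hmD) (Eventually.of_forall fun x => by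
      rw [norm_smul, Pi.smul_apply, norm_smul, Real.norm_of_nonneg hM0]
      exact mul_le_mul_of_nonneg_right (hb x) (norm_nonneg _))
  have hrη : ∀ x, ‖rampDeriv (τ k) (w x) * η x‖ ≤ M := fun x => by
    rw [norm_mul, Real.norm_of_nonneg (rampDeriv_nonneg _ _)]
    calc _ ≤ 1 * M := mul_le_mul (rampDeriv_le_one _ _) (hM x) (norm_nonneg _) zero_le_one
      _ = M := one_mul M
  have i1 := integrable_inner_of_memLp h.memLp (hη2 (t := fun x => rampDeriv (τ k) (w x) * η x)
    ((((continuous_rampDeriv (τ k)).comp_continuousOn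
    h.limit_continuousOn).mul hη.continuous.continuousOn).aestronglyMeasurable measurableSet_ball)
    hrη)
  have i2 := integrable_inner_of_memLp h.memLp (hη2 hη.continuous.aestronglyMeasurable hM)
  have h0 := h.integral_rampDeriv_eq_zero hη hηc hηN (hτ0 k)
  simp_rw [inner_add_right] at h0
  rw [integral_add i1 (Integrable.mono' hgr (hmr k) (hbr k))] at h0
  rw [← eq_neg_iff_add_eq_zero.2 h0]
  refine integral_mono i1 i2 fun x => ?_
  simp only [inner_smul_right]
  refine mul_le_mul_of_nonneg_right ?_ (real_inner_self_nonneg)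
  exact mul_le_of_le_one_left (hη0 x) (rampDeriv_le_one _ _)

theorem tendsto_integral_norm_sub_sq (h : IsApproxSequence N Λ ε v G B w D) {η : Euc d → ℝ}
    (hη : ContDiff ℝ 1 η) (hηc : HasCompactSupport η) (hηN : tsupport η ⊆ ball 0 N)
    (hη0 : ∀ x, 0 ≤ η x) :
    Tendsto (fun m => ∫ x in ball 0 N, η x * ‖G m x - D x‖ ^ 2) atTop (𝓝 0) := by
  have := isFiniteMeasure_restrict_ball (d := d) N
  obtain ⟨M, hM⟩ := hηc.exists_bound_of_continuous hη.continuous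
  have hM0 : 0 ≤ M := (norm_nonneg _).trans (hM 0)
  have hη2 : ∀ {u : Euc d → Euc d}, MemLp u 2 (volume.restrict (ball 0 N)) →
      MemLp (fun x => η x • u x) 2 (volume.restrict (ball 0 N)) := fun {u} hu =>
    (hu.const_smul M).mono (hη.continuous.aestronglyMeasurable.smul hu.aestronglyMeasurable)
      (Eventually.of_forall fun x => by
        rw [norm_smul, Pi.smul_apply, norm_smul, Real.norm_of_nonneg hM0]
        exact mul_le_mul_of_nonneg_right (hM x) (norm_nonneg _))
  have h1 := h.tendsto_dirichlet hη hηc hηN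
  have h2 := h.weak_grad _ (hη2 h.memLp)
  set A := ∫ x in ball 0 N, inner ℝ (D x) (η x • D x)
  have h3 := h.neg_integral_le hη hηc hηN hη0
  have h4 := (h1.sub (h2.const_mul 2)).add_const A
  have hnn : ∀ m, 0 ≤ ∫ x in ball 0 N, η x * ‖G m x - D x‖ ^ 2 := fun m =>
    integral_nonneg fun x => mul_nonneg (hη0 x) (sq_nonneg _)
  have h5 : (fun m => (∫ x in ball 0 N, inner ℝ (G m x) (η x • G m x)) -
      2 * (∫ x in ball 0 N, inner ℝ (G m x) (η x • D x)) + A) =ᶠ[atTop]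
      fun m => ∫ x in ball 0 N, η x * ‖G m x - D x‖ ^ 2 := by
    filter_upwards [h.meas_grad, h.norm_grad_le] with m k1 k2
    have hG2 : MemLp (G m) 2 (volume.restrict (ball 0 N)) := MemLp.of_bound k1 Λ k2
    have j1 := integrable_inner_of_memLp hG2 (hη2 hG2)
    have j2 := integrable_inner_of_memLp hG2 (hη2 h.memLp)
    have j3 := integrable_inner_of_memLp h.memLp (hη2 h.memLp)
    rw [← integral_const_mul, ← integral_sub j1 (j2.const_mul 2)]
    have j4 := integral_add (j1.sub (j2.const_mul 2)) j3
    simp only [Pi.sub_apply] at j4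
    rw [← j4]
    refine integral_congr_ae (Eventually.of_forall fun x => ?_)
    simp only [inner_smul_right, norm_sub_sq_real, real_inner_self_eq_norm_sq]
    ring
  have h6 := h4.congr' h5
  have h7 := ge_of_tendsto h6 (Eventually.of_forall hnn)
  have h8 : -(∫ x in ball 0 N, inner ℝ (D x) (w x • gradient η x)) - 2 * A + A = 0 := by linarith
  rwa [h8] at h6

/-- Strong convergence of the gradients in a smaller ball. -/
theorem tendsto_eLpNorm (h : IsApproxSequence N Λ ε v G B w D) {N' : ℝ} (hN' : 0 < N')
    (hNN : N' < N) :
    Tendsto (fun m => eLpNorm (G m - D) 2 (volume.restrict (ball 0 N'))) atTop (𝓝 0) := by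
  have := isFiniteMeasure_restrict_ball (d := d) N
  let b : ContDiffBump (0 : Euc d) := ⟨N', (N' + N) / 2, hN', by linarith⟩
  have hbN : tsupport b ⊆ ball 0 N := by
    rw [b.tsupport_eq]
    exact closedBall_subset_ball (show (N' + N) / 2 < N by linarith)
  have h1 := h.tendsto_integral_norm_sub_sq b.contDiff b.hasCompactSupport hbN fun x => b.nonneg
  have hsub : ball (0 : Euc d) N' ⊆ ball 0 N := ball_subset_ball hNN.le
  have h2 : ∀ᶠ m in atTop, MemLp (G m - D) 2 (volume.restrict (ball 0 N)) := by
    filter_upwards [h.meas_grad, h.norm_grad_le] with m k1 k2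
    exact (MemLp.of_bound k1 Λ k2).sub h.memLp
  have h3 : Tendsto (fun m => ∫ x in ball (0 : Euc d) N', ‖(G m - D) x‖ ^ (2 : ℝ)) atTop
      (𝓝 0) := by
    refine tendsto_of_tendsto_of_tendsto_of_le_of_le' tendsto_const_nhds h1
      (Eventually.of_forall fun m => integral_nonneg fun x => by positivity) ?_
    filter_upwards [h2] with m hm
    have hi : Integrable (fun x => ‖G m x - D x‖ ^ 2) (volume.restrict (ball 0 N)) :=
      hm.integrable_norm_pow two_ne_zero
    have hiη : Integrable (fun x => b x * ‖G m x - D x‖ ^ 2) (volume.restrict (ball 0 N)) :=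
      Integrable.bdd_mul (c := 1) hi b.continuous.aestronglyMeasurable
        (Eventually.of_forall fun x => by
          rw [Real.norm_of_nonneg b.nonneg]; exact b.le_one)
    calc ∫ x in ball (0 : Euc d) N', ‖(G m - D) x‖ ^ (2 : ℝ) =
          ∫ x in ball (0 : Euc d) N', b x * ‖G m x - D x‖ ^ 2 := by
          refine setIntegral_congr_fun measurableSet_ball fun x hx => ?_
          simp only [Real.rpow_two, Pi.sub_apply]
          rw [b.one_of_mem_closedBall (ball_subset_closedBall hx), one_mul]
      _ ≤ _ := setIntegral_mono_set hiη (Eventually.of_forall fun x =>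
          mul_nonneg b.nonneg (sq_nonneg _)) hsub.eventuallyLE
  have h4 : Tendsto (fun m => ENNReal.ofReal ((∫ x in ball (0 : Euc d) N',
      ‖(G m - D) x‖ ^ (2 : ℝ)) ^ (2⁻¹ : ℝ))) atTop (𝓝 0) := by
    have h5 := h3.rpow_const (p := 2⁻¹) (Or.inr (by norm_num))
    rw [Real.zero_rpow (by norm_num)] at h5
    simpa using ENNReal.tendsto_ofReal h5
  refine h4.congr' ?_
  filter_upwards [h2] with m hm
  have hm' : MemLp (G m - D) 2 (volume.restrict (ball 0 N')) :=
    hm.mono_measure (Measure.restrict_mono hsub le_rfl)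
  rw [hm'.eLpNorm_eq_integral_rpow_norm two_ne_zero ENNReal.ofNat_ne_top]
  simp

end IsApproxSequence

theorem rpow_three_halves {r : ℝ} (hr : 0 ≤ r) : r ^ (3 / 2 : ℝ) = r * √r := by
  refine (pow_left_inj₀ (Real.rpow_nonneg hr _) (by positivity) two_ne_zero).1 ?_
  rw [rpow_three_halves_sq hr, mul_pow, Real.sq_sqrt hr]
  ring

section Rescaling

variable {d : ℕ} {ζ : Euc d → ℝ} {r : ℝ}

theorem contDiff_comp_inv_smul (hζ : ContDiff ℝ 1 ζ) : ContDiff ℝ 1 fun y => ζ (r⁻¹ • y) :=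
  hζ.comp (contDiff_const_smul _)

theorem hasCompactSupport_comp_inv_smul (hr : 0 < r) (hζc : HasCompactSupport ζ) :
    HasCompactSupport fun y => ζ (r⁻¹ • y) :=
  hζc.comp_homeomorph (Homeomorph.smulOfNeZero r⁻¹ (inv_ne_zero hr.ne'))

theorem tsupport_comp_inv_smul_subset :
    tsupport (fun y => ζ (r⁻¹ • y)) ⊆ (fun y => r⁻¹ • y) ⁻¹' tsupport ζ :=
  tsupport_comp_subset_preimage ζ (continuous_const_smul _)

theorem fderiv_comp_inv_smul (hr : 0 < r) (x z : Euc d) :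
    fderiv ℝ (fun y => ζ (r⁻¹ • y)) (r • x) z = r⁻¹ * fderiv ℝ ζ x z := by
  rw [fderiv_comp_smul, inv_smul_smul₀ hr.ne']
  simp

theorem setIntegral_ball_eq_integral_of_tsupport {N : ℝ} (hζN : tsupport ζ ⊆ ball 0 N)
    {f : Euc d → ℝ} (hf : ∀ x, x ∉ tsupport ζ → f x = 0) :
    ∫ x in ball 0 N, f x = ∫ x, f x :=
  setIntegral_eq_integral_of_forall_compl_eq_zero fun x hx => hf x fun h => hx (hζN h)

end Rescaling

namespace IsLocalSolution

variable {L : CompressibleLiquid} {d : ℕ} {R C δ K : ℝ} {v : Euc d → ℝ} {G : Euc d → Euc d}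

theorem aestronglyMeasurable_of_continuousOn {E : Type*} [NormedAddCommGroup E]
    (h : IsLocalSolution L R C δ K v G) {f : Euc d → E} [SecondCountableTopologyEither (Euc d) E]
    (hf : ContinuousOn f (posSet (ball 0 R) v)) (h0 : ∀ y, y ∉ posSet (ball 0 R) v → f y = 0) :
    AEStronglyMeasurable f volume := by
  have hV := h.isOpen_posSet.measurableSet
  have h1 : AEStronglyMeasurable ((posSet (ball 0 R) v).indicator f) volume :=
    (aestronglyMeasurable_indicator_iff hV).2 (hf.aestronglyMeasurable hV)
  refine h1.congr (Eventually.of_forall fun y => ?_)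
  by_cases hy : y ∈ posSet (ball 0 R) v
  · rw [indicator_of_mem hy]
  · rw [indicator_of_notMem hy, h0 y hy]

/-- The rescaled flux `ρ₀ ∂₁F ∇v`. -/
def blowUpFlux (L : CompressibleLiquid) (G : Euc d → Euc d) (r : ℝ) (x : Euc d) : Euc d :=
  (L.rho0 * coeff L G (r • x)) • blowUpGrad G 0 r x

theorem isApproxSolution_blowUp (h : IsLocalSolution L R C δ K v G) {r N : ℝ} (hr : 0 < r)
    (hN : 0 < N) (hrN : r * N ≤ R) :
    IsApproxSolution N √(C * N) (L.rho0 * (K * (C + 1) * (r * N)) * √(C * N)) (blowUp v 0 r)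
      (blowUpGrad G 0 r) (blowUpFlux L G r) := by
  have hC := h.growth_nonneg
  have hK := h.regular.const_nonneg
  have hρ := L.rho0_pos
  set a := r ^ (3 / 2 : ℝ) with ha
  have ha0 : 0 < a := Real.rpow_pos_of_pos hr _
  have har : a = r * √r := rpow_three_halves hr.le
  have hv : ∀ x, blowUp v 0 r x = v (r • x) / a := fun x => by rw [blowUp, zero_add]
  have hG : ∀ x, blowUpGrad G 0 r x = (r / a) • G (r • x) := fun x => by rw [blowUpGrad, zero_add]
  have hmem : ∀ {x : Euc d}, x ∈ ball (0 : Euc d) N → r • x ∈ ball (0 : Euc d) (r * N) :=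
    fun {x} hx => by
      rw [mem_ball_zero_iff] at *
      rw [norm_smul, Real.norm_of_nonneg hr.le]
      exact mul_lt_mul_of_pos_left hx hr
  have hmemR : ∀ {x : Euc d}, x ∈ ball (0 : Euc d) N → r • x ∈ ball (0 : Euc d) R :=
    fun hx => ball_subset_ball hrN (hmem hx)
  have hsqrt : √(C * (r * N)) * r / a = √(C * N) := by
    rw [har, show C * (r * N) = r * (C * N) by ring, Real.sqrt_mul hr.le]
    have := Real.sqrt_pos.2 hr
    field_simp
  have hpos : ∀ {x : Euc d}, x ∈ ball (0 : Euc d) N → 0 < blowUp v 0 r x →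
      r • x ∈ posSet (ball 0 R) v := fun hx hp => by
    rw [hv] at hp
    exact ⟨hmemR hx, (div_pos_iff_of_pos_right ha0).1 hp⟩
  have hnorm : ∀ x ∈ ball (0 : Euc d) N, ‖blowUpGrad G 0 r x‖ ≤ √(C * N) := fun x hx => by
    rw [hG, norm_smul, Real.norm_of_nonneg (by positivity), ← hsqrt, mul_div_assoc, mul_comm]
    refine mul_le_mul_of_nonneg_right ?_ (by positivity)
    refine (h.norm_grad_le (hmemR hx)).trans (Real.sqrt_le_sqrt ?_)
    exact mul_le_mul_of_nonneg_left (mem_ball_zero_iff.1 (hmem hx)).le hC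
  have hq : Measure.QuasiMeasurePreserving (fun x : Euc d => r • x) volume volume :=
    Measure.quasiMeasurePreserving_smul volume hr.ne'
  refine ⟨?_, ?_, ?_, ?_, ?_, hnorm, ?_, ?_, ?_, ?_, ?_⟩
  · rw [hv, smul_zero, h.apply_zero, zero_div]
  · intro x hx
    rw [hv]
    exact div_nonneg (h.nonneg _ (hmemR hx)) ha0.le
  · intro x hx y hy
    rw [hv, hv, ← sub_div, abs_div, abs_of_pos ha0, ← hsqrt, div_le_iff₀ ha0]
    refine (h.abs_sub_le hrN (hmem hx) (hmem hy)).trans_eq ?_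
    rw [← smul_sub, norm_smul, Real.norm_of_nonneg hr.le]
    field_simp
  · have h1 : ContDiffOn ℝ 1 v (posSet (ball 0 R) v) := h.contDiffOn.of_le (by norm_num)
    have h2 : ContDiffOn ℝ 1 (fun x => v (r • x) / a)
        (ball 0 N ∩ {x | 0 < blowUp v 0 r x}) :=
      (h1.comp (contDiff_const_smul r).contDiffOn fun x hx => hpos hx.1 hx.2).div_const a
    exact h2.congr fun x _ => hv x
  · intro x hx hp y
    have h1 := (h.hasGradientAt _ (hpos hx hp)).hasFDerivAt
    have h2 : HasFDerivAt (fun x : Euc d => r • x) (r • ContinuousLinearMap.id ℝ (Euc d)) x :=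
      (hasFDerivAt_id x).const_smul r
    have h3 : HasFDerivAt (blowUp v 0 r) _ x :=
      ((h1.comp x h2).mul_const a⁻¹).congr_of_eventuallyEq
        (Eventually.of_forall fun x => by simp [hv, div_eq_mul_inv])
    rw [h3.fderiv, hG, real_inner_smul_left]
    simp
    ring
  · intro x hx
    have h1 : blowUpFlux L G r x - blowUpGrad G 0 r x =
        (L.rho0 * (coeff L G (r • x) - 1 / L.rho0)) • blowUpGrad G 0 r x := by
      rw [blowUpFlux, mul_sub, mul_one_div_cancel hρ.ne', sub_smul, one_smul]
    rw [h1, norm_smul, norm_mul, Real.norm_of_nonneg hρ.le]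
    refine mul_le_mul (mul_le_mul_of_nonneg_left ((h.abs_coeff_sub_le (hmemR hx)).trans ?_) hρ.le)
      (hnorm x hx) (norm_nonneg _) (by positivity)
    exact mul_le_mul_of_nonneg_left (mem_ball_zero_iff.1 (hmem hx)).le (by positivity)
  · have h1 := h.aestronglyMeasurable_of_continuousOn h.contDiffOn_grad.continuousOn h.grad_eq_zero
    have h2 := (h1.comp_quasiMeasurePreserving hq).const_smul (r / a)
    exact (h2.congr (Eventually.of_forall fun x => (hG x).symm)).restrict
  · have h1 := h.aestronglyMeasurable_of_continuousOn (f := fun y => coeff L G y • G y)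
      (h.contDiffOn_coeff.continuousOn.smul h.contDiffOn_grad.continuousOn)
      fun y hy => by rw [h.grad_eq_zero y hy, smul_zero]
    have h2 := (h1.comp_quasiMeasurePreserving hq).const_smul (L.rho0 * (r / a))
    refine (h2.congr (Eventually.of_forall fun x => ?_)).restrict
    simp only [blowUpFlux, hG, Pi.smul_apply, Function.comp_apply, smul_smul]
    congr 1
    ring
  · intro ζ hζ hζc hζV
    have hζN : tsupport ζ ⊆ ball 0 N := fun x hx => (hζV hx).1
    rw [setIntegral_ball_eq_integral_of_tsupport hζN fun x hx => by
      simp [fderiv_of_notMem_tsupport ℝ hx]]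
    set ζ' : Euc d → ℝ := fun y => ζ (r⁻¹ • y) with hζ'
    have h1 := h.integral_coeff_mul_fderiv_grad_eq_zero (contDiff_comp_inv_smul hζ)
      (hasCompactSupport_comp_inv_smul hr hζc) fun y hy => by
        have := hζV (tsupport_comp_inv_smul_subset hy)
        have h2 := hpos this.1 this.2
        rwa [smul_inv_smul₀ hr.ne'] at h2
    have h2 := Measure.integral_comp_smul volume
      (fun y => coeff L G y * fderiv ℝ ζ' y (G y)) r
    rw [h1, smul_zero] at h2
    have h3 : ∀ x, fderiv ℝ ζ x (blowUpFlux L G r x) = L.rho0 * (r ^ 2 / a) *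
        (coeff L G (r • x) * fderiv ℝ ζ' (r • x) (G (r • x))) := fun x => by
      rw [hζ', fderiv_comp_inv_smul hr, blowUpFlux, hG]
      simp
      field_simp
    simp_rw [h3]
    rw [integral_const_mul, h2, mul_zero]
  · intro η hη hηc hηN
    rw [setIntegral_ball_eq_integral_of_tsupport hηN fun x hx => by
      simp [fderiv_of_notMem_tsupport ℝ hx, image_eq_zero_of_notMem_tsupport hx]]
    set η' : Euc d → ℝ := fun y => η (r⁻¹ • y) with hη'
    have hηR : tsupport η' ⊆ ball 0 R := fun y hy => by
      have h2 := hmemR (hηN (tsupport_comp_inv_smul_subset hy))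
      rwa [smul_inv_smul₀ hr.ne'] at h2
    have h1 : ∫ y in ball (0 : Euc d) R,
        coeff L G y * (η' y * ‖G y‖ ^ 2 + v y * fderiv ℝ η' y (G y)) = 0 :=
      h.integral_energy_identity (contDiff_comp_inv_smul hη) (hasCompactSupport_comp_inv_smul hr hηc) hηR
    rw [setIntegral_ball_eq_integral_of_tsupport hηR fun x hx => by
      simp [fderiv_of_notMem_tsupport ℝ hx, image_eq_zero_of_notMem_tsupport hx]] at h1
    have h2 := Measure.integral_comp_smul volume
      (fun y => coeff L G y * (η' y * ‖G y‖ ^ 2 + v y * fderiv ℝ η' y (G y))) r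
    rw [h1, smul_zero] at h2
    have h3 : ∀ x, η x * inner ℝ (blowUpFlux L G r x) (blowUpGrad G 0 r x) +
        blowUp v 0 r x * fderiv ℝ η x (blowUpFlux L G r x) = L.rho0 * (r / a) ^ 2 *
        (coeff L G (r • x) * (η' (r • x) * ‖G (r • x)‖ ^ 2 +
          v (r • x) * fderiv ℝ η' (r • x) (G (r • x)))) := fun x => by
      rw [hη', fderiv_comp_inv_smul hr, blowUpFlux, hG, hv]
      simp only [inv_smul_smul₀ hr.ne', real_inner_smul_left, real_inner_smul_right,
        real_inner_self_eq_norm_sq, map_smul, smul_eq_mul]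
      field_simp
    simp_rw [h3]
    rw [integral_const_mul, h2, mul_zero]

end IsLocalSolution

namespace IsLocalSolution

variable {L : CompressibleLiquid} {d : ℕ} {R C δ K : ℝ} {v : Euc d → ℝ} {G : Euc d → Euc d}

theorem tendsto_eLpNorm_of_tendstoUniformlyOn {v : ℕ → Euc d → ℝ} {w u₀ : Euc d → ℝ} {N : ℝ}
    (hu : TendstoUniformlyOn v w atTop (ball 0 N)) (hae : u₀ =ᵐ[volume] w) :
    Tendsto (fun m => eLpNorm (v m - u₀) 2 (volume.restrict (ball 0 N))) atTop (𝓝 0) := by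
  have : IsFiniteMeasure (volume.restrict (ball (0 : Euc d) N)) :=
    ⟨by simpa using measure_ball_lt_top⟩
  set V := (volume.restrict (ball (0 : Euc d) N) univ) ^ ((2 : ENNReal).toReal⁻¹) with hV
  have hVt : V ≠ ⊤ := ENNReal.rpow_ne_top_of_nonneg (by norm_num) (measure_ne_top _ _)
  rw [ENNReal.tendsto_nhds_zero]
  intro ε hε
  rcases eq_or_ne ε ⊤ with rfl | hεt
  · exact Eventually.of_forall fun _ => le_top
  have hε' : 0 < ε.toReal := ENNReal.toReal_pos hε.ne' hεt
  filter_upwards [Metric.tendstoUniformlyOn_iff.1 hu (ε.toReal / (V.toReal + 1)) (by positivity)]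
    with m hm
  have hb : ∀ᵐ x ∂(volume.restrict (ball (0 : Euc d) N)),
      ‖(v m - u₀) x‖ ≤ ε.toReal / (V.toReal + 1) := by
    filter_upwards [ae_restrict_mem measurableSet_ball, ae_restrict_of_ae hae] with x hx h1
    have := (hm x hx).le
    rw [dist_comm, dist_eq_norm] at this
    rwa [Pi.sub_apply, h1]
  refine (eLpNorm_le_of_ae_bound hb).trans ?_
  rw [← hV]
  have h1 : V = ENNReal.ofReal V.toReal := (ENNReal.ofReal_toReal hVt).symm
  rw [h1, ← ENNReal.ofReal_mul ENNReal.toReal_nonneg]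
  refine ENNReal.ofReal_le_of_le_toReal ?_
  rw [ENNReal.toReal_ofReal ENNReal.toReal_nonneg, ← mul_div_assoc, div_le_iff₀ (by positivity)]
  nlinarith [ENNReal.toReal_nonneg (a := V)]

/-- Weakly convergent blow-up sequences have homogeneous limits and converge strongly. -/
theorem blowUp_convergence (h : IsLocalSolution L R C δ K v G) {r : ℕ → ℝ}
    (hr : ∀ m, 0 < r m) (hr0 : Tendsto r atTop (𝓝 0)) {u₀ : Euc d → ℝ} {Du₀ : Euc d → Euc d}
    (hu₀ : MemW12Loc univ u₀ Du₀)
    (hweak : TendstoWeaklyW12Loc (fun m => blowUp v 0 (r m)) (fun m => blowUpGrad G 0 (r m))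
      u₀ Du₀) :
    (∃ w : Euc d → ℝ, u₀ =ᵐ[volume] w ∧
      ∀ c : ℝ, 0 < c → ∀ x, w (c • x) = c ^ (3 / 2 : ℝ) * w x) ∧
    TendstoStronglyW12Loc (fun m => blowUp v 0 (r m)) (fun m => blowUpGrad G 0 (r m)) u₀ Du₀ := by
  have hev : ∀ N, 0 < N → ∀ᶠ m in atTop, r m * N ≤ R := fun N _ => by
    have : Tendsto (fun m => r m * N) atTop (𝓝 0) := by simpa using hr0.mul_const N
    exact this.eventually_le_const h.radius_pos
  have happ : ∀ N, 0 < N → ∀ᶠ m in atTop, IsApproxSolution N √(C * N)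
      (L.rho0 * (K * (C + 1) * (r m * N)) * √(C * N)) (blowUp v 0 (r m))
      (blowUpGrad G 0 (r m)) (blowUpFlux L G (r m)) := fun N hN =>
    (hev N hN).mono fun m hm => h.isApproxSolution_blowUp (hr m) hN hm
  obtain ⟨w, hwc, hae, hlim, -, hunif⟩ := exists_continuous_limit (Λ := fun N => √(C * N))
    (v := fun m => blowUp v 0 (r m)) (u₀ := u₀) (fun N => Real.sqrt_nonneg _)
    (fun m => by simp [blowUp, h.apply_zero])
    (fun N hN => (happ N hN).mono fun m hm => hm.abs_sub_le)
    (fun N hN => (hweak N hN).1) (fun A hA => hu₀.memLp_fun A (subset_univ A) hA)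
  refine ⟨⟨w, hae, fun c hc x => h.blowUp_limit_homogeneous hr hr0 hwc hlim hc x⟩, fun N hN => ?_⟩
  refine ⟨tendsto_eLpNorm_of_tendstoUniformlyOn ((hunif N).mono ball_subset_closedBall) hae, ?_⟩
  have hseq : IsApproxSequence (N + 1) √(C * (N + 1))
      (fun m => L.rho0 * (K * (C + 1) * (r m * (N + 1))) * √(C * (N + 1)))
      (fun m => blowUp v 0 (r m)) (fun m => blowUpGrad G 0 (r m)) (fun m => blowUpFlux L G (r m))
      w Du₀ :=
    { radius_pos := by linarith
      bound_nonneg := Real.sqrt_nonneg _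
      tendsto_zero := by
        have := (((hr0.mul_const (N + 1)).const_mul (K * (C + 1))).const_mul L.rho0).mul_const
          √(C * (N + 1))
        simpa using this
      approx := happ (N + 1) (by linarith)
      memLp := (hu₀.memLp_grad _ (subset_univ _) (isCompact_closedBall 0 (N + 1))).mono_measure
        (Measure.restrict_mono ball_subset_closedBall le_rfl)
      weak_grad := (hweak (N + 1) (by linarith)).2
      uniform := (hunif (N + 1)).mono ball_subset_closedBall }
  exact hseq.tendsto_eLpNorm hN (by linarith)

end IsLocalSolution

section WeakGradient

variable {d : ℕ} {B : Set (Euc d)} {v : Euc d → ℝ} {D : Euc d → Euc d}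

theorem ae_eq_of_integral_coord_mul_eq (hB : IsOpen B) {D₁ D₂ : Euc d → Euc d}
    (h1 : LocallyIntegrableOn D₁ B) (h2 : LocallyIntegrableOn D₂ B)
    (h : ∀ g : Euc d → ℝ, ContDiff ℝ ∞ g → HasCompactSupport g → tsupport g ⊆ B → ∀ i,
      ∫ x, D₁ x i * g x = ∫ x, D₂ x i * g x) : ∀ᵐ x, x ∈ B → D₁ x = D₂ x := by
  have hi : ∀ {D : Euc d → Euc d}, LocallyIntegrableOn D B → ∀ i,
      LocallyIntegrableOn (fun x => D x i) B := fun {D} hD i x hx => by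
    obtain ⟨t, ht, hint⟩ := hD x hx
    exact ⟨t, ht, (EuclideanSpace.proj (𝕜 := ℝ) i).integrable_comp hint⟩
  have hmul : ∀ {D : Euc d → Euc d}, LocallyIntegrableOn D B → ∀ i {g : Euc d → ℝ},
      Continuous g → HasCompactSupport g → tsupport g ⊆ B → Integrable fun x => D x i * g x :=
    fun {D} hD i {g} hg hgc hgB => by
      have k1 : IntegrableOn (fun x => D x i) (tsupport g) :=
        (hi hD i).integrableOn_compact_subset hgB hgc
      have k2 : IntegrableOn (fun x => D x i * g x) (tsupport g) := by
        obtain ⟨M, hM⟩ := hgc.exists_bound_of_continuous hg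
        exact Integrable.mul_bdd (c := M) k1 hg.aestronglyMeasurable (Eventually.of_forall hM)
      refine (integrableOn_iff_integrable_of_support_subset fun x hx => ?_).1 k2
      exact subset_tsupport g fun h0 => hx (by simp [h0])
  have hcoord : ∀ i, ∀ᵐ x, x ∈ B → D₁ x i - D₂ x i = 0 := fun i => by
    refine hB.ae_eq_zero_of_integral_contDiff_smul_eq_zero ((hi h1 i).sub (hi h2 i))
      fun g hg hgc hgB => ?_
    have := integral_sub (hmul h1 i hg.continuous hgc hgB) (hmul h2 i hg.continuous hgc hgB)
    rw [h g hg hgc hgB i, sub_self] at this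
    rw [← this]
    refine integral_congr_ae (Eventually.of_forall fun x => ?_)
    simp only [smul_eq_mul]
    ring
  filter_upwards [ae_all_iff.2 hcoord] with x hx hxB
  ext i
  exact sub_eq_zero.1 (hx i hxB)

/-- The classical gradient in `{v > 0}`, extended by zero. -/
def posGradient (B : Set (Euc d)) (v : Euc d → ℝ) : Euc d → Euc d :=
  (posSet B v).indicator (gradient v)

theorem posGradient_apply_coord {y : Euc d} (hy : y ∈ posSet B v) (i : Fin (d + 1)) :
    posGradient B v y i = fderiv ℝ v y (EuclideanSpace.single i 1) := by
  rw [posGradient, indicator_of_mem hy, ← inner_gradient, EuclideanSpace.inner_single_left]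
  simp

theorem isOpen_posSet_of_continuousOn (hB : IsOpen B) (hv : ContinuousOn v B) :
    IsOpen (posSet B v) :=
  hv.isOpen_inter_preimage hB isOpen_Ioi

theorem continuousOn_posGradient (hB : IsOpen B) (hv : ContinuousOn v B)
    (hvd : ContDiffOn ℝ 1 v (posSet B v)) : ContinuousOn (posGradient B v) (posSet B v) := by
  have h1 : ContinuousOn (gradient v) (posSet B v) :=
    (InnerProductSpace.toDual ℝ (Euc d)).symm.continuous.comp_continuousOn
      (hvd.continuousOn_fderiv_of_isOpen (isOpen_posSet_of_continuousOn hB hv) le_rfl)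
  exact h1.congr fun y hy => indicator_of_mem hy _

theorem aestronglyMeasurable_posGradient (hB : IsOpen B) (hv : ContinuousOn v B)
    (hvd : ContDiffOn ℝ 1 v (posSet B v)) : AEStronglyMeasurable (posGradient B v) volume := by
  have hV := (isOpen_posSet_of_continuousOn hB hv).measurableSet
  rw [posGradient, aestronglyMeasurable_indicator_iff hV]
  exact ((continuousOn_posGradient hB hv hvd).aestronglyMeasurable hV).congr
    ((ae_restrict_mem hV).mono fun y hy => indicator_of_mem hy _)

/-- A weak gradient agrees with the classical one on the positivity set. -/
theorem ae_eq_posGradient_on_posSet (hB : IsOpen B) (hv : ContinuousOn v B)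
    (hvd : ContDiffOn ℝ 1 v (posSet B v)) (hD : LocallyIntegrableOn D B)
    (hweak : ∀ η : Euc d → ℝ, ContDiff ℝ ∞ η → HasCompactSupport η → tsupport η ⊆ B → ∀ i,
      ∫ x, v x * fderiv ℝ η x (EuclideanSpace.single i 1) = -∫ x, D x i * η x) :
    ∀ᵐ x, x ∈ posSet B v → D x = posGradient B v x := by
  have hV := isOpen_posSet_of_continuousOn hB hv
  have hVB : posSet B v ⊆ B := fun x hx => hx.1
  refine ae_eq_of_integral_coord_mul_eq hV (hD.mono_set hVB)
    ((continuousOn_posGradient hB hv hvd).locallyIntegrableOn hV.measurableSet)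
    fun g hg hgc hgV i => ?_
  have h1 := hweak g hg hgc (hgV.trans hVB) i
  rw [integral_mul_fderiv_eq_neg_of_tsupport_subset hV hvd (hg.of_le (by norm_cast))
    hgc hgV, neg_inj] at h1
  rw [← h1]
  refine integral_congr_ae (Eventually.of_forall fun x => ?_)
  by_cases hx : x ∈ posSet B v
  · simp only [posGradient_apply_coord hx]
  · have : g x = 0 := image_eq_zero_of_notMem_tsupport fun h => hx (hgV h)
    simp [this]

theorem norm_posGradient_sq_le (hB : IsOpen B) (hv : ContinuousOn v B)
    (hvd : ContDiffOn ℝ 1 v (posSet B v)) (hae : ∀ᵐ x, x ∈ posSet B v → D x = posGradient B v x)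
    {M : Euc d → ℝ} (hM : Continuous M) (hDM : ∀ᵐ x, x ∈ B → ‖D x‖ ^ 2 ≤ M x)
    (hM0 : ∀ x ∈ B, 0 ≤ M x) {y : Euc d} (hy : y ∈ B) : ‖posGradient B v y‖ ^ 2 ≤ M y := by
  have hV := isOpen_posSet_of_continuousOn hB hv
  by_cases hyV : y ∈ posSet B v
  · have hopen : IsOpen (posSet B v ∩ {x | 0 < ‖posGradient B v x‖ ^ 2 - M x}) :=
      (((continuousOn_posGradient hB hv hvd).norm.pow 2).sub
        hM.continuousOn).isOpen_inter_preimage hV isOpen_Ioi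
    have hnull : volume (posSet B v ∩ {x | 0 < ‖posGradient B v x‖ ^ 2 - M x}) = 0 := by
      rw [← compl_compl (posSet B v ∩ _)]
      change _ ∈ ae volume
      filter_upwards [hae, hDM] with x h1 h2 h3
      have h4 := h2 h3.1.1
      rw [h1 h3.1] at h4
      have h5 : 0 < ‖posGradient B v x‖ ^ 2 - M x := h3.2
      linarith
    have hempty := hopen.eq_empty_of_measure_zero hnull
    by_contra! hlt
    have : y ∈ posSet B v ∩ {x | 0 < ‖posGradient B v x‖ ^ 2 - M x} := by
      refine ⟨hyV, ?_⟩
      rw [mem_ofPred_eq]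
      linarith
    rw [hempty] at this
    exact this
  · rw [posGradient, indicator_of_notMem hyV]
    simpa using hM0 y hy

/-- A bounded weak gradient agrees almost everywhere with the classical gradient on the
positivity set, extended by zero. -/
theorem ae_eq_posGradient (hB : IsOpen B) (hBv : volume B < ⊤) (hv : ContinuousOn v B)
    (hv0 : ∀ y ∈ B, 0 ≤ v y) (hvd : ContDiffOn ℝ 1 v (posSet B v)) (hD : LocallyIntegrableOn D B)
    (hweak : ∀ η : Euc d → ℝ, ContDiff ℝ ∞ η → HasCompactSupport η → tsupport η ⊆ B → ∀ i,
      ∫ x, v x * fderiv ℝ η x (EuclideanSpace.single i 1) = -∫ x, D x i * η x)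
    {M₀ : ℝ} (hbd : ∀ x ∈ B, ‖posGradient B v x‖ ≤ M₀) :
    ∀ᵐ x, x ∈ B → D x = posGradient B v x := by
  set G := posGradient B v with hG
  have hGm := aestronglyMeasurable_posGradient hB hv hvd
  have hGi : IntegrableOn G B := IntegrableOn.of_bound hBv hGm.restrict M₀
    ((ae_restrict_mem hB.measurableSet).mono hbd)
  refine ae_eq_of_integral_coord_mul_eq hB hD hGi.locallyIntegrableOn fun g hg hgc hgB i => ?_
  have hg1 : ContDiff ℝ 1 g := hg.of_le (by norm_cast)
  set e : Euc d := EuclideanSpace.single i 1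
  rw [← neg_inj, ← hweak g hg hgc hgB i]
  have hG0 : ∀ x, x ∉ posSet B v → G x = 0 := fun x hx => indicator_of_notMem hx _
  have hg' : Continuous fun x => fderiv ℝ g x e :=
    (hg1.continuous_fderiv one_ne_zero).clm_apply continuous_const
  have i1 : Integrable fun x => G x i * g x := by
    obtain ⟨Mg, hMg⟩ := hgc.exists_bound_of_continuous hg.continuous
    have hk : IntegrableOn (fun x => G x i * g x) B :=
      Integrable.mul_bdd (c := Mg) ((EuclideanSpace.proj (𝕜 := ℝ) i).integrable_comp hGi)
        hg.continuous.aestronglyMeasurable (Eventually.of_forall hMg)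
    refine (integrableOn_iff_integrable_of_support_subset fun x hx => ?_).1 hk
    exact hgB (subset_tsupport g fun h0 => hx (by simp [h0]))
  have i2 : Integrable fun x => v x * fderiv ℝ g x e :=
    integrable_mul_of_tsupport_subset hB hv hg' (hgc.fderiv_apply (𝕜 := ℝ) e)
      ((tsupport_fderiv_apply_subset ℝ e).trans hgB)
  have hramp : ∀ ε, 0 < ε →
      ∫ x, (rampDeriv ε (v x) * (G x i * g x) + ramp ε (v x) * fderiv ℝ g x e) = 0 := by
    intro ε hε
    have hZ := contDiff_ramp_mul hB hv hvd hε hg1 hgB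
    have h1 := integral_mul_fderiv_eq_neg_of_tsupport_subset (f := fun _ => (1 : ℝ)) isOpen_univ
      contDiffOn_const hZ hgc.mul_left (subset_univ _) e
    simp only [one_mul, fderiv_fun_const, Pi.zero_apply, zero_apply, zero_mul,
      integral_zero, neg_zero] at h1
    rw [← h1]
    refine integral_congr_ae (Eventually.of_forall fun x => ?_)
    simp only
    rw [(hasFDerivAt_ramp_mul hB hv hvd hε hg1 hgB x).fderiv]
    by_cases hx : x ∈ posSet B v
    · rw [hG, posGradient_apply_coord hx]
      simp [e]
      ring
    · have : rampDeriv ε (v x) * g x = 0 := by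
        by_cases hxB : x ∈ B
        · have : v x ≤ 0 := not_lt.1 fun h => hx ⟨hxB, h⟩
          rw [rampDeriv_eq_zero hε (this.trans hε.le), zero_mul]
        · rw [image_eq_zero_of_notMem_tsupport fun h => hxB (hgB h), mul_zero]
      simp [hG0 x hx, this]
  set ε : ℕ → ℝ := fun k => 1 / (k + 1 : ℝ)
  have hε0 : ∀ k, 0 < ε k := fun k => by positivity
  have hε : Tendsto ε atTop (𝓝 0) := tendsto_one_div_add_atTop_nhds_zero_nat
  have hfx : ∀ x, x ∉ B → fderiv ℝ g x e = 0 ∧ g x = 0 := fun x hx => by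
    have : x ∉ tsupport g := fun h => hx (hgB h)
    exact ⟨by rw [fderiv_of_notMem_tsupport ℝ this]; simp, image_eq_zero_of_notMem_tsupport this⟩
  have hlim : Tendsto (fun k => ∫ x, (rampDeriv (ε k) (v x) * (G x i * g x) +
      ramp (ε k) (v x) * fderiv ℝ g x e)) atTop
      (𝓝 (∫ x, (G x i * g x + v x * fderiv ℝ g x e))) := by
    refine tendsto_integral_of_dominated_convergence
      (fun x => |G x i * g x| + |v x * fderiv ℝ g x e|) (fun k => ?_) (i1.abs.add i2.abs)
      (fun k => Eventually.of_forall fun x => ?_) (Eventually.of_forall fun x => ?_)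
    · have hs : ∀ {f : ℝ → ℝ} {t : Euc d → ℝ}, Continuous f → AEStronglyMeasurable t volume →
          (∀ x, x ∉ B → t x = 0) → AEStronglyMeasurable (fun x => f (v x) * t x) volume :=
        fun {f t} hf ht h0 => by
          have h1 : AEStronglyMeasurable (B.indicator fun x => f (v x) * t x) volume :=
            (aestronglyMeasurable_indicator_iff hB.measurableSet).2
              (((hf.comp_continuousOn hv).aestronglyMeasurable hB.measurableSet).mul ht.restrict)
          refine h1.congr (Eventually.of_forall fun x => ?_)
          by_cases hx : x ∈ B
          · rw [indicator_of_mem hx]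
          · simp only [indicator_of_notMem hx, h0 x hx, mul_zero]
      exact (hs (continuous_rampDeriv _) i1.aestronglyMeasurable fun x hx => by
        simp [(hfx x hx).2]).add (hs (contDiff_ramp _).continuous hg'.aestronglyMeasurable
          fun x hx => (hfx x hx).1)
    · refine (norm_add_le _ _).trans (add_le_add ?_ ?_)
      · rw [norm_mul, Real.norm_of_nonneg (rampDeriv_nonneg _ _), Real.norm_eq_abs]
        exact mul_le_of_le_one_left (abs_nonneg _) (rampDeriv_le_one _ _)
      · by_cases hx : x ∈ B
        · rw [norm_mul, Real.norm_of_nonneg (ramp_nonneg (hv0 x hx)), abs_mul,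
            abs_of_nonneg (hv0 x hx), Real.norm_eq_abs]
          exact mul_le_mul_of_nonneg_right (ramp_le (hv0 x hx)) (abs_nonneg _)
        · simp [(hfx x hx).1]
    · by_cases hx : x ∈ B
      · refine Tendsto.add ?_ ((tendsto_ramp hε0 hε (hv0 x hx)).mul_const _)
        by_cases hxV : x ∈ posSet B v
        · simpa using (tendsto_rampDeriv hε0 hε hxV.2).mul_const (G x i * g x)
        · simp [hG0 x hxV]
      · simp [hfx x hx]
  have hzero : ∫ x, (G x i * g x + v x * fderiv ℝ g x e) = 0 :=
    tendsto_nhds_unique hlim (by simp_rw [fun k => hramp (ε k) (hε0 k)]; exact tendsto_const_nhds)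
  rw [integral_add i1 i2] at hzero
  linarith

end WeakGradient

section Translation

variable {d : ℕ}

theorem setIntegral_eq_integral_comp_add {Ω : Set (Euc d)} {f : Euc d → ℝ}
    (hf : ∀ x, x ∉ Ω → f x = 0) (x₀ : Euc d) : ∫ x in Ω, f x = ∫ y, f (x₀ + y) := by
  rw [setIntegral_eq_integral_of_forall_compl_eq_zero hf, integral_add_left_eq_self f x₀]

theorem setIntegral_ball_eq_comp_add (f : Euc d → ℝ) (x₀ : Euc d) (r : ℝ) :
    ∫ x in ball x₀ r, f x = ∫ y in ball 0 r, f (x₀ + y) := by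
  rw [← integral_indicator measurableSet_ball, ← integral_indicator measurableSet_ball,
    ← integral_add_left_eq_self _ x₀]
  refine integral_congr_ae (Eventually.of_forall fun y => ?_)
  simp [indicator]

theorem ae_comp_add {P : Euc d → Prop} (h : ∀ᵐ x, P x) (x₀ : Euc d) : ∀ᵐ y, P (x₀ + y) :=
  (measurePreserving_add_left volume x₀).quasiMeasurePreserving.ae h

theorem tsupport_comp_sub_subset {E : Type*} [Zero E] (η : Euc d → E) (x₀ : Euc d) :
    tsupport (fun x => η (x - x₀)) ⊆ (fun x => x - x₀) ⁻¹' tsupport η :=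
  tsupport_comp_subset_preimage η (continuous_id.sub continuous_const)

theorem hasCompactSupport_comp_sub {E : Type*} [Zero E] [TopologicalSpace E] {η : Euc d → E}
    (hη : HasCompactSupport η) (x₀ : Euc d) : HasCompactSupport fun x => η (x - x₀) :=
  hη.comp_homeomorph (Homeomorph.subRight x₀)

theorem divergence_eq_zero_of_notMem {φ : Euc d → Euc d} {x : Euc d} (hx : x ∉ tsupport φ) :
    divergence φ x = 0 := by
  simp [divergence, fderiv_of_notMem_tsupport ℝ hx]

end Translation

namespace IsSubsonicVariationalSolution

variable {L : CompressibleLiquid} {d : ℕ} {Ω : Set (Euc d)} {u : Euc d → ℝ} {Du : Euc d → Euc d}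
  {x₀ : Euc d} {R : ℝ}

theorem integral_by_parts_comp_add (hu : IsSubsonicVariationalSolution L Ω u Du)
    (hR : ball x₀ R ⊆ Ω) {η : Euc d → ℝ} (hη : ContDiff ℝ ∞ η) (hηc : HasCompactSupport η)
    (hηR : tsupport η ⊆ ball 0 R) (i : Fin (d + 1)) :
    ∫ y, u (x₀ + y) * fderiv ℝ η y (EuclideanSpace.single i 1) = -∫ y, Du (x₀ + y) i * η y := by
  have hsub : tsupport (fun x => η (x - x₀)) ⊆ Ω := fun x hx => hR (by
    have := hηR (tsupport_comp_sub_subset η x₀ hx)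
    rwa [mem_ball_zero_iff, ← mem_ball_iff_norm] at this)
  have h1 := hu.memW12Loc.integral_by_parts (fun x => η (x - x₀))
    (hη.comp (contDiff_id.sub contDiff_const)) (hasCompactSupport_comp_sub hηc x₀) hsub i
  rw [setIntegral_eq_integral_comp_add (fun x hx => ?_) x₀,
    setIntegral_eq_integral_comp_add (fun x hx => ?_) x₀] at h1
  · simpa only [fderiv_comp_sub, add_sub_cancel_left] using h1
  · rw [image_eq_zero_of_notMem_tsupport fun h => hx (hsub h), mul_zero]
  · rw [fderiv_of_notMem_tsupport ℝ fun h => hx (hsub h)]; simp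

theorem domain_variation_comp_add (hu : IsSubsonicVariationalSolution L Ω u Du)
    (hR : ball x₀ R ⊆ Ω) (hx₀ : lastCoord x₀ = 0) {φ : Euc d → Euc d} (hφ : ContDiff ℝ 1 φ)
    (hφc : HasCompactSupport φ) (hφR : tsupport φ ⊆ ball 0 R) :
    (∫ y, (L.F (‖Du (x₀ + y)‖ ^ 2) (lastCoord y) + L.lam (lastCoord y) * chiPos u (x₀ + y)) *
        divergence φ y)
      - 2 * (∫ y, L.dF1 (‖Du (x₀ + y)‖ ^ 2) (lastCoord y) *
        inner ℝ (Du (x₀ + y)) (fderiv ℝ φ y (Du (x₀ + y))))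
      + (∫ y, (deriv L.lam (lastCoord y) * chiPos u (x₀ + y) +
        L.dF2 (‖Du (x₀ + y)‖ ^ 2) (lastCoord y)) * lastCoord (φ y)) = 0 := by
  have hlc : ∀ y, lastCoord (x₀ + y) = lastCoord y := fun y => by
    have : lastCoord (x₀ + y) = lastCoord x₀ + lastCoord y := rfl
    rw [this, hx₀, zero_add]
  have hsub : tsupport (fun x => φ (x - x₀)) ⊆ Ω := fun x hx => hR (by
    have := hφR (tsupport_comp_sub_subset φ x₀ hx)
    rwa [mem_ball_zero_iff, ← mem_ball_iff_norm] at this)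
  have hdiv : ∀ y, divergence (fun x => φ (x - x₀)) (x₀ + y) = divergence φ y := fun y => by
    simp only [divergence, fderiv_comp_sub, add_sub_cancel_left]
  have h1 := hu.domain_variation (fun x => φ (x - x₀))
    (hφ.comp (contDiff_id.sub contDiff_const)) (hasCompactSupport_comp_sub hφc x₀) hsub
  rw [setIntegral_eq_integral_comp_add (fun x hx => ?_) x₀,
    setIntegral_eq_integral_comp_add (fun x hx => ?_) x₀,
    setIntegral_eq_integral_comp_add (fun x hx => ?_) x₀] at h1
  · simpa only [fderiv_comp_sub, add_sub_cancel_left, hdiv, hlc] using h1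
  · have : φ (x - x₀) = 0 :=
      image_eq_zero_of_notMem_tsupport (f := fun x => φ (x - x₀)) fun h => hx (hsub h)
    rw [this]
    simp [lastCoord]
  · rw [fderiv_of_notMem_tsupport ℝ fun h => hx (hsub h)]; simp
  · rw [divergence_eq_zero_of_notMem fun h => hx (hsub h), mul_zero]

theorem exists_isLocalSolution (hu : IsSubsonicVariationalSolution L Ω u Du)
    (hgrowth : HasLocalGrowth Ω Du) (hx₀Ω : x₀ ∈ Ω) (hx₀ : lastCoord x₀ = 0) :
    ∃ R C δ K G, IsLocalSolution L R C δ K (fun y => u (x₀ + y)) G ∧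
      ∀ᵐ y, y ∈ ball (0 : Euc d) R → Du (x₀ + y) = G y := by
  obtain ⟨R₀, hR₀, hR₀Ω⟩ := Metric.nhds_basis_closedBall.mem_iff.1 (hu.isOpen.mem_nhds hx₀Ω)
  obtain ⟨C₀, hC₀⟩ := hgrowth _ hR₀Ω (isCompact_closedBall x₀ R₀)
  obtain ⟨δ, K, hreg⟩ := L.exists_regularNearZero
  have hδ := hreg.radius_pos
  set C := max C₀ 0 with hC
  have hC0 : 0 ≤ C := le_max_right _ _
  set R := min R₀ (δ / (2 * (C + 1))) with hRdef
  have hR : 0 < R := lt_min hR₀ (by positivity)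
  have hR2 : R * (2 * (C + 1)) ≤ δ := by
    have : R ≤ δ / (2 * (C + 1)) := min_le_right _ _
    rwa [le_div_iff₀ (by positivity)] at this
  have hball : ball x₀ R ⊆ closedBall x₀ R₀ :=
    ball_subset_closedBall.trans (closedBall_subset_closedBall (min_le_left _ _))
  have hΩ : ball x₀ R ⊆ Ω := hball.trans hR₀Ω
  have hmem : ∀ {y : Euc d}, y ∈ ball (0 : Euc d) R → x₀ + y ∈ ball x₀ R := fun {y} hy => by
    rw [mem_ball_iff_norm, add_sub_cancel_left]
    exact mem_ball_zero_iff.1 hy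
  have hlc : ∀ y, lastCoord (x₀ + y) = lastCoord y := fun y => by
    have : lastCoord (x₀ + y) = lastCoord x₀ + lastCoord y := rfl
    rw [this, hx₀, zero_add]
  set v : Euc d → ℝ := fun y => u (x₀ + y) with hv
  set D : Euc d → Euc d := fun y => Du (x₀ + y) with hD
  set G := posGradient (ball (0 : Euc d) R) v with hG
  have hvc : ContinuousOn v (ball 0 R) :=
    hu.continuousOn.comp (by fun_prop) fun y hy => hΩ (hmem hy)
  have hv0 : ∀ y ∈ ball (0 : Euc d) R, 0 ≤ v y := fun y hy => hu.nonneg _ (hΩ (hmem hy))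
  have hv2 : ContDiffOn ℝ 2 v (posSet (ball 0 R) v) :=
    hu.contDiffOn.comp (contDiff_const.add contDiff_id).contDiffOn
      fun y hy => ⟨hΩ (hmem hy.1), hy.2⟩
  have hv1 : ContDiffOn ℝ 1 v (posSet (ball 0 R) v) := hv2.of_le (by norm_num)
  have hDi : IntegrableOn D (ball 0 R) := by
    have : IsFiniteMeasure (volume.restrict (closedBall x₀ R₀)) :=
      ⟨by simpa using measure_closedBall_lt_top⟩
    have h1 : IntegrableOn Du (closedBall x₀ R₀) :=
      (hu.memW12Loc.memLp_grad _ hR₀Ω (isCompact_closedBall x₀ R₀)).integrable one_le_two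
    have h2 := ((measurePreserving_add_left volume x₀).integrableOn_comp_preimage
      (measurableEmbedding_addLeft x₀)).2 h1
    exact h2.mono_set fun y hy => hball (hmem hy)
  have hweak : ∀ η : Euc d → ℝ, ContDiff ℝ ∞ η → HasCompactSupport η →
      tsupport η ⊆ ball 0 R → ∀ i,
      ∫ x, v x * fderiv ℝ η x (EuclideanSpace.single i 1) = -∫ x, D x i * η x :=
    fun η h1 h2 h3 i => hu.integral_by_parts_comp_add hΩ h1 h2 h3 i
  have hDM : ∀ᵐ y, y ∈ ball (0 : Euc d) R → ‖D y‖ ^ 2 ≤ C * max (lastCoord y) 0 := by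
    filter_upwards [ae_comp_add ((ae_restrict_iff' measurableSet_closedBall).1 hC₀) x₀]
      with y hy hyR
    refine (hy (hball (hmem hyR))).trans ?_
    rw [hlc]
    exact mul_le_mul_of_nonneg_right (le_max_left _ _) (le_max_right _ _)
  have hGM : ∀ y ∈ ball (0 : Euc d) R, ‖G y‖ ^ 2 ≤ C * max (lastCoord y) 0 := fun y hy =>
    norm_posGradient_sq_le isOpen_ball hvc hv1
      (ae_eq_posGradient_on_posSet isOpen_ball hvc hv1 hDi.locallyIntegrableOn hweak)
      (M := fun y => C * max (lastCoord y) 0)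
      (continuous_const.mul (continuous_lastCoord.max continuous_const)) hDM
      (fun x _ => mul_nonneg hC0 (le_max_right _ _)) hy
  have hGb : ∀ y ∈ ball (0 : Euc d) R, ‖G y‖ ≤ √(C * R) := fun y hy => by
    refine Real.le_sqrt_of_sq_le ((hGM y hy).trans (mul_le_mul_of_nonneg_left ?_ hC0))
    exact max_le (((le_abs_self _).trans (abs_lastCoord_le y)).trans
      (mem_ball_zero_iff.1 hy).le) hR.le
  have hae := ae_eq_posGradient isOpen_ball measure_ball_lt_top hvc hv0 hv1
    hDi.locallyIntegrableOn hweak hGb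
  refine ⟨R, C, δ, K, G, ⟨hR, hC0, hreg, by nlinarith, by nlinarith, hvc, hv0, ?_, hv2, ?_, ?_,
    hGM, ?_⟩, hae⟩
  · intro y hy hy0
    exact hu.eq_zero _ (hΩ (hmem hy)) (by rwa [hlc])
  · intro y hy
    rw [hG, posGradient, indicator_of_mem hy]
    exact ((hv1.contDiffAt ((isOpen_posSet_of_continuousOn isOpen_ball hvc).mem_nhds
      hy)).differentiableAt one_ne_zero).hasGradientAt
  · exact fun y hy => indicator_of_notMem hy _
  · intro φ hφ hφc hφR
    have h1 := hu.domain_variation_comp_add hΩ hx₀ hφ hφc hφR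
    have hcong : ∀ {f g : Euc d → ℝ}, (∀ y, y ∉ tsupport φ → f y = 0) →
        (∀ y, y ∉ tsupport φ → g y = 0) → (∀ y, D y = G y → f y = g y) →
        ∫ y, f y = ∫ y, g y := fun {f g} hf hg hfg => by
      refine integral_congr_ae ?_
      filter_upwards [hae] with y hy
      by_cases hyφ : y ∈ tsupport φ
      · exact hfg y (hy (hφR hyφ))
      · rw [hf y hyφ, hg y hyφ]
    rw [← h1]
    have hφ0 : ∀ y, y ∉ tsupport φ → lastCoord (φ y) = 0 := fun y hy => by
      rw [image_eq_zero_of_notMem_tsupport hy]; simp [lastCoord]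
    congr 1
    · congr 1
      · refine hcong (fun y hy => ?_) (fun y hy => ?_) fun y hy => ?_
        · rw [divergence_eq_zero_of_notMem hy, mul_zero]
        · rw [divergence_eq_zero_of_notMem hy, mul_zero]
        · rw [← hy]; rfl
      · congr 1
        refine hcong (fun y hy => ?_) (fun y hy => ?_) fun y hy => ?_
        · simp [fderiv_of_notMem_tsupport ℝ hy]
        · simp [fderiv_of_notMem_tsupport ℝ hy]
        · rw [← hy]
    · refine hcong (fun y hy => ?_) (fun y hy => ?_) fun y hy => ?_
      · rw [hφ0 y hy, mul_zero]
      · rw [hφ0 y hy, mul_zero]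
      · rw [← hy]; rfl

end IsSubsonicVariationalSolution

end

theorem mainTheorem12 (L : CompressibleLiquid) (d : ℕ) (hd : 1 ≤ d) (Ω : Set (Euc d))
    (u : Euc d → ℝ) (Du : Euc d → Euc d) (hu : IsSubsonicVariationalSolution L Ω u Du)
    (hgrowth : HasLocalGrowth Ω Du)
    (x₀ : Euc d) (hx₀Ω : x₀ ∈ Ω) (hx₀ : x₀ ∈ frontier (posSet Ω u)) (hx₀n : lastCoord x₀ = 0) :
    (∃ ℓ : ℝ, Tendsto (fun r => weissPhi L u Du x₀ r) (𝓝[>] 0) (𝓝 ℓ)) ∧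
    ∀ r : ℕ → ℝ, (∀ m, 0 < r m) → Tendsto r atTop (𝓝 0) →
      ∀ (u₀ : Euc d → ℝ) (Du₀ : Euc d → Euc d), MemW12Loc univ u₀ Du₀ →
        TendstoWeaklyW12Loc (fun m => blowUp u x₀ (r m)) (fun m => blowUpGrad Du x₀ (r m))
          u₀ Du₀ →
        (∃ w : Euc d → ℝ, u₀ =ᵐ[volume] w ∧
          ∀ c : ℝ, 0 < c → ∀ x, w (c • x) = c ^ (3 / 2 : ℝ) * w x) ∧
        TendstoStronglyW12Loc (fun m => blowUp u x₀ (r m)) (fun m => blowUpGrad Du x₀ (r m))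
          u₀ Du₀ := by
  obtain ⟨R, C, δ, K, G, h, hae⟩ := hu.exists_isLocalSolution hgrowth hx₀Ω hx₀n
  have hlc : ∀ y, lastCoord (x₀ + y) = lastCoord y := fun y => by
    have : lastCoord (x₀ + y) = lastCoord x₀ + lastCoord y := rfl
    rw [this, hx₀n, zero_add]
  refine ⟨?_, fun r hr hr0 u₀ Du₀ hu₀ hweak => ?_⟩
  · obtain ⟨ℓ, hℓ⟩ := h.tendsto_weissPhi
    refine ⟨ℓ, hℓ.congr' ?_⟩
    filter_upwards [Ioo_mem_nhdsGT h.radius_pos] with s hs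
    have hU : weissU L (fun y => u (x₀ + y)) G 0 s = weissU L u Du x₀ s := by
      rw [weissU, weissU, setIntegral_ball_eq_comp_add _ x₀]
      congr 1
      refine setIntegral_congr_ae measurableSet_ball ?_
      filter_upwards [hae] with y hy hys
      rw [hy (ball_subset_ball hs.2.le hys), hlc]
      rfl
    have hW : weissW L (fun y => u (x₀ + y)) 0 s = weissW L u x₀ s := by
      simp only [weissW, sphereIntegral, zero_add]
    rw [weissPhi, weissPhi, hU, hW]
  · have hv : ∀ m, blowUp (fun y => u (x₀ + y)) 0 (r m) = blowUp u x₀ (r m) := fun m => by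
      funext x; simp only [blowUp, zero_add]
    have hG : ∀ N : ℝ, ∀ᶠ m in atTop, blowUpGrad Du x₀ (r m)
        =ᵐ[volume.restrict (ball 0 N)] blowUpGrad G 0 (r m) := fun N => by
      have hrN : Tendsto (fun m => r m * N) atTop (𝓝 0) := by simpa using hr0.mul_const N
      filter_upwards [hrN.eventually_lt_const h.radius_pos] with m hm
      have hq : Measure.QuasiMeasurePreserving (fun x : Euc d => r m • x) volume volume :=
        Measure.quasiMeasurePreserving_smul volume (hr m).ne'
      filter_upwards [ae_restrict_mem measurableSet_ball, ae_restrict_of_ae (hq.ae hae)]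
        with x hx h1
      rw [blowUpGrad, blowUpGrad, zero_add, h1]
      rw [mem_ball_zero_iff] at *
      rw [norm_smul, Real.norm_of_nonneg (hr m).le]
      exact (mul_lt_mul_of_pos_left hx (hr m)).trans hm
    have hweak' : TendstoWeaklyW12Loc (fun m => blowUp (fun y => u (x₀ + y)) 0 (r m))
        (fun m => blowUpGrad G 0 (r m)) u₀ Du₀ := by
      intro N hN
      simp only [hv]
      refine ⟨(hweak N hN).1, fun f hf => ((hweak N hN).2 f hf).congr' ?_⟩
      filter_upwards [hG N] with m hm
      refine integral_congr_ae ?_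
      filter_upwards [hm] with x hx
      rw [hx]
    obtain ⟨hhom, hstrong⟩ := h.blowUp_convergence hr hr0 hu₀ hweak'
    refine ⟨hhom, fun N hN => ?_⟩
    have h1 := hstrong N hN
    simp only [hv] at h1
    refine ⟨h1.1, h1.2.congr' ?_⟩
    filter_upwards [hG N] with m hm
    exact eLpNorm_congr_ae (hm.symm.sub (ae_eq_refl Du₀))
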